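/- An argumentation framework (AF) $F=\langle\mathcal A,\mathcal R\rangle$ consists of a set $\mathcal A$ of arguments and a set $\mathcal R\subseteq\mathcal A\times\mathcal A$ of attacks. A set $S\subseteq\mathcal A$ is conflict-free if no element of $S$ attacks an element of $S$, and it defends $a\in\mathcal A$ if every attacker of $a$ is attacked by some element of $S$. $S$ is an admissible ($\mathtt{ad}$) extension if it is conflict-free and defends all of its elements; a stable ($\mathtt{st}$) extension if it is conflict-free and the set of arguments it attacks is $\mathcal A\setminus S$; a complete ($\mathtt{co}$) extension if it is admissible and contains every argument it defends; a grounded ($\mathtt{gr}$) extension if it is $\subseteq$-minimal among the complete extensions; a preferred ($\mathtt{pr}$) extension if it is $\subseteq$-maximal among the admissible extensions. For a semantics $\sigma\in\{\mathtt{ad},\mathtt{st},\mathtt{co},\mathtt{gr},\mathtt{pr}\}$, a set $S$ is $\sigma$-$true$ in $F$ if it is a $\sigma$-extension of $F$ (in particular $S\subseteq\mathcal A$), and $\sigma$-$false$ in $F$ otherwise. An incomplete argumentation framework (IAF) $I=\langle\mathcal A,\mathcal A^?,\mathcal R,\mathcal R^?\rangle$ consists of disjoint sets $\mathcal A$, $\mathcal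 A^?$ (certain and uncertain arguments) and disjoint sets $\mathcal R,\mathcal R^?\subseteq(\mathcal A\cup\mathcal A^?)\times(\mathcal A\cup\mathcal A^?)$ (certain and uncertain attacks). Put $\mathrm{cert}(I)=\langle\mathcal A,\mathcal R\cap(\mathcal A\times\mathcal A)\rangle$. A partial completion of $I$ is an IAF $I'=\langle\mathcal A',\mathcal A^{?\prime},\mathcal R',\mathcal R^{?\prime}\rangle$ with $\mathcal A\subseteq\mathcal A'\subseteq\mathcal A\cup\mathcal A^?$, $\mathcal R\cap\big((\mathcal A'\cup\mathcal A^{?\prime})\times(\mathcal A'\cup\mathcal A^{?\prime})\big)\subseteq\mathcal R'\subseteq\mathcal R\cup\mathcal R^?$, $\mathcal A^{?\prime}\subseteq\mathcal A^?$ and $\mathcal R^{?\prime}\subseteq\mathcal R^?$. For an uncertain element $e\in\mathcal A^?\cup\mathcal R^?$, $I+\{e\}$ is obtained from $I$ by making $e$ certain, and $I-\{e\}$ by deleting $e$, together with all certain and uncertain attacks that involve $e$ if $e$ is an argument. Let $S\subseteq\mathcal A\cup\mathcal A^?$, $e\in\mathcal A^?\cup\mathcal R^?$ and $j$ a status $\sigma$-$true$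 or $\sigma$-$false$. Addition (resp. removal) of $e$ is $j$-relevant for $S$ w.r.t. $I$ if there is a partial completion $I'$ of $I$ whose only uncertain element is $e$, such that $S$ is $j$ in $\mathrm{cert}(I'+\{e\})$ (resp. $\mathrm{cert}(I'-\{e\})$) and $S$ is not $j$ in $\mathrm{cert}(I'-\{e\})$ (resp. $\mathrm{cert}(I'+\{e\})$). For fixed $j$, the decision problem $j$-RELEVANCE is: given a finite IAF $I$, a set $S\subseteq\mathcal A\cup\mathcal A^?$, an action $\mathbf a\in\{\text{addition},\text{removal}\}$ and an uncertain element $e\in\mathcal A^?\cup\mathcal R^?$, is $\mathbf a$ of $e$ $j$-relevant for $S$ w.r.t. $I$? Then: 1. for $j\in\{\mathtt{ad},\mathtt{st},\mathtt{co},\mathtt{gr}\}\times\{true,false\}$, $j$-RELEVANCE is in $\mathrm{NP}$; and 2. $\mathtt{pr}$-$true$-RELEVANCE and $\mathtt{pr}$-$false$-RELEVANCE are in $\Sigma_2^p$. -/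

import Mathlib

/-! ### Abstract argumentation frameworks -/

/-- An abstract argumentation framework: a set of arguments with an attack relation on it. -/
structure AF (α : Type) where
  args : Set α
  att : Set (α × α)
  att_subset : att ⊆ args ×ˢ args

namespace AF

variable {α : Type}

/-- `S⁺`: the arguments attacked by `S`. -/
def plus (F : AF α) (S : Set α) : Set α :=
  {a | a ∈ F.args ∧ ∃ b ∈ S, (b, a) ∈ F.att}

def ConflictFree (F : AF α) (S : Set α) : Prop :=
  S ∩ F.plus S = ∅

/-- The characteristic function: the arguments all of whose attackers are attacked by `S`. -/
def defended (F : AF α) (S : Set α) : Set α :=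
  {a | a ∈ F.args ∧ ∀ b, (b, a) ∈ F.att → ∃ c ∈ S, (c, b) ∈ F.att}

def admissible (F : AF α) : Set (Set α) :=
  {S | S ⊆ F.args ∧ F.ConflictFree S ∧ S ⊆ F.defended S}

def stable (F : AF α) : Set (Set α) :=
  {S | S ⊆ F.args ∧ F.ConflictFree S ∧ F.plus S = F.args \ S}

def complete (F : AF α) : Set (Set α) :=
  {S | S ∈ F.admissible ∧ ∀ a ∈ F.defended S, a ∈ S}

/-- Inclusion-minimal complete sets. -/
def grounded (F : AF α) : Set (Set α) :=
  {S | Minimal (fun T => T ∈ F.complete) S}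

/-- Inclusion-maximal admissible sets. -/
def preferred (F : AF α) : Set (Set α) :=
  {S | Maximal (fun T => T ∈ F.admissible) S}

end AF

/-- The five semantics: admissible, stable, complete, grounded, preferred. -/
inductive Semantics
  | ad
  | st
  | co
  | gr
  | pr

/-- The `σ`-extensions of an argumentation framework. -/
def Semantics.extensions {α : Type} : Semantics → AF α → Set (Set α)
  | .ad, F => F.admissible
  | .st, F => F.stable
  | .co, F => F.complete
  | .gr, F => F.grounded
  | .pr, F => F.preferred

/-- `S` has verification status `(σ, true)` in `F` iff it is a `σ`-extension of `F`, and status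
`(σ, false)` iff it is not. -/
def AF.HasStatus {α : Type} (F : AF α) (j : Semantics × Bool) (S : Set α) : Prop :=
  match j with
  | (σ, true) => S ∈ σ.extensions F
  | (σ, false) => S ∉ σ.extensions F

/-! ### Incomplete argumentation frameworks -/

/-- An incomplete argumentation framework `⟨A, A?, R, R?⟩`. -/
structure IAF (α : Type) where
  args : Set α
  uargs : Set α
  att : Set (α × α)
  uatt : Set (α × α)
  args_disjoint : Disjoint args uargs
  att_disjoint : Disjoint att uatt
  att_subset : att ⊆ (args ∪ uargs) ×ˢ (args ∪ uargs)
  uatt_subset : uatt ⊆ (args ∪ uargs) ×ˢ (args ∪ uargs)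

namespace IAF

variable {α : Type}

/-- The partial completions of `I`. -/
def part (I : IAF α) : Set (IAF α) :=
  {I' | (I.args ⊆ I'.args ∧ I'.args ⊆ I.args ∪ I.uargs) ∧
    (I.att ∩ ((I'.args ∪ I'.uargs) ×ˢ (I'.args ∪ I'.uargs)) ⊆ I'.att ∧
      I'.att ⊆ I.att ∪ I.uatt) ∧
    I'.uargs ⊆ I.uargs ∧ I'.uatt ⊆ I.uatt}

/-- The argumentation framework given by the certain part of `I`. -/
def cert (I : IAF α) : AF α where
  args := I.args
  att := I.att ∩ (I.args ×ˢ I.args)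
  att_subset := Set.inter_subset_right

/-- The uncertain elements of `I`: its uncertain arguments (`Sum.inl`) and its uncertain attacks
(`Sum.inr`). -/
def uncertain (I : IAF α) : Set (α ⊕ α × α) :=
  Sum.inl '' I.uargs ∪ Sum.inr '' I.uatt

theorem mem_uargs {I : IAF α} {a : α} (h : Sum.inl a ∈ I.uncertain) : a ∈ I.uargs := by
  simpa [uncertain] using h

theorem mem_uatt {I : IAF α} {r : α × α} (h : Sum.inr r ∈ I.uncertain) : r ∈ I.uatt := by
  simpa [uncertain] using h

/-- `I + R₀`. -/
def addAtts (I : IAF α) (R₀ : Set (α × α)) (h : R₀ ⊆ I.uatt) : IAF α where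
  args := I.args
  uargs := I.uargs
  att := I.att ∪ R₀
  uatt := I.uatt \ R₀
  args_disjoint := I.args_disjoint
  att_disjoint := Set.disjoint_union_left.2
    ⟨I.att_disjoint.mono_right Set.sdiff_subset, Set.disjoint_sdiff_right⟩
  att_subset := Set.union_subset I.att_subset (h.trans I.uatt_subset)
  uatt_subset := Set.sdiff_subset.trans I.uatt_subset

/-- `I - R₀`. -/
def removeAtts (I : IAF α) (R₀ : Set (α × α)) : IAF α where
  args := I.args
  uargs := I.uargs
  att := I.att
  uatt := I.uatt \ R₀
  args_disjoint := I.args_disjoint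
  att_disjoint := I.att_disjoint.mono_right Set.sdiff_subset
  att_subset := I.att_subset
  uatt_subset := Set.sdiff_subset.trans I.uatt_subset

/-- `I + A₀`. -/
def addArgs (I : IAF α) (A₀ : Set α) (h : A₀ ⊆ I.uargs) : IAF α where
  args := I.args ∪ A₀
  uargs := I.uargs \ A₀
  att := I.att
  uatt := I.uatt
  args_disjoint := Set.disjoint_union_left.2
    ⟨I.args_disjoint.mono_right Set.sdiff_subset, Set.disjoint_sdiff_right⟩
  att_disjoint := I.att_disjoint
  att_subset := by
    rw [Set.union_assoc, Set.union_sdiff_cancel h]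
    exact I.att_subset
  uatt_subset := by
    rw [Set.union_assoc, Set.union_sdiff_cancel h]
    exact I.uatt_subset

/-- The attacks that start or end in `A₀`. -/
def related (A₀ : Set α) : Set (α × α) :=
  {r | r.1 ∈ A₀ ∨ r.2 ∈ A₀}

theorem diff_related_subset {A U A₀ : Set α} {R : Set (α × α)}
    (hR : R ⊆ (A ∪ U) ×ˢ (A ∪ U)) :
    R \ related A₀ ⊆ (A ∪ U \ A₀) ×ˢ (A ∪ U \ A₀) := by
  rintro ⟨a, b⟩ ⟨hab, hn⟩
  have h := hR hab
  simp only [related, Set.mem_ofPred_eq, not_or] at hn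
  simp only [Set.mem_prod, Set.mem_union, Set.mem_sdiff] at h ⊢
  tauto

/-- `I - A₀`: the uncertain arguments in `A₀` disappear, with all attacks related to them. -/
def removeArgs (I : IAF α) (A₀ : Set α) : IAF α where
  args := I.args
  uargs := I.uargs \ A₀
  att := I.att \ related A₀
  uatt := I.uatt \ related A₀
  args_disjoint := I.args_disjoint.mono_right Set.sdiff_subset
  att_disjoint := I.att_disjoint.mono Set.sdiff_subset Set.sdiff_subset
  att_subset := diff_related_subset I.att_subset
  uatt_subset := diff_related_subset I.uatt_subset

/-- `I + {e}` for an uncertain element `e`. -/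
def addElem (I : IAF α) : (e : α ⊕ α × α) → e ∈ I.uncertain → IAF α
  | .inl a, h => I.addArgs {a} (Set.singleton_subset_iff.2 (mem_uargs h))
  | .inr r, h => I.addAtts {r} (Set.singleton_subset_iff.2 (mem_uatt h))

/-- `I - {e}` for an uncertain element `e`. -/
def removeElem (I : IAF α) : α ⊕ α × α → IAF α
  | .inl a => I.removeArgs {a}
  | .inr r => I.removeAtts {r}

end IAF

inductive RelAction
  | addition
  | removal

/-- `action` of the uncertain element `e` is `j`-relevant for `S` with respect to `I`. -/
def IAF.Relevant {α : Type} (I : IAF α) (S : Set α) (j : Semantics × Bool)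
    (action : RelAction) (e : α ⊕ α × α) : Prop :=
  ∃ I' ∈ I.part, ∃ he : e ∈ I'.uncertain, I'.uncertain = {e} ∧
    match action with
    | .addition =>
        (I'.addElem e he).cert.HasStatus j S ∧ ¬ (I'.removeElem e).cert.HasStatus j S
    | .removal =>
        (I'.removeElem e).cert.HasStatus j S ∧ ¬ (I'.addElem e he).cert.HasStatus j S

/-! ### The decision problem -/

/-- In instances, arguments are named by arbitrary bit strings. -/
abbrev ArgName : Type := List Bool

/-- The data of an instance. The finite sets `A`, `A?`, `R`, `R?`, `S` are given as lists of
their elements, in any order. -/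
structure RelevanceInput where
  args : List ArgName
  uargs : List ArgName
  att : List (ArgName × ArgName)
  uatt : List (ArgName × ArgName)
  target : List ArgName
  action : RelAction
  elem : ArgName ⊕ ArgName × ArgName

/-- The input alphabet: bits, an end marker for names and an end marker for lists. -/
inductive InputSymbol
  | bit (b : Bool)
  | endName
  | endList

namespace RelevanceInput

def encodeName (a : ArgName) : List InputSymbol :=
  a.map InputSymbol.bit ++ [InputSymbol.endName]

def encodeAtt (r : ArgName × ArgName) : List InputSymbol :=
  encodeName r.1 ++ encodeName r.2

def encodeNames (l : List ArgName) : List InputSymbol :=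
  l.flatMap encodeName ++ [InputSymbol.endList]

def encodeAtts (l : List (ArgName × ArgName)) : List InputSymbol :=
  l.flatMap encodeAtt ++ [InputSymbol.endList]

def encodeAction : RelAction → List InputSymbol
  | .addition => [InputSymbol.bit true]
  | .removal => [InputSymbol.bit false]

def encodeElem : ArgName ⊕ ArgName × ArgName → List InputSymbol
  | .inl a => InputSymbol.bit false :: encodeName a
  | .inr r => InputSymbol.bit true :: encodeAtt r

/-- The word that encodes an instance. -/
def encode (X : RelevanceInput) : List InputSymbol :=
  encodeNames X.args ++ (encodeNames X.uargs ++ (encodeAtts X.att ++ (encodeAtts X.uatt ++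
    (encodeNames X.target ++ (encodeAction X.action ++ encodeElem X.elem)))))

theorem encodeName_append_inj {a b : ArgName} {u v : List InputSymbol}
    (h : encodeName a ++ u = encodeName b ++ v) : a = b ∧ u = v := by
  induction a generalizing b with
  | nil => cases b <;> simp_all [encodeName]
  | cons x a ih =>
    cases b with
    | nil => simp [encodeName] at h
    | cons y b =>
      simp only [encodeName, List.map_cons, List.cons_append, List.cons.injEq,
        InputSymbol.bit.injEq] at h
      obtain ⟨h1, h2⟩ := ih h.2
      exact ⟨by rw [h.1, h1], h2⟩

theorem encodeAtt_append_inj {r s : ArgName × ArgName} {u v : List InputSymbol}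
    (h : encodeAtt r ++ u = encodeAtt s ++ v) : r = s ∧ u = v := by
  simp only [encodeAtt, List.append_assoc] at h
  obtain ⟨h1, h2⟩ := encodeName_append_inj h
  obtain ⟨h3, h4⟩ := encodeName_append_inj h2
  exact ⟨Prod.ext h1 h3, h4⟩

theorem encodeName_head_ne (a : ArgName) (u v : List InputSymbol) :
    encodeName a ++ u ≠ InputSymbol.endList :: v := by
  cases a <;> simp [encodeName]

theorem encodeNames_append_inj {k l : List ArgName} {u v : List InputSymbol}
    (h : encodeNames k ++ u = encodeNames l ++ v) : k = l ∧ u = v := by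
  induction k generalizing l with
  | nil =>
    cases l with
    | nil => simpa [encodeNames] using h
    | cons b l =>
      simp only [encodeNames, List.flatMap_cons, List.flatMap_nil, List.nil_append,
        List.append_assoc, List.cons_append] at h
      exact absurd h.symm (encodeName_head_ne _ _ _)
  | cons a k ih =>
    cases l with
    | nil =>
      simp only [encodeNames, List.flatMap_cons, List.flatMap_nil, List.nil_append,
        List.append_assoc, List.cons_append] at h
      exact absurd h (encodeName_head_ne _ _ _)
    | cons b l =>
      simp only [encodeNames, List.flatMap_cons, List.append_assoc] at h ih
      obtain ⟨h1, h2⟩ := encodeName_append_inj h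
      obtain ⟨h3, h4⟩ := ih h2
      exact ⟨by rw [h1, h3], h4⟩

theorem encodeAtts_append_inj {k l : List (ArgName × ArgName)} {u v : List InputSymbol}
    (h : encodeAtts k ++ u = encodeAtts l ++ v) : k = l ∧ u = v := by
  induction k generalizing l with
  | nil =>
    cases l with
    | nil => simpa [encodeAtts] using h
    | cons b l =>
      simp only [encodeAtts, encodeAtt, List.flatMap_cons, List.flatMap_nil, List.nil_append,
        List.append_assoc, List.cons_append] at h
      exact absurd h.symm (encodeName_head_ne _ _ _)
  | cons a k ih =>
    cases l with
    | nil =>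
      simp only [encodeAtts, encodeAtt, List.flatMap_cons, List.flatMap_nil, List.nil_append,
        List.append_assoc, List.cons_append] at h
      exact absurd h (encodeName_head_ne _ _ _)
    | cons b l =>
      simp only [encodeAtts, List.flatMap_cons, List.append_assoc] at h ih
      obtain ⟨h1, h2⟩ := encodeAtt_append_inj h
      obtain ⟨h3, h4⟩ := ih h2
      exact ⟨by rw [h1, h3], h4⟩

theorem encodeElem_injective : Function.Injective encodeElem := by
  rintro (a | r) (b | s) h <;> simp only [encodeElem, List.cons.injEq, InputSymbol.bit.injEq,
    true_and, reduceCtorEq, false_and] at h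
  · exact congrArg _ (encodeName_append_inj (congrArg (· ++ []) h)).1
  · exact congrArg _ (encodeAtt_append_inj (congrArg (· ++ []) h)).1

/-- Instances can be recovered from their encodings. -/
theorem encode_injective : Function.Injective encode := by
  rintro ⟨A, U, R, Q, T, c, e⟩ ⟨A', U', R', Q', T', c', e'⟩ h
  simp only [encode] at h
  obtain ⟨h1, k1⟩ := encodeNames_append_inj h
  obtain ⟨h2, k2⟩ := encodeNames_append_inj k1
  obtain ⟨h3, k3⟩ := encodeAtts_append_inj k2
  obtain ⟨h4, k4⟩ := encodeAtts_append_inj k3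
  obtain ⟨h5, k5⟩ := encodeNames_append_inj k4
  have k6 : c = c' ∧ encodeElem e = encodeElem e' := by
    cases c <;> cases c' <;> simpa [encodeAction] using k5
  rw [h1, h2, h3, h4, h5, k6.1, encodeElem_injective k6.2]

/-- The lists of `X` enumerate the components of the incomplete argumentation framework `I`. -/
def Describes (X : RelevanceInput) (I : IAF ArgName) : Prop :=
  I.args = {a | a ∈ X.args} ∧ I.uargs = {a | a ∈ X.uargs} ∧
    I.att = {r | r ∈ X.att} ∧ I.uatt = {r | r ∈ X.uatt}

/-- The set of arguments whose verification status is considered. -/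
def targetSet (X : RelevanceInput) : Set ArgName :=
  {a | a ∈ X.target}

end RelevanceInput

/-- The decision problem `j`-RELEVANCE, as the language of the encodings of its yes-instances. -/
def relevanceProblem (j : Semantics × Bool) : Set (List InputSymbol) :=
  {w | ∃ (X : RelevanceInput) (I : IAF ArgName), w = X.encode ∧ X.Describes I ∧
    X.targetSet ⊆ I.args ∪ I.uargs ∧ X.elem ∈ I.uncertain ∧
    I.Relevant X.targetSet j X.action X.elem}

/-! ### Complexity classes -/

open Classical in
/-- `P` is decided in polynomial time by a (multi-stack) Turing machine, on inputs encoded by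
`enc`. The alphabet is finite, because that of the input stack of a machine is. -/
def PolyTimeDecidable {α Γ : Type} (enc : α → List Γ) (P : α → Prop) : Prop :=
  Nonempty (Turing.TM2ComputableInPolyTime enc Computability.encodeBool
    (fun x => decide (P x)))

/-- The language `L` is in NP: it has a polynomial-time verifier with certificates of polynomial
length. -/
def InNP {Γ : Type} (L : Set (List Γ)) : Prop :=
  ∃ (p : Polynomial ℕ) (V : List Γ × List Bool → Prop),
    PolyTimeDecidable
      (Computability.encodingProd (Computability.encodingList Γ)
        (Computability.encodingList Bool)).encode V ∧
    ∀ w, w ∈ L ↔ ∃ y : List Bool, y.length ≤ p.eval w.length ∧ V (w, y)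

/-- The language `L` is in `Σ₂ᵖ`, the second existential level of the polynomial hierarchy. -/
def InSigmaTwo {Γ : Type} (L : Set (List Γ)) : Prop :=
  ∃ (p : Polynomial ℕ) (V : List Γ × List Bool × List Bool → Prop),
    PolyTimeDecidable
      (Computability.encodingProd (Computability.encodingList Γ)
        (Computability.encodingProd (Computability.encodingList Bool)
          (Computability.encodingList Bool))).encode V ∧
    ∀ w, w ∈ L ↔ ∃ y : List Bool, y.length ≤ p.eval w.length ∧
      ∀ z : List Bool, z.length ≤ p.eval w.length → V (w, y, z)

/-! ### Structured programs on stacks -/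

/-! Relevance asks for one pair of frameworks, `F = cert (I' + {e})` and `G = cert (I' - {e})`, such
that `S` is an extension of one and not of the other; which way round depends on the action and the
truth value (`IAF.relevant_iff`). The pair itself can be guessed: by `IAF.completesTo_iff`, whether
it comes from a partial completion is decided by finitely many conditions whose quantifiers range
over the listed arguments and attacks.

It remains to certify the two claims about `S`. For admissible, stable and complete sets, both are
again such bounded first-order conditions. That `S` is not grounded, or not preferred, is witnessed
by a failure of completeness, or of admissibility, or by a guessed competitor `W`. That `S` is
grounded is witnessed by a strict order in which every attack on an element of `S` is answered by an
earlier element: well-founded induction then leaves no smaller complete set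
(`AF.Ranked.mem_grounded`), and conversely the stages of the fixed point iteration provide such an
order (`AF.exists_ranked`). Only for "`S` is preferred" does the verification range over all
competitors; this is the universal quantifier of `Σ₂ᵖ`.

Hence for every semantics and truth value the verifier is one fixed first-order formula in four
variables, `Fm.relevance`, evaluated over lists of pairs of names. Nested loops evaluate a fixed
formula in polynomial time (`Fm.run_eval`). The loops are written as structured stack commands,
which translate to multi-stack machines at the price of one step per loop test (`Run.evalsTo`).

The lists are read by a finite automaton with output (`reader`). It rejects malformed instances and
certificates and accepts malformed challenges, which are thereby harmless under the universal
quantifier. All guessed lists are sublists of lists built from the instance, so certificates have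
polynomial length. The pieces are joined in `inNP_of_formula` and `inSigmaTwo_of_formula`. -/

namespace StackProgram

/-- A store: finite memory, an input stack, an output stack, and work stacks. -/
structure Store (Γ W σ : Type) where
  mem : σ
  inp : List Γ
  out : List Bool
  wk : W → List (Option Bool)

/-- Basic operations. The operation `push w f` pushes only if `f` returns a symbol. -/
inductive Op (Γ W σ : Type)
  | popInput (f : σ → Option Γ → σ)
  | pushOutput (f : σ → Bool)
  | push (w : W) (f : σ → Option (Option Bool))
  | pop (w : W) (f : σ → Option (Option Bool) → σ)
  | peek (w : W) (f : σ → Option (Option Bool) → σ)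
  | load (f : σ → σ)

inductive Cmd (Γ W σ : Type)
  | op (o : Op Γ W σ)
  | seq (c d : Cmd Γ W σ)
  | ite (p : σ → Bool) (c d : Cmd Γ W σ)
  | loop (p : σ → Bool) (c : Cmd Γ W σ)

variable {Γ W σ : Type}

namespace Cmd

/-- The labels of a command: its loops. -/
def Label : Cmd Γ W σ → Type
  | .op _ => Empty
  | .seq c d => c.Label ⊕ d.Label
  | .ite _ c d => c.Label ⊕ d.Label
  | .loop _ c => Option c.Label

theorem finite_label : ∀ c : Cmd Γ W σ, Finite c.Label
  | .op _ => inferInstanceAs (Finite Empty)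
  | .seq c d =>
    have := finite_label c
    have := finite_label d
    inferInstanceAs (Finite (c.Label ⊕ d.Label))
  | .ite _ c d =>
    have := finite_label c
    have := finite_label d
    inferInstanceAs (Finite (c.Label ⊕ d.Label))
  | .loop _ c =>
    have := finite_label c
    inferInstanceAs (Finite (Option c.Label))

end Cmd

variable [DecidableEq W]

def Op.exec (s : Store Γ W σ) : Op Γ W σ → Store Γ W σ
  | .popInput f => { s with mem := f s.mem s.inp.head?, inp := s.inp.tail }
  | .pushOutput f => { s with out := f s.mem :: s.out }
  | .push w f => { s with wk := Function.update s.wk w ((f s.mem).toList ++ s.wk w) }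
  | .pop w f =>
    { s with mem := f s.mem (s.wk w).head?, wk := Function.update s.wk w (s.wk w).tail }
  | .peek w f => { s with mem := f s.mem (s.wk w).head? }
  | .load f => { s with mem := f s.mem }

/-- `Run c s s' n`: started in `s`, the command `c` ends in `s'` after at most `n` jumps. -/
inductive Run : Cmd Γ W σ → Store Γ W σ → Store Γ W σ → ℕ → Prop
  | op (o : Op Γ W σ) (s : Store Γ W σ) (n : ℕ) : Run (.op o) s (o.exec s) n
  | seq {c d : Cmd Γ W σ} {s t u : Store Γ W σ} {m n k : ℕ} :
      Run c s t m → Run d t u n → m + n ≤ k → Run (.seq c d) s u k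
  | ite_true {p : σ → Bool} {c d : Cmd Γ W σ} {s t : Store Γ W σ} {n : ℕ} :
      p s.mem = true → Run c s t n → Run (.ite p c d) s t n
  | ite_false {p : σ → Bool} {c d : Cmd Γ W σ} {s t : Store Γ W σ} {n : ℕ} :
      p s.mem = false → Run d s t n → Run (.ite p c d) s t n
  | loop_done {p : σ → Bool} {c : Cmd Γ W σ} {s : Store Γ W σ} {n : ℕ} :
      p s.mem = false → 1 ≤ n → Run (.loop p c) s s n
  | loop_step {p : σ → Bool} {c : Cmd Γ W σ} {s t u : Store Γ W σ} {m n k : ℕ} :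
      p s.mem = true → Run c s t m → Run (.loop p c) t u n → m + n + 1 ≤ k →
      Run (.loop p c) s u k

theorem Run.mono {c : Cmd Γ W σ} {s t : Store Γ W σ} {m n : ℕ} (h : Run c s t m) (hmn : m ≤ n) :
    Run c s t n := by
  induction h generalizing n with
  | op o s => exact .op o s n
  | seq h1 h2 hk => exact .seq h1 h2 (hk.trans hmn)
  | ite_true hp _ ih => exact .ite_true hp (ih hmn)
  | ite_false hp _ ih => exact .ite_false hp (ih hmn)
  | loop_done hp h1 => exact .loop_done hp (h1.trans hmn)
  | loop_step hp h1 h2 hk => exact .loop_step hp h1 h2 (hk.trans hmn)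

theorem Run.op_of_eq {o : Op Γ W σ} {s t : Store Γ W σ} (n : ℕ) (h : o.exec s = t) :
    Run (.op o) s t n :=
  h ▸ .op o s n

/-! ### Translation of commands to multi-stack machines. -/

inductive StackIndex (W : Type)
  | input
  | output
  | work (w : W)
  deriving DecidableEq, Fintype

def Alphabet (Γ : Type) {W : Type} : StackIndex W → Type
  | .input => Γ
  | .output => Bool
  | .work _ => Option Bool

def Store.stacks (s : Store Γ W σ) : ∀ k, List (Alphabet Γ (W := W) k)
  | .input => s.inp
  | .output => s.out
  | .work w => s.wk w

variable {Λ : Type}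

abbrev MachineStmt (Γ W σ Λ : Type) : Type :=
  Turing.TM2.Stmt (Alphabet Γ (W := W)) Λ σ

def Op.stmt (q : MachineStmt Γ W σ Λ) : Op Γ W σ → MachineStmt Γ W σ Λ
  | .popInput f => .pop StackIndex.input f q
  | .pushOutput f => .push StackIndex.output f q
  -- A machine push always pushes, so the optional push becomes a branch. The default `none` is
  -- never used, because that branch is taken only if `f` returns a symbol.
  | .push w f => .branch (fun v => (f v).isSome)
      (.push (StackIndex.work w) (fun v => ((f v).getD none : Option Bool)) q) q
  | .pop w f => .pop (StackIndex.work w) f q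
  | .peek w f => .peek (StackIndex.work w) f q
  | .load f => .load f q

theorem stacks_update_wk (s : Store Γ W σ) (w : W) (l : List (Option Bool)) :
    Function.update (β := fun k => List (Alphabet Γ k)) s.stacks (StackIndex.work w) l =
      Store.stacks { s with wk := Function.update s.wk w l } := by
  funext k
  cases k with
  | input => exact Function.update_of_ne (by simp) _ _
  | output => exact Function.update_of_ne (by simp) _ _
  | work w' =>
    by_cases h : w' = w
    · subst h
      exact (Function.update_self _ _ _).trans (Function.update_self w' l s.wk).symm
    · refine (Function.update_of_ne (by simpa using h) _ _).trans ?_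
      exact (Function.update_of_ne h l s.wk).symm

theorem stacks_update_input (s : Store Γ W σ) (l : List Γ) :
    Function.update (β := fun k => List (Alphabet Γ k)) s.stacks StackIndex.input l =
      Store.stacks { s with inp := l } := by
  funext k
  cases k with
  | input => exact Function.update_self _ _ _
  | output => exact Function.update_of_ne (by simp) _ _
  | work w => exact Function.update_of_ne (by simp) _ _

theorem stacks_update_output (s : Store Γ W σ) (l : List Bool) :
    Function.update (β := fun k => List (Alphabet Γ k)) s.stacks StackIndex.output l =
      Store.stacks { s with out := l } := by
  funext k
  cases k with
  | input => exact Function.update_of_ne (by simp) _ _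
  | output => exact Function.update_self _ _ _
  | work w => exact Function.update_of_ne (by simp) _ _

/-- Operations contain no jump, so they are carried out within the same machine step as their
continuation. This is why `Run` charges nothing for them. -/
theorem stepAux_stmt (o : Op Γ W σ) (q : MachineStmt Γ W σ Λ) (s : Store Γ W σ) :
    Turing.TM2.stepAux (o.stmt q) s.mem s.stacks =
      Turing.TM2.stepAux q (o.exec s).mem (o.exec s).stacks := by
  cases o with
  | popInput f =>
    exact congrArg (Turing.TM2.stepAux q _) (stacks_update_input s _)
  | pushOutput f =>
    exact congrArg (Turing.TM2.stepAux q _) (stacks_update_output s _)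
  | push w f =>
    cases h : f s.mem with
    | none =>
      simp only [Op.stmt, Turing.TM2.stepAux, h, Option.isSome_none, cond_false, Op.exec,
        Option.toList_none, List.nil_append, Function.update_eq_self]
    | some x =>
      simp only [Op.stmt, Turing.TM2.stepAux, h, Option.isSome_some, cond_true, Op.exec,
        Option.toList_some, Option.getD_some]
      exact congrArg (Turing.TM2.stepAux q _) (stacks_update_wk s w _)
  | pop w f =>
    exact congrArg (Turing.TM2.stepAux q _) (stacks_update_wk s w _)
  | peek w f => rfl
  | load f => rfl

namespace Cmd

/-- The statement that starts `c` and continues with `q`. -/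
def entry : (c : Cmd Γ W σ) → (c.Label → Λ) → MachineStmt Γ W σ Λ → MachineStmt Γ W σ Λ
  | .op o, _, q => o.stmt q
  | .seq c d, e, q => c.entry (fun l => e (.inl l)) (d.entry (fun l => e (.inr l)) q)
  | .ite p c d, e, q => .branch p (c.entry (fun l => e (.inl l)) q)
      (d.entry (fun l => e (.inr l)) q)
  | .loop _ _, e, _ => .goto fun _ => e none

/-- The statement at a label of `c`, when `c` continues with `q`. -/
def code : (c : Cmd Γ W σ) → (c.Label → Λ) → MachineStmt Γ W σ Λ → c.Label → MachineStmt Γ W σ Λ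
  | .op _, _, _ => fun l => nomatch l
  | .seq c d, e, q => fun l => match l with
    | .inl l => c.code (fun l => e (.inl l)) (d.entry (fun l => e (.inr l)) q) l
    | .inr l => d.code (fun l => e (.inr l)) q l
  | .ite _ c d, e, q => fun l => match l with
    | .inl l => c.code (fun l => e (.inl l)) q l
    | .inr l => d.code (fun l => e (.inr l)) q l
  | .loop p c, e, q => fun l => match l with
    | none => .branch p (c.entry (fun l => e (some l)) (.goto fun _ => e none)) q
    | some l => c.code (fun l => e (some l)) (.goto fun _ => e none) l

end Cmd

-- Induction on the run, for all continuations `q` at once: in a sequence the first command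
-- continues with the entry of the second, and a loop body continues with the jump back to its loop.
-- The map `e` embeds the labels of the subcommand into those of the whole machine.
open StateTransition in
theorem Run.evalsTo {c : Cmd Γ W σ} {s t : Store Γ W σ} {n : ℕ} (h : Run c s t n)
    {m : Λ → MachineStmt Γ W σ Λ} {e : c.Label → Λ} {q : MachineStmt Γ W σ Λ}
    (hm : ∀ l, m (e l) = c.code e q l) :
    Nonempty (EvalsToInTime (Turing.TM2.step m)
      (Turing.TM2.stepAux (c.entry e q) s.mem s.stacks)
      (some (Turing.TM2.stepAux q t.mem t.stacks)) n) := by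
  induction h generalizing q with
  | op o s n =>
    exact ⟨⟨⟨0, congrArg some (stepAux_stmt o q s)⟩, Nat.zero_le _⟩⟩
  | seq _ _ hk ih1 ih2 =>
    obtain ⟨h1⟩ := ih1 (e := fun l => e (.inl l)) (fun l => hm (.inl l))
    obtain ⟨h2⟩ := ih2 (e := fun l => e (.inr l)) (fun l => hm (.inr l))
    have h3 := EvalsToInTime.trans _ _ _ _ _ _ h1 h2
    exact ⟨⟨h3.toEvalsTo, h3.steps_le_m.trans (by omega)⟩⟩
  | @ite_true p c d s t n hp _ ih =>
    obtain ⟨h1⟩ := ih (e := fun l => e (.inl l)) (fun l => hm (.inl l))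
    refine ⟨?_⟩
    simp only [Cmd.entry, Turing.TM2.stepAux, hp, cond_true]
    exact h1
  | @ite_false p c d s t n hp _ ih =>
    obtain ⟨h1⟩ := ih (e := fun l => e (.inr l)) (fun l => hm (.inr l))
    refine ⟨?_⟩
    simp only [Cmd.entry, Turing.TM2.stepAux, hp, cond_false]
    exact h1
  | @loop_done p c s n hp h1 =>
    -- The jump to the loop label is already part of `stepAux`; the single step is the test at that
    -- label.
    refine ⟨⟨⟨1, ?_⟩, h1⟩⟩
    have := hm none
    simp only [Cmd.code] at this
    simp [Cmd.entry, Turing.TM2.stepAux, flip, Turing.TM2.step, this, hp]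
  | @loop_step p c s t u m' n k hp _ _ hk ih1 ih2 =>
    obtain ⟨h1⟩ := ih1 (e := fun l => e (some l)) (q := .goto fun _ => e none)
      (fun l => hm (some l))
    obtain ⟨h2⟩ := ih2 hm
    have h0 : EvalsToInTime (Turing.TM2.step m)
        (Turing.TM2.stepAux ((Cmd.loop p c).entry e q) s.mem s.stacks)
        (some (Turing.TM2.stepAux (c.entry (fun l => e (some l)) (.goto fun _ => e none))
          s.mem s.stacks)) 1 := by
      refine ⟨⟨1, ?_⟩, le_rfl⟩
      have := hm none
      simp only [Cmd.code] at this
      simp [Cmd.entry, Turing.TM2.stepAux, flip, Turing.TM2.step, this, hp]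
    have h3 := EvalsToInTime.trans _ _ _ _ _ _ (EvalsToInTime.trans _ _ _ _ _ _ h0 h1) h2
    exact ⟨⟨h3.toEvalsTo, h3.steps_le_m.trans (by omega)⟩⟩

/-- The machine that runs a command. -/
noncomputable def machine [Fintype Γ] [Fintype W] [Fintype σ] (init : σ) (c : Cmd Γ W σ) :
    Turing.FinTM2 where
  K := StackIndex W
  k₀ := .input
  k₁ := .output
  Γ := Alphabet Γ
  Λ := Option c.Label
  main := none
  ΛFin := have := c.finite_label; Fintype.ofFinite _
  σ := σ
  initialState := init
  Γk₀Fin := inferInstanceAs (Fintype Γ)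
  m := fun l => match l with
    | none => c.entry some .halt
    | some l => c.code some .halt l

/-- The form of the final store is dictated by `Turing.haltList`: initial memory, the answer on the
output stack, and every other stack empty. -/
theorem polyTimeDecidable_of_run [Fintype Γ] [Fintype W] [Fintype σ] {α : Type}
    {enc : α → List Γ} {P : α → Prop} {init : σ} {c : Cmd Γ W σ} (T : Polynomial ℕ)
    (h : ∀ a, ∃ b : Bool, (b = true ↔ P a) ∧
      Run c ⟨init, enc a, [], fun _ => []⟩ ⟨init, [], [b], fun _ => []⟩
        (T.eval (enc a).length)) :
    PolyTimeDecidable enc P := by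
  classical
  refine ⟨{
    tm := machine init c
    inputAlphabet := Equiv.refl _
    outputAlphabet := Equiv.refl _
    -- The additional step executes the statement at the start label, that is, the entry of `c` up
    -- to its first jump.
    time := T + 1
    outputsFun := fun a => Classical.choice ?_ }⟩
  obtain ⟨b, hb, hrun⟩ := h a
  have hbP : decide (P a) = b := by
    rw [Bool.eq_iff_iff, decide_eq_true_iff, hb]
  obtain ⟨h1⟩ := hrun.evalsTo (m := (machine init c).m) (e := some) (q := .halt) (fun _ => rfl)
  have hs : (machine init c).step (Turing.initList (machine init c) (enc a)) =
      some (Turing.TM2.stepAux (c.entry some .halt) init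
        (Store.stacks ⟨init, enc a, [], fun _ => []⟩)) := by
    have : (Turing.initList (machine init c) (enc a)).stk =
        Store.stacks (W := W) ⟨init, enc a, [], fun _ => []⟩ := by
      funext k
      cases k <;> rfl
    rw [← this]
    rfl
  have hh : Turing.haltList (machine init c) [b] =
      (Turing.TM2.stepAux (Turing.TM2.Stmt.halt : MachineStmt Γ W σ (Option c.Label)) init
        (Store.stacks ⟨init, [], [b], fun _ => []⟩)) := by
    have : (Turing.haltList (machine init c) [b]).stk =
        Store.stacks (Γ := Γ) (W := W) ⟨init, [], [b], fun _ => []⟩ := by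
      funext k
      cases k <;> rfl
    simp only [Turing.TM2.stepAux, ← this]
    rfl
  have h0 : StateTransition.EvalsToInTime (machine init c).step
      (Turing.initList (machine init c) (enc a)) _ 1 := ⟨⟨1, hs⟩, le_rfl⟩
  have h2 := StateTransition.EvalsToInTime.trans _ _ _ _ _ _ h0 h1
  rw [hbP]
  refine ⟨⟨⟨h2.steps, ?_⟩, ?_⟩⟩
  · have e1 : List.map (Equiv.refl ((machine init c).Γ (machine init c).k₀)).invFun (enc a)
        = enc a := List.map_id _
    have e2 : List.map (Equiv.refl ((machine init c).Γ (machine init c).k₁)).invFun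
        (Computability.encodeBool b) = [b] := rfl
    erw [e1, e2]
    exact h2.evals_in_steps.trans (congrArg some hh.symm)
  · simpa using h2.steps_le_m

end StackProgram

/-! ### Gadgets that move names between stacks -/

namespace StackProgram

/-- Memory of the programs below: a flag, two symbol registers and a control state. -/
structure Mem (C : Type) where
  flag : Bool
  x : Option (Option Bool)
  y : Option (Option Bool)
  ctl : C
  deriving Fintype

def isBit : Option (Option Bool) → Bool
  | some (some _) => true
  | _ => false

theorem isBit_of_mem {p : List Bool} : ∀ t ∈ (p.map some).reverse, isBit (some t) = true := by
  intro t ht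
  obtain ⟨b, -, rfl⟩ := List.mem_map.1 (List.mem_reverse.1 ht)
  rfl

section Gadgets

variable {Γ W C : Type} [DecidableEq W]

theorem update_update_shift (f : W → List (Option Bool)) (a b : W)
    (l l' r r' : List (Option Bool)) :
    Function.update (Function.update (Function.update (Function.update f a l) b r) a l') b r' =
      Function.update (Function.update f a l') b r' := by
  funext k
  simp only [Function.update_apply]
  split_ifs <;> simp_all

/-- Move the top symbol of `a` to `b`. -/
def moveTop (a b : W) : Cmd Γ W (Mem C) :=
  .seq (.op (.pop a fun m t => { m with x := t }))
    (.seq (.op (.push b fun m => m.x)) (.op (.load fun m => { m with x := none })))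

theorem run_moveTop {a b : W} (hab : a ≠ b) {s : Store Γ W (Mem C)} {t : Option Bool}
    {l : List (Option Bool)} (ha : s.wk a = t :: l) (n : ℕ) :
    Run (moveTop a b) s
      { s with
        mem := { s.mem with x := none }
        wk := Function.update (Function.update s.wk a l) b (t :: s.wk b) } n := by
  refine .seq (.op _ _ 0) (.seq (.op _ _ 0) (.op_of_eq 0 ?_) (le_refl _)) (Nat.zero_le _)
  simp [Op.exec, ha, hab.symm]

/-- Move symbols from `a` to `b` as long as they satisfy `p`. -/
def moveWhile (p : Option (Option Bool) → Bool) (a b : W) : Cmd Γ W (Mem C) :=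
  .seq (.op (.peek a fun m t => { m with x := t }))
    (.seq (.loop (fun m => p m.x)
      (.seq (moveTop a b) (.op (.peek a fun m t => { m with x := t }))))
      (.op (.load fun m => { m with x := none })))

theorem run_moveWhile {p : Option (Option Bool) → Bool} {a b : W} (hab : a ≠ b)
    {s : Store Γ W (Mem C)} {l₁ l₂ : List (Option Bool)} (ha : s.wk a = l₁ ++ l₂)
    (h₁ : ∀ t ∈ l₁, p (some t) = true) (h₂ : p l₂.head? = false) :
    Run (moveWhile p a b) s
      { s with
        mem := { s.mem with x := none }
        wk := Function.update (Function.update s.wk a l₂) b (l₁.reverse ++ s.wk b) }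
      (l₁.length + 1) := by
  -- Loop invariant: the register `x` shows the top of `a`.
  have key : ∀ (l₁ : List (Option Bool)) (s : Store Γ W (Mem C)), s.wk a = l₁ ++ l₂ →
      s.mem.x = (s.wk a).head? → (∀ t ∈ l₁, p (some t) = true) →
      Run (.loop (fun m => p m.x)
        (.seq (moveTop a b) (.op (.peek a fun m t => { m with x := t })))) s
      { s with
        mem := { s.mem with x := l₂.head? }
        wk := Function.update (Function.update s.wk a l₂) b (l₁.reverse ++ s.wk b) }
      (l₁.length + 1) := by
    intro l₁
    induction l₁ with
    | nil =>
      intro s hs hx _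
      have e : ({ s with
          mem := { s.mem with x := l₂.head? }
          wk := Function.update (Function.update s.wk a l₂) b ([].reverse ++ s.wk b) } :
          Store Γ W (Mem C)) = s := by
        rcases s with ⟨⟨f, x, y, c⟩, i, o, w⟩
        simp only [List.nil_append] at hs
        simp only at hx
        simp [hx, ← hs]
      rw [e]
      refine .loop_done ?_ (by simp)
      simp only [hx, hs, List.nil_append, h₂]
    | cons t l₁ ih =>
      intro s hs hx hp
      rw [List.cons_append] at hs
      refine .loop_step (m := 0) (n := l₁.length + 1) ?_
        (.seq (run_moveTop hab hs 0) (.op _ _ 0) (le_refl _)) (?_ : Run _ _ _ _) (by simp)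
      · simp only [hx, hs, List.head?_cons]
        exact hp t (by simp)
      · have h := ih (Op.exec { s with
            mem := { s.mem with x := none }
            wk := Function.update (Function.update s.wk a (l₁ ++ l₂)) b (t :: s.wk b) }
            (.peek a fun m t => { m with x := t })) (by simp [Op.exec, hab])
            (by simp [Op.exec]) (fun t ht => hp t (by simp [ht]))
        convert h using 1
        simp [Op.exec, update_update_shift]
  refine .seq (.op _ _ 0) (.seq (key l₁ _ ha (by simp [Op.exec]) h₁) (.op_of_eq 0 ?_)
    (le_refl _)) (by simp)
  simp [Op.exec]

/-- Set the flag to whether the names on top of `c` and `d` agree. -/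
def compareNames (c c' d d' : W) : Cmd Γ W (Mem C) :=
  .seq (.op (.peek c fun m t => { m with x := t }))
  (.seq (.op (.peek d fun m t => { m with y := t }))
  (.seq (.loop (fun m => decide (m.x = m.y) && isBit m.x)
    (.seq (moveTop c c') (.seq (moveTop d d')
      (.seq (.op (.peek c fun m t => { m with x := t }))
        (.op (.peek d fun m t => { m with y := t }))))))
  (.seq (.op (.load fun m => { m with flag := decide (m.x = m.y), x := none, y := none }))
  (.seq (moveWhile isBit c' c) (moveWhile isBit d' d)))))

/-- The symbols of a name, followed by the end marker `none`. -/
def nameSyms (a : List Bool) : List (Option Bool) :=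
  a.map some ++ [none]

/-- The loop shifts a common prefix `p` of the two names until the visible symbols differ or are
both end markers. Since names carry end markers, agreement of the last symbols seen means that both
names ended together, hence that they are equal. -/
theorem run_compareNames_loop {c c' d d' : W} (h1 : c ≠ c') (h2 : c ≠ d) (h3 : c ≠ d')
    (h4 : c' ≠ d) (h5 : c' ≠ d') (h6 : d ≠ d') {r r' : List (Option Bool)} :
    ∀ (a a' : List Bool) (s : Store Γ W (Mem C)),
    s.wk c = nameSyms a ++ r → s.wk d = nameSyms a' ++ r' →
    s.mem.x = (s.wk c).head? → s.mem.y = (s.wk d).head? →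
    ∃ (p q q' : List Bool) (x y : Option (Option Bool)), a = p ++ q ∧ a' = p ++ q' ∧
      (x = y ↔ a = a') ∧
      Run (.loop (fun m => decide (m.x = m.y) && isBit m.x)
        (.seq (moveTop c c') (.seq (moveTop d d')
          (.seq (.op (.peek c fun m t => { m with x := t }))
            (.op (.peek d fun m t => { m with y := t })))))) s
        { s with
          mem := { s.mem with x := x, y := y }
          wk := Function.update (Function.update (Function.update (Function.update s.wk
            c (nameSyms q ++ r)) c' ((p.map some).reverse ++ s.wk c'))
            d (nameSyms q' ++ r')) d' ((p.map some).reverse ++ s.wk d') }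
        (p.length + 1) := by
  -- The case in which the loop stops at once, with empty common prefix.
  have key : ∀ (a a' : List Bool) (s : Store Γ W (Mem C)),
      s.wk c = nameSyms a ++ r → s.wk d = nameSyms a' ++ r' →
      s.mem.x = (s.wk c).head? → s.mem.y = (s.wk d).head? →
      (decide (s.mem.x = s.mem.y) && isBit s.mem.x) = false →
      (s.mem.x = s.mem.y ↔ a = a') →
      ∃ (p q q' : List Bool) (x y : Option (Option Bool)), a = p ++ q ∧ a' = p ++ q' ∧
      (x = y ↔ a = a') ∧
      Run (.loop (fun m => decide (m.x = m.y) && isBit m.x)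
        (.seq (moveTop c c') (.seq (moveTop d d')
          (.seq (.op (.peek c fun m t => { m with x := t }))
            (.op (.peek d fun m t => { m with y := t })))))) s
        { s with
          mem := { s.mem with x := x, y := y }
          wk := Function.update (Function.update (Function.update (Function.update s.wk
            c (nameSyms q ++ r)) c' ((p.map some).reverse ++ s.wk c'))
            d (nameSyms q' ++ r')) d' ((p.map some).reverse ++ s.wk d') }
        (p.length + 1) := by
    intro a a' s hc hd hx hy hend hiff
    refine ⟨[], a, a', s.mem.x, s.mem.y, rfl, rfl, hiff, ?_⟩
    have e : ({ s with
        mem := { s.mem with x := s.mem.x, y := s.mem.y }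
        wk := Function.update (Function.update (Function.update (Function.update s.wk
          c (nameSyms a ++ r)) c' ((([] : List Bool).map some).reverse ++ s.wk c'))
          d (nameSyms a' ++ r')) d' ((([] : List Bool).map some).reverse ++ s.wk d') } :
        Store Γ W (Mem C)) = s := by
      rcases s with ⟨⟨f, x, y, ct⟩, i, o, w⟩
      simp only at hc hd
      simp only [← hc, ← hd]
      simp
    rw [e]
    exact .loop_done hend (by simp)
  intro a
  induction a with
  | nil =>
    intro a' s hc hd hx hy
    apply key _ _ s hc hd hx hy
    · simp [hx, hc, nameSyms, isBit]
    · rw [hx, hy, hc, hd]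
      cases a' <;> simp [nameSyms]
  | cons t a ih =>
    intro a' s hc hd hx hy
    cases a' with
    | nil =>
      apply key _ _ s hc hd hx hy
      · simp [hx, hc, hy, hd, nameSyms]
      · rw [hx, hy, hc, hd]
        simp [nameSyms]
    | cons t' a' =>
      by_cases htt : t = t'
      · subst htt
        have hc' : s.wk c = some t :: (nameSyms a ++ r) := by simpa [nameSyms] using hc
        have hd' : s.wk d = some t :: (nameSyms a' ++ r') := by simpa [nameSyms] using hd
        let s₁ : Store Γ W (Mem C) := { s with
          mem := { s.mem with
            x := (nameSyms a ++ r).head?, y := (nameSyms a' ++ r').head? }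
          wk := Function.update (Function.update (Function.update (Function.update s.wk
            c (nameSyms a ++ r)) c' (some t :: s.wk c'))
            d (nameSyms a' ++ r')) d' (some t :: s.wk d') }
        obtain ⟨p, q, q', x, y, ha, ha', hiff, hrun⟩ := ih a' s₁
          (by simp [s₁, h1, h2, h3]) (by simp [s₁, h6]) (by simp [s₁, h1, h2, h3])
          (by simp [s₁, h6])
        refine ⟨t :: p, q, q', x, y, by simp [ha], by simp [ha'], by simp [hiff], ?_⟩
        refine .loop_step (m := 0) (n := p.length + 1) (t := s₁) ?_ ?_ ?_ (by simp)
        · simp [hx, hy, hc', hd', isBit]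
        · refine .seq (run_moveTop h1 hc' 0) (.seq (run_moveTop h6
            (t := some t) (l := nameSyms a' ++ r') ?_ 0)
            (.seq (.op _ _ 0) (.op_of_eq 0 ?_) (le_refl _)) (le_refl _)) (le_refl _)
          · simp [h2.symm, h4.symm, hd']
          · simp [Op.exec, s₁, h1, h2, h3, h6, h5.symm, h3.symm]
        · convert hrun using 1
          simp only [s₁]
          congr 1
          funext k
          simp only [Function.update_apply]
          split_ifs <;> simp_all
      · apply key _ _ s hc hd hx hy
        · simp [hx, hc, hy, hd, nameSyms, htt]
        · rw [hx, hy, hc, hd]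
          simp [nameSyms, htt]

/-- The shifted prefix is put back afterwards. The tops of `c'` and `d'` must not be bits, so that
moving bits back stops exactly where the prefix began. The bound counts three passes over the
prefix: one to compare and two to restore. -/
theorem run_compareNames {c c' d d' : W} (h1 : c ≠ c') (h2 : c ≠ d) (h3 : c ≠ d')
    (h4 : c' ≠ d) (h5 : c' ≠ d') (h6 : d ≠ d') {r r' : List (Option Bool)} {a a' : List Bool}
    {s : Store Γ W (Mem C)} (hc : s.wk c = nameSyms a ++ r) (hd : s.wk d = nameSyms a' ++ r')
    (hc' : isBit (s.wk c').head? = false) (hd' : isBit (s.wk d').head? = false) :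
    Run (compareNames c c' d d') s
      { s with mem := { s.mem with flag := decide (a = a'), x := none, y := none } }
      (3 * a.length + 3) := by
  obtain ⟨p, q, q', x, y, ha, ha', hiff, hrun⟩ := run_compareNames_loop (C := C) (Γ := Γ)
    h1 h2 h3 h4 h5 h6 (r := r) (r' := r') a a'
    { s with mem := { s.mem with x := (s.wk c).head?, y := (s.wk d).head? } } hc hd rfl rfl
  refine .seq (.op _ _ 0) (.seq (.op _ _ 0) (.seq hrun (.seq (.op _ _ 0)
    (.seq (run_moveWhile h1.symm (l₁ := (p.map some).reverse) (l₂ := s.wk c') ?_ ?_ hc')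
      (?_ : Run _ _ _ (p.length + 1)) (le_refl _)) (le_refl _)) (le_refl _)) (le_refl _)) ?_
  · simp [Op.exec, h4, h5]
  · exact isBit_of_mem
  · have h := run_moveWhile (p := isBit) (C := C) (Γ := Γ) h6.symm
      (l₁ := (p.map some).reverse) (l₂ := s.wk d')
      (s := { s with
        mem := { s.mem with flag := decide (a = a'), x := none, y := none }
        wk := Function.update (Function.update s.wk d (nameSyms q' ++ r'))
          d' ((p.map some).reverse ++ s.wk d') }) (by simp) isBit_of_mem hd'
    have e1 : p.map some ++ nameSyms q = nameSyms a := by simp [ha, nameSyms]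
    have e2 : p.map some ++ nameSyms q' = nameSyms a' := by simp [ha', nameSyms]
    have e1' : p.map some ++ (nameSyms q ++ r) = s.wk c := by rw [hc, ← e1, List.append_assoc]
    have e2' : p.map some ++ (nameSyms q' ++ r') = s.wk d := by rw [hd, ← e2, List.append_assoc]
    convert h using 1
    · simp only [Op.exec, hiff]
      congr 1
      funext k
      simp only [Function.update_apply]
      split_ifs <;> simp_all
    · congr 1
      funext k
      simp only [Function.update_apply]
      split_ifs <;> simp_all
    · simp
  · have : p.length ≤ a.length := by simp [ha]
    simp
    omega

end Gadgets

end StackProgram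

/-! ### Evaluation of first-order formulas over lists of pairs of names -/

namespace StackProgram

abbrev NamePair : Type := ArgName × ArgName

/-- A component of a pair of names: the first for `false`, the second for `true`. -/
def component (p : NamePair) : Bool → ArgName
  | false => p.1
  | true => p.2

/-- First-order formulas whose variables `0, …, m - 1` range over the pairs in finite lists,
which are indexed by `I`. -/
inductive Fm (I : Type) (m : ℕ)
  | eq (x y : Fin m × Bool)
  | not (φ : Fm I m)
  | and (φ ψ : Fm I m)
  | ex (s : I) (i : Fin m) (φ : Fm I m)

section

variable {I : Type} {m : ℕ}

def Fm.Sat (D : I → List NamePair) : (Fin m → NamePair) → Fm I m → Prop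
  | ρ, .eq x y => component (ρ x.1) x.2 = component (ρ y.1) y.2
  | ρ, .not φ => ¬ φ.Sat D ρ
  | ρ, .and φ ψ => φ.Sat D ρ ∧ ψ.Sat D ρ
  | ρ, .ex s i φ => ∃ p ∈ D s, φ.Sat D (Function.update ρ i p)

/-- In a context that maps the bound variables to the lists they range over, every variable
that occurs in the formula is bound, and no variable is bound again in its own scope. -/
def Fm.WellScoped : (Fin m → Option I) → Fm I m → Bool
  | Δ, .eq x y => (Δ x.1).isSome && (Δ y.1).isSome && decide (x ≠ y)
  | Δ, .not φ => φ.WellScoped Δ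
  | Δ, .and φ ψ => φ.WellScoped Δ && ψ.WellScoped Δ
  | Δ, .ex s i φ => (Δ i).isNone && φ.WellScoped (Function.update Δ i (some s))

/-- The symbols of one component of a list of pairs. -/
def columnSyms (l : List NamePair) (c : Bool) : List (Option Bool) :=
  l.flatMap fun p => nameSyms (component p c)

/-- Work stacks: variable `(s, i)` has for each of the two components a stack with the pairs
already visited (side `false`) and a stack with the remaining pairs (side `true`). -/
abbrev Tape (I : Type) (m : ℕ) : Type :=
  (I × Fin m) × Bool × Bool

/-- Stack contents for given lists of visited pairs (last one first) and remaining pairs. -/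
def zipperStacks (Z : I × Fin m → List NamePair × List NamePair) :
    Tape I m → List (Option Bool)
  | (v, c, false) => (columnSyms (Z v).1.reverse c).reverse
  | (v, c, true) => columnSyms (Z v).2 c

variable {Γ C : Type} [DecidableEq I]

/-- The bits are moved before the end marker, so on the visited side every name lies reversed below
its marker. -/
def advanceColumn (v : I × Fin m) (c : Bool) : Cmd Γ (Tape I m) (Mem C) :=
  .seq (moveWhile isBit (v, c, true) (v, c, false)) (moveTop (v, c, true) (v, c, false))

def advance (v : I × Fin m) : Cmd Γ (Tape I m) (Mem C) :=
  .seq (advanceColumn v false) (advanceColumn v true)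

def rewind (v : I × Fin m) : Cmd Γ (Tape I m) (Mem C) :=
  .seq (moveWhile Option.isSome (v, false, false) (v, false, true))
    (moveWhile Option.isSome (v, true, false) (v, true, true))

/-- The program that stores the truth value of a formula in the flag. -/
def Fm.eval : (Fin m → Option I) → Fm I m → Cmd Γ (Tape I m) (Mem C)
  | Δ, .eq x y =>
    match Δ x.1, Δ y.1 with
    | some s, some t => compareNames ((s, x.1), x.2, true) ((s, x.1), x.2, false)
        ((t, y.1), y.2, true) ((t, y.1), y.2, false)
    -- Not reached for well-scoped formulas.
    | _, _ => .op (.load id)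
  | Δ, .not φ => .seq (φ.eval Δ) (.op (.load fun m => { m with flag := !m.flag }))
  | Δ, .and φ ψ => .seq (φ.eval Δ) (.ite (fun m => m.flag) (ψ.eval Δ) (.op (.load id)))
  | Δ, .ex s i φ =>
    .seq (.op (.load fun m => { m with flag := false }))
    (.seq (.op (.peek ((s, i), false, true) fun m t => { m with x := t }))
    -- The search stops at the first pair that satisfies the body or at the end of the list. The top
    -- of the remaining first column is missing only at the end, since even the empty name has its
    -- end marker.
    (.seq (.loop (fun m => !m.flag && m.x.isSome)
      (.seq (.op (.load fun m => { m with x := none }))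
      (.seq (φ.eval (Function.update Δ i (some s)))
      (.seq (.ite (fun m => m.flag) (.op (.load id)) (advance (s, i)))
        (.op (.peek ((s, i), false, true) fun m t => { m with x := t }))))))
    (.seq (.op (.load fun m => { m with x := none })) (rewind (s, i)))))

/-- A polynomial bound on the running time of `Fm.eval`, in terms of the size of the lists. -/
noncomputable def Fm.time : Fm I m → Polynomial ℕ
  | .eq _ _ => 3 * Polynomial.X + 3
  | .not φ => φ.time
  | .and φ ψ => φ.time + ψ.time
  | .ex _ _ φ => Polynomial.X * (φ.time + 2 * Polynomial.X + 3) + 1 + 2 * (Polynomial.X + 1)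

theorem columnSyms_cons (p : NamePair) (l : List NamePair) (c : Bool) :
    columnSyms (p :: l) c = nameSyms (component p c) ++ columnSyms l c := by
  simp [columnSyms]

theorem columnSyms_append (l l' : List NamePair) (c : Bool) :
    columnSyms (l ++ l') c = columnSyms l c ++ columnSyms l' c := by
  simp [columnSyms]

theorem columnSyms_eq_nil {l : List NamePair} {c : Bool} : columnSyms l c = [] ↔ l = [] := by
  cases l <;> simp [columnSyms, nameSyms]

theorem length_le_columnSyms (l : List NamePair) (c : Bool) :
    l.length ≤ (columnSyms l c).length := by
  induction l with
  | nil => simp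
  | cons p l ih =>
    rw [columnSyms_cons]
    simp [nameSyms]
    omega

/-- The visited side is empty or has the end marker of a name on top. It can therefore serve as
scratch space in `compareNames`, without stacks reserved for this purpose. -/
theorem isBit_head_visited (l : List NamePair) (c : Bool) :
    isBit ((columnSyms l.reverse c).reverse).head? = false := by
  cases l with
  | nil => rfl
  | cons p l => simp [columnSyms, nameSyms, isBit]

theorem run_advanceColumn {v : I × Fin m} {c : Bool} {s : Store Γ (Tape I m) (Mem C)}
    {a : List Bool} {r : List (Option Bool)} (h : s.wk (v, c, true) = nameSyms a ++ r)
    (hx : s.mem.x = none) :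
    Run (advanceColumn v c) s
      { s with
        wk := Function.update (Function.update s.wk (v, c, true) r) (v, c, false)
          ((nameSyms a).reverse ++ s.wk (v, c, false)) }
      (a.length + 1) := by
  have hne : ((v, c, true) : Tape I m) ≠ (v, c, false) := by simp
  refine .seq (run_moveWhile (l₁ := a.map some) (l₂ := none :: r) hne ?_ ?_ rfl)
    (?_ : Run _ _ _ 0) (by simp)
  · rw [h, nameSyms, List.append_assoc]; rfl
  · intro t ht
    exact isBit_of_mem t (List.mem_reverse.2 ht)
  · convert run_moveTop hne (C := C) (Γ := Γ) (s := { s with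
      mem := { s.mem with x := none }
      wk := Function.update (Function.update s.wk (v, c, true) (none :: r)) (v, c, false)
        ((a.map some).reverse ++ s.wk (v, c, false)) }) (t := none) (l := r) (by simp) 0 using 1
    rcases s with ⟨⟨f, x, y, ct⟩, i, o, w⟩
    simp only at hx
    subst hx
    simp [update_update_shift, nameSyms]

theorem run_advance {v : I × Fin m} {Z : I × Fin m → List NamePair × List NamePair}
    {q : NamePair} {p n : List NamePair} (hZ : Z v = (p, q :: n)) {μ : Mem C} (hx : μ.x = none)
    {i : List Γ} {o : List Bool} {N : ℕ} (hN : ∀ c, (component q c).length + 1 ≤ N) :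
    Run (advance v) ⟨μ, i, o, zipperStacks Z⟩
      ⟨μ, i, o, zipperStacks (Function.update Z v (q :: p, n))⟩ (2 * N) := by
  have h1 := run_advanceColumn (Γ := Γ) (C := C) (v := v) (c := false)
    (s := ⟨μ, i, o, zipperStacks Z⟩) (a := q.1) (r := columnSyms n false)
    (by simp [zipperStacks, hZ, columnSyms_cons, component]) hx
  have h2 := run_advanceColumn (Γ := Γ) (C := C) (v := v) (c := true)
    (s := ⟨μ, i, o, Function.update (Function.update (zipperStacks Z) (v, false, true)
      (columnSyms n false)) (v, false, false)
        ((nameSyms q.1).reverse ++ zipperStacks Z (v, false, false))⟩)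
    (a := q.2) (r := columnSyms n true)
    (by simp [zipperStacks, hZ, columnSyms_cons, component]) hx
  have e : zipperStacks (Function.update Z v (q :: p, n)) =
      Function.update (Function.update (Function.update (Function.update (zipperStacks Z)
        (v, false, true) (columnSyms n false)) (v, false, false)
        ((nameSyms q.1).reverse ++ zipperStacks Z (v, false, false)))
        (v, true, true) (columnSyms n true)) (v, true, false)
        ((nameSyms q.2).reverse ++ zipperStacks Z (v, true, false)) := by
    funext ⟨u, c, d⟩
    by_cases huv : u = v
    · subst huv
      cases c <;> cases d <;>
        simp [zipperStacks, hZ, columnSyms, component]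
    · cases c <;> cases d <;> simp [zipperStacks, huv]
  rw [e]
  refine .seq h1 ?_ (?_ : q.1.length + 1 + (q.2.length + 1) ≤ _)
  · convert h2 using 1
    simp
  · have h3 := hN false
    have h4 := hN true
    simp only [component] at h3 h4
    omega

theorem run_rewind {v : I × Fin m} {Z : I × Fin m → List NamePair × List NamePair} {μ : Mem C}
    (hx : μ.x = none) {i : List Γ} {o : List Bool} {N : ℕ}
    (hN : ∀ c, (columnSyms (Z v).1 c).length ≤ N) :
    Run (rewind v) ⟨μ, i, o, zipperStacks Z⟩
      ⟨μ, i, o, zipperStacks (Function.update Z v ([], (Z v).1.reverse ++ (Z v).2))⟩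
      (2 * (N + 1)) := by
  have hlen : ∀ c, (columnSyms (Z v).1.reverse c).length = (columnSyms (Z v).1 c).length := by
    intro c
    simp [columnSyms, List.length_flatMap]
  have h1 := run_moveWhile (Γ := Γ) (C := C) (p := Option.isSome)
    (a := ((v, false, false) : Tape I m)) (b := (v, false, true)) (by simp)
    (s := ⟨μ, i, o, zipperStacks Z⟩) (l₁ := zipperStacks Z (v, false, false)) (l₂ := [])
    (by simp) (by simp) rfl
  have h2 := run_moveWhile (Γ := Γ) (C := C) (p := Option.isSome)
    (a := ((v, true, false) : Tape I m)) (b := (v, true, true)) (by simp)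
    (s := ⟨{ μ with x := none }, i, o, Function.update (Function.update (zipperStacks Z)
      (v, false, false) []) (v, false, true)
        ((zipperStacks Z (v, false, false)).reverse ++ zipperStacks Z (v, false, true))⟩)
    (l₁ := zipperStacks Z (v, true, false)) (l₂ := []) (by simp) (by simp) rfl
  refine .seq h1 (n := (zipperStacks Z (v, true, false)).length + 1) ?_ ?_
  · convert h2 using 1
    rcases μ with ⟨f, x, y, ct⟩
    simp only at hx
    subst hx
    congr 1
    funext ⟨u, c, d⟩
    by_cases huv : u = v
    · subst huv
      cases c <;> cases d <;> simp [zipperStacks, columnSyms_append] <;> simp [columnSyms]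
    · cases c <;> cases d <;> simp [zipperStacks, huv]
  · simp only [zipperStacks, List.length_reverse, hlen]
    have := hN false
    have := hN true
    omega

/-- The stacks of the bound variables show their values, and the other ones are rewound. -/
structure Represents (D : I → List NamePair) (Δ : Fin m → Option I) (ρ : Fin m → NamePair)
    (Z : I × Fin m → List NamePair × List NamePair) : Prop where
  split : ∀ s i, (Z (s, i)).1.reverse ++ (Z (s, i)).2 = D s
  bound : ∀ s i, Δ i = some s → (Z (s, i)).2.head? = some (ρ i)
  free : ∀ s i, Δ i ≠ some s → (Z (s, i)).1 = []

theorem component_length_le {p : NamePair} {l : List NamePair} (h : p ∈ l) (c : Bool) :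
    (component p c).length + 1 ≤ (columnSyms l c).length := by
  obtain ⟨l₁, l₂, rfl⟩ := List.append_of_mem h
  simp [columnSyms_append, columnSyms_cons, nameSyms]
  omega

/-- Structural induction works because evaluation changes nothing but the flag: stacks and registers
are restored, so subformulas can be run one after the other. The number `N` bounds the length of
each column, and hence both the number of iterations of a quantifier and the length of the names
compared. -/
theorem Fm.run_eval (D : I → List NamePair) {N : ℕ} (hN : ∀ s c, (columnSyms (D s) c).length ≤ N)
    {inp : List Γ} {out : List Bool} (φ : Fm I m) :
    ∀ (Δ : Fin m → Option I) (ρ : Fin m → NamePair)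
      (Z : I × Fin m → List NamePair × List NamePair) (μ : Mem C), μ.x = none → μ.y = none →
      φ.WellScoped Δ = true → Represents D Δ ρ Z →
      ∃ b : Bool, (b = true ↔ φ.Sat D ρ) ∧
        Run (φ.eval Δ) ⟨μ, inp, out, zipperStacks Z⟩
          ⟨{ μ with flag := b }, inp, out, zipperStacks Z⟩ (φ.time.eval N) := by
  induction φ with
  | eq x y =>
    intro Δ ρ Z μ hx hy hφ hZ
    simp only [Fm.WellScoped, Bool.and_eq_true, Option.isSome_iff_exists,
      decide_eq_true_eq] at hφ
    obtain ⟨⟨⟨s, hs⟩, ⟨t, ht⟩⟩, hne⟩ := hφ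
    obtain ⟨⟨i, c⟩, ⟨j, d⟩⟩ := x, y
    simp only at hs ht
    have hi := hZ.bound s i hs
    have hj := hZ.bound t j ht
    refine ⟨decide (component (ρ i) c = component (ρ j) d), by simp [Fm.Sat], ?_⟩
    simp only [Fm.eval, hs, ht]
    obtain ⟨n, hn⟩ := List.head?_eq_some_iff.1 hi
    obtain ⟨n', hn'⟩ := List.head?_eq_some_iff.1 hj
    -- `compareNames` works on four distinct stacks; the clause `x ≠ y` of `WellScoped` provides
    -- this.
    have hne' : (((s, i), c) : (I × Fin m) × Bool) ≠ ((t, j), d) := by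
      intro h
      simp only [Prod.mk.injEq] at h
      exact hne (by rw [h.1.2, h.2])
    have h := run_compareNames (C := C) (Γ := Γ) (c := (((s, i), c, true) : Tape I m))
      (c' := ((s, i), c, false)) (d := ((t, j), d, true)) (d' := ((t, j), d, false))
      (by simp) (by simpa using hne') (by simp) (by simp) (by simpa using hne') (by simp)
      (r := columnSyms n c) (r' := columnSyms n' d) (a := component (ρ i) c)
      (a' := component (ρ j) d)
      (s := ⟨μ, inp, out, zipperStacks Z⟩)
      (by simp [zipperStacks, hn, columnSyms_cons]) (by simp [zipperStacks, hn', columnSyms_cons])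
      (isBit_head_visited _ _) (isBit_head_visited _ _)
    rcases μ with ⟨f, x, y, ct⟩
    simp only at hx hy
    subst hx hy
    refine h.mono ?_
    have h1 : ρ i ∈ D s := by
      rw [← hZ.split s i, hn]
      simp
    have h2 := component_length_le h1 c
    have h3 := hN s c
    simp [Fm.time]
    omega
  | not φ ih =>
    intro Δ ρ Z μ hx hy hφ hZ
    obtain ⟨b, hb, hrun⟩ := ih Δ ρ Z μ hx hy hφ hZ
    refine ⟨!b, by simp [Fm.Sat, ← hb], .seq hrun (.op _ _ 0) (le_refl _)⟩
  | and φ ψ ih1 ih2 =>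
    intro Δ ρ Z μ hx hy hφ hZ
    simp only [Fm.WellScoped, Bool.and_eq_true] at hφ
    obtain ⟨b, hb, hrun⟩ := ih1 Δ ρ Z μ hx hy hφ.1 hZ
    obtain ⟨b', hb', hrun'⟩ := ih2 Δ ρ Z { μ with flag := b } hx hy hφ.2 hZ
    cases b with
    | false =>
      refine ⟨false, by simp [Fm.Sat, ← hb], .seq hrun (.ite_false rfl (.op_of_eq 0 rfl)) ?_⟩
      simp [Fm.time]
    | true =>
      refine ⟨b', by simp [Fm.Sat, ← hb, hb'], .seq hrun (.ite_true rfl hrun') ?_⟩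
      simp [Fm.time]
  | ex s i φ ih =>
    intro Δ ρ Z μ hx hy hφ hZ
    simp only [Fm.WellScoped, Bool.and_eq_true, Option.isNone_iff_eq_none] at hφ
    obtain ⟨hi, hφ⟩ := hφ
    -- The variable `i` is unbound here, so its copy of the list `s` is fully rewound when the
    -- search starts.
    have hZ1 : Z (s, i) = ([], D s) := by
      have h1 := hZ.free s i (by simp [hi])
      have h2 := hZ.split s i
      rw [h1] at h2
      exact Prod.ext h1 (by simpa using h2)
    -- Generalized to a search that starts in the middle of the list, with `p` visited and `n`
    -- remaining. Where it stops is irrelevant, because the list is rewound afterwards.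
    have key : ∀ (n p : List NamePair), p.reverse ++ n = D s →
        ∃ (b : Bool) (x : Option (Option Bool)) (p' n' : List NamePair),
          (b = true ↔ ∃ q ∈ n, φ.Sat D (Function.update ρ i q)) ∧ p'.reverse ++ n' = D s ∧
          Run (.loop (fun m => !m.flag && m.x.isSome)
            (.seq (.op (.load fun m => { m with x := none }))
            (.seq (φ.eval (Function.update Δ i (some s)))
            (.seq (.ite (fun m => m.flag) (.op (.load id)) (advance (s, i)))
              (.op (.peek ((s, i), false, true) fun m t => { m with x := t }))))))
          ⟨{ μ with flag := false, x := (columnSyms n false).head? }, inp, out,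
            zipperStacks (Function.update Z (s, i) (p, n))⟩
          ⟨{ μ with flag := b, x := x }, inp, out,
            zipperStacks (Function.update Z (s, i) (p', n'))⟩
          (n.length * (φ.time.eval N + 2 * N + 1) + 1) := by
      intro n
      induction n with
      | nil =>
        intro p hp
        refine ⟨false, none, p, [], by simp, hp, .loop_done (by simp [columnSyms]) (by simp)⟩
      | cons q n ihn =>
        intro p hp
        have hsome : (columnSyms (q :: n) false).head?.isSome = true := by
          rw [Option.isSome_iff_ne_none, Ne, List.head?_eq_none_iff, columnSyms_eq_nil]
          simp
        have hq : q ∈ D s := by rw [← hp]; simp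
        have hrep : Represents D (Function.update Δ i (some s)) (Function.update ρ i q)
            (Function.update Z (s, i) (p, q :: n)) := by
          constructor
          · intro t j
            by_cases h : (t, j) = (s, i)
            · rw [h, Function.update_self, hp]
              exact congrArg D (Prod.ext_iff.1 h).1.symm
            · rw [Function.update_of_ne h]
              exact hZ.split t j
          · intro t j htj
            by_cases hj : j = i
            · subst hj
              simp only [Function.update_self, Option.some.injEq] at htj
              simp [htj]
            · rw [Function.update_of_ne hj] at htj
              rw [Function.update_of_ne hj, Function.update_of_ne (by simp [hj])]
              exact hZ.bound t j htj
          · intro t j htj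
            have h : (t, j) ≠ (s, i) := by
              intro h
              simp only [Prod.mk.injEq] at h
              simp [h.1, h.2] at htj
            rw [Function.update_of_ne h]
            apply hZ.free t j
            by_cases hj : j = i
            · subst hj
              simp [hi]
            · rwa [Function.update_of_ne hj] at htj
        obtain ⟨b, hb, hrun⟩ := ih _ _ _ { μ with flag := false, x := none } rfl hy hφ hrep
        cases b with
        | true =>
          refine ⟨true, (columnSyms (q :: n) false).head?, p, q :: n, ?_, hp, ?_⟩
          · simp [← hb]
          · refine .loop_step (m := φ.time.eval N) (n := 1)
              (t := ⟨{ μ with flag := true, x := (columnSyms (q :: n) false).head? }, inp, out,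
                zipperStacks (Function.update Z (s, i) (p, q :: n))⟩) (by simpa using hsome)
              (.seq (.op _ _ 0) (.seq hrun (.seq (.ite_true rfl (.op _ _ 0)) (.op_of_eq 0 ?_)
                (le_refl _)) (le_refl _)) (by simp)) (.loop_done (by simp) (le_refl _)) ?_
            · simp [Op.exec, zipperStacks]
            · simp
              ring_nf
              omega
        | false =>
          obtain ⟨b', x, p', n', hb', hp', hrun'⟩ := ihn (q :: p) (by simp [← hp])
          refine ⟨b', x, p', n', ?_, hp', ?_⟩
          · rw [hb']
            simp [← hb]
          · have hadv := run_advance (Γ := Γ) (C := C) (v := (s, i))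
              (Z := Function.update Z (s, i) (p, q :: n)) (q := q) (p := p) (n := n)
              (Function.update_self _ _ _) (μ := { μ with flag := false, x := none }) rfl
              (i := inp) (o := out) (N := N)
              (fun c => (component_length_le hq c).trans (hN s c))
            rw [Function.update_idem] at hadv
            refine .loop_step (m := φ.time.eval N + 2 * N) (by simpa using hsome)
              (.seq (.op _ _ 0) (.seq hrun (.seq (.ite_false rfl hadv) (.op_of_eq 0 ?_)
                (le_refl _)) (le_refl _)) (by simp)) hrun' ?_
            · simp [Op.exec, zipperStacks]
            · simp
              ring_nf
              omega
    obtain ⟨b, x, p', n', hb, hp', hrun⟩ := key (D s) [] (by simp)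
    refine ⟨b, hb, ?_⟩
    have hZself : Function.update Z (s, i) ([], D s) = Z := by
      rw [← hZ1, Function.update_eq_self]
    rw [hZself] at hrun
    have hrew := run_rewind (Γ := Γ) (C := C) (v := (s, i))
      (Z := Function.update Z (s, i) (p', n')) (μ := { μ with flag := b, x := none }) rfl
      (i := inp) (o := out) (N := N) (by
        intro c
        refine le_trans ?_ (hN s c)
        rw [← hp', columnSyms_append, Function.update_self]
        simp [columnSyms, List.length_flatMap])
    rw [Function.update_idem, Function.update_self, hp', hZself] at hrew
    rcases μ with ⟨f, x₀, y₀, ct⟩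
    simp only at hx
    subst hx
    have hlen := (length_le_columnSyms (D s) false).trans (hN s false)
    refine .seq (.op _ _ 0) (.seq (.op_of_eq 0 ?_) (.seq hrun (.seq (.op_of_eq 0 rfl) hrew
      (le_refl _)) (le_refl _)) (le_refl _)) ?_
    · simp [Op.exec, zipperStacks, hZ1]
    · simp [Fm.time]
      have := Nat.mul_le_mul_right (φ.time.eval N + 2 * N + 1) hlen
      nlinarith

end

end StackProgram

/-! ### Programs that parse their input and evaluate a formula -/

namespace StackProgram

section SeqAll

variable {Γ W σ κ β : Type} [DecidableEq W] [DecidableEq κ]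

def seqAll (c : κ → Cmd Γ W σ) : List κ → Cmd Γ W σ
  | [] => .op (.load id)
  | k :: l => .seq (c k) (seqAll c l)

/-- The command for `k` changes only the coordinate `k`, whatever the other coordinates are. As no
index is repeated, each command still finds the original value at its own coordinate. -/
theorem run_seqAll {c : κ → Cmd Γ W σ} (F : (κ → β) → Store Γ W σ) {f₀ g : κ → β} {n : ℕ}
    {l : List κ} (hl : l.Nodup)
    (h : ∀ k ∈ l, ∀ f, f k = f₀ k → Run (c k) (F f) (F (Function.update f k (g k))) n)
    {f : κ → β} (hf : ∀ k ∈ l, f k = f₀ k) :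
    Run (seqAll c l) (F f) (F fun k => if k ∈ l then g k else f k) (l.length * n) := by
  induction l generalizing f with
  | nil => exact .op_of_eq _ (by simp [Op.exec])
  | cons k l ih =>
    rw [List.nodup_cons] at hl
    have h1 := ih hl.2 (fun k' hk' => h k' (by simp [hk'])) (f := Function.update f k (g k)) (by
      intro k' hk'
      rw [Function.update_of_ne (by rintro rfl; exact hl.1 hk')]
      exact hf k' (by simp [hk']))
    refine .seq (h k (by simp) f (hf k (by simp))) (?_ : Run _ _ _ (l.length * n)) ?_
    · convert h1 using 2
      funext k'
      by_cases hk : k' = k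
      · subst hk; simp [hl.1]
      · simp [hk]
    · rw [List.length_cons]
      ring_nf
      omega

noncomputable def forAll [Fintype κ] (c : κ → Cmd Γ W σ) : Cmd Γ W σ :=
  seqAll c Finset.univ.toList

theorem run_forAll [Fintype κ] {c : κ → Cmd Γ W σ} (F : (κ → β) → Store Γ W σ) {f g : κ → β}
    {n : ℕ} (h : ∀ k f', f' k = f k → Run (c k) (F f') (F (Function.update f' k (g k))) n) :
    Run (forAll c) (F f) (F g) (Fintype.card κ * n) := by
  have := run_seqAll F (Finset.nodup_toList Finset.univ) (fun k _ => h k) (f := f)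
    (fun _ _ => rfl)
  simpa [forAll] using this

end SeqAll

/-- A transducer that writes symbols to the columns of the lists indexed by `I`. In the end it
either accepts or rejects, or leaves the decision to a formula (verdict `none`). -/
structure Transducer (Γ Q I : Type) where
  start : Q
  step : Q → Γ → Q
  emit : Q → Γ → I → Bool → Option (Option Bool)
  verdict : Q → Option Bool

namespace Transducer

variable {Γ Q I : Type} (T : Transducer Γ Q I)

def run : Q → List Γ → Q
  | q, [] => q
  | q, a :: w => run (T.step q a) w

def output : Q → List Γ → I → Bool → List (Option Bool)
  | _, [], _, _ => []
  | q, a :: w, s, c => (T.emit q a s c).toList ++ output (T.step q a) w s c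

variable {T} in
theorem length_output_le (q : Q) (w : List Γ) (s : I) (c : Bool) :
    (T.output q w s c).length ≤ w.length := by
  induction w generalizing q with
  | nil => simp [output]
  | cons a w ih =>
    simp only [output, List.length_append, List.length_cons]
    have h := ih (T.step q a)
    have : (T.emit q a s c).toList.length ≤ 1 := by
      cases T.emit q a s c <;> simp
    omega

end Transducer

/-! ### Parsing, rewinding and clearing, and the program built from them. -/

section

variable {Γ Q I : Type} {m : ℕ} [DecidableEq I] [Fintype I]

abbrev ParserMem (Γ Q : Type) : Type := Mem (Q × Option Γ)

/-- The variable index is ignored: every list is written once per variable, so that nested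
quantifiers over the same list have separate copies to walk through. Symbols arrive on the visited
side in reverse, and `rewindAll` restores the order. -/
def emitSymbol (T : Transducer Γ Q I) (μ : ParserMem Γ Q) :
    Tape I m → Option (Option Bool)
  | (v, c, false) => μ.ctl.2.bind fun a => T.emit μ.ctl.1 a v.1 c
  | (_, _, true) => none

noncomputable def parse (T : Transducer Γ Q I) : Cmd Γ (Tape I m) (ParserMem Γ Q) :=
  .seq (.op (.popInput fun μ a => { μ with ctl := (μ.ctl.1, a) }))
    (.loop (fun μ => μ.ctl.2.isSome)
      (.seq (forAll fun w : Tape I m => .op (.push w fun μ => emitSymbol T μ w))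
        (.op (.popInput fun μ a =>
          { μ with ctl := (μ.ctl.2.elim μ.ctl.1 (T.step μ.ctl.1), a) }))))

/-- Stack contents after parsing. -/
def parsedStacks (o : I → Bool → List (Option Bool)) : Tape I m → List (Option Bool)
  | (v, c, false) => (o v.1 c).reverse
  | (_, _, true) => []

/-- The next symbol is held in the control state, hence the input stack contains only the tail of
`w`. This look-ahead detects the end of the input. -/
theorem run_parse_loop (T : Transducer Γ Q I) (out : List Bool) (w : List Γ) :
    ∀ (μ : ParserMem Γ Q) (o : I → Bool → List (Option Bool)), μ.ctl.2 = w.head? →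
    Run (.loop (fun μ => μ.ctl.2.isSome)
      (.seq (forAll fun w : Tape I m => .op (.push w fun μ => emitSymbol T μ w))
        (.op (.popInput fun μ a =>
          { μ with ctl := (μ.ctl.2.elim μ.ctl.1 (T.step μ.ctl.1), a) }))))
      ⟨μ, w.tail, out, parsedStacks o⟩
      ⟨{ μ with ctl := (T.run μ.ctl.1 w, none) }, [], out,
        parsedStacks fun s c => o s c ++ T.output μ.ctl.1 w s c⟩ (w.length + 1) := by
  induction w with
  | nil =>
    rintro ⟨f, x, y, q, e⟩ o h
    simp only [List.head?_nil] at h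
    subst h
    simp only [Transducer.run, Transducer.output, List.append_nil, List.tail_nil]
    exact .loop_done rfl (by simp)
  | cons a w ih =>
    rintro ⟨f, x, y, q, e⟩ o h
    simp only [List.head?_cons] at h
    subst h
    have h1 := ih ⟨f, x, y, T.step q a, w.head?⟩
      (fun s c => o s c ++ (T.emit q a s c).toList) rfl
    have h2 := run_forAll (Γ := Γ) (κ := Tape I m) (n := 0)
      (c := fun w : Tape I m => .op (.push w fun μ => emitSymbol T μ w))
      (fun k => ⟨⟨f, x, y, q, some a⟩, w, out, k⟩) (f := parsedStacks o)
      (g := parsedStacks fun s c => o s c ++ (T.emit q a s c).toList) (by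
        rintro ⟨v, c, d⟩ k hk
        refine .op_of_eq 0 ?_
        simp only [Op.exec, hk]
        congr 2
        cases d with
        | false =>
          simp only [emitSymbol, parsedStacks, Option.bind_some]
          cases T.emit q a v.1 c <;> simp
        | true => simp [emitSymbol, parsedStacks])
    refine .loop_step (m := 0) (n := w.length + 1)
      (t := ⟨⟨f, x, y, T.step q a, w.head?⟩, w.tail, out,
        parsedStacks fun s c => o s c ++ (T.emit q a s c).toList⟩) rfl
      (.seq (h2.mono (by simp)) (.op_of_eq 0 rfl) (le_refl 0)) ?_ (by simp)
    · convert h1 using 1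
      simp [Transducer.run, Transducer.output]

theorem run_parse (T : Transducer Γ Q I) (out : List Bool) (w : List Γ) (μ : ParserMem Γ Q) :
    Run (parse T) ⟨μ, w, out, fun _ : Tape I m => []⟩
      ⟨{ μ with ctl := (T.run μ.ctl.1 w, none) }, [], out, parsedStacks (T.output μ.ctl.1 w)⟩
      (w.length + 1) := by
  have h := run_parse_loop (m := m) T out w { μ with ctl := (μ.ctl.1, w.head?) }
    (fun _ _ => []) rfl
  refine .seq (.op_of_eq 0 ?_) h (by simp)
  have : (parsedStacks fun _ _ => [] : Tape I m → List (Option Bool)) = fun _ => [] := by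
    funext ⟨v, c, d⟩
    cases d <;> simp [parsedStacks]
  rw [this]
  rfl

noncomputable def rewindAll {C : Type} : Cmd Γ (Tape I m) (Mem C) :=
  forAll fun k : (I × Fin m) × Bool => moveWhile Option.isSome (k.1, k.2, false) (k.1, k.2, true)

theorem run_rewindAll {C : Type} (o : I → Bool → List (Option Bool)) {N : ℕ}
    (hN : ∀ s c, (o s c).length ≤ N) {μ : Mem C} (hx : μ.x = none) {inp : List Γ}
    {out : List Bool} :
    Run rewindAll ⟨μ, inp, out, (parsedStacks o : Tape I m → List (Option Bool))⟩
      ⟨μ, inp, out, fun w => if w.2.2 then o w.1.1 w.2.1 else []⟩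
      (Fintype.card ((I × Fin m) × Bool) * (N + 1)) := by
  have h := run_forAll (Γ := Γ) (κ := (I × Fin m) × Bool) (n := N + 1)
    (c := fun k => (moveWhile Option.isSome (k.1, k.2, false) (k.1, k.2, true) :
      Cmd Γ (Tape I m) (Mem C)))
    (β := List (Option Bool) × List (Option Bool))
    (fun k => ⟨μ, inp, out, fun w => if w.2.2 then (k (w.1, w.2.1)).2 else (k (w.1, w.2.1)).1⟩)
    (f := fun k => ((o k.1.1 k.2).reverse, [])) (g := fun k => ([], o k.1.1 k.2)) (by
      rintro ⟨v, c⟩ k hk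
      refine Run.mono ?_ (Nat.add_le_add_right (hN v.1 c) 1)
      convert run_moveWhile (Γ := Γ) (C := C) (p := Option.isSome)
        (a := ((v, c, false) : Tape I m)) (b := (v, c, true)) (by simp)
        (l₁ := (o v.1 c).reverse) (l₂ := []) ?_ (by simp) rfl using 1
      · rcases μ with ⟨f, x, y, ct⟩
        simp only at hx
        subst hx
        congr 1
        funext ⟨v', c', d⟩
        by_cases h : (v', c') = (v, c)
        · simp only [Prod.mk.injEq] at h
          obtain ⟨rfl, rfl⟩ := h
          cases d <;> simp [hk]
        · have h' : ¬ (v' = v ∧ c' = c) := by simpa using h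
          cases d <;> simp [h']
      · simp
      · simp [hk])
  have e : (parsedStacks o : Tape I m → List (Option Bool)) =
      fun w => if w.2.2 then [] else (o w.1.1 w.2.1).reverse := by
    funext ⟨v, c, d⟩
    cases d <;> simp [parsedStacks]
  rw [e]
  exact h

def clearStack {W C : Type} (w : W) : Cmd Γ W (Mem C) :=
  .seq (.op (.pop w fun μ t => { μ with x := t }))
    (.loop (fun μ => μ.x.isSome) (.op (.pop w fun μ t => { μ with x := t })))

theorem run_clearStack {W C : Type} [DecidableEq W] (w : W) {s : Store Γ W (Mem C)}
    (hx : s.mem.x = none) :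
    Run (clearStack w) s { s with wk := Function.update s.wk w [] } ((s.wk w).length + 1) := by
  -- Here `l` is the stack together with the symbol already popped into `x`.
  have key : ∀ (l : List (Option Bool)) (s : Store Γ W (Mem C)), s.wk w = l.tail →
      s.mem.x = l.head? →
      Run (.loop (fun μ => μ.x.isSome) (.op (.pop w fun μ t => { μ with x := t }))) s
        { s with mem := { s.mem with x := none }, wk := Function.update s.wk w [] }
        (l.length + 1) := by
    intro l
    induction l with
    | nil =>
      rintro ⟨⟨f, x, y, c⟩, i, o, k⟩ h1 h2
      simp only [List.tail_nil, List.head?_nil] at h1 h2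
      subst h2
      rw [← h1]
      simp only [Function.update_eq_self]
      exact .loop_done rfl (by simp)
    | cons t l ih =>
      rintro ⟨⟨f, x, y, c⟩, i, o, k⟩ h1 h2
      simp only [List.tail_cons, List.head?_cons] at h1 h2
      subst h2
      refine .loop_step (m := 0) (n := l.length + 1) rfl (.op _ _ 0) ?_ (by simp)
      have h := ih (Op.exec ⟨⟨f, some t, y, c⟩, i, o, k⟩
        (.pop w fun μ t => { μ with x := t })) (by simp [Op.exec, h1]) (by simp [Op.exec, h1])
      convert h using 1
      simp [Op.exec]
  refine .seq (.op _ _ 0) (?_ : Run _ _ _ ((s.wk w).length + 1)) (by simp)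
  convert key (s.wk w) _ ?_ ?_ using 1
  · rcases s with ⟨⟨f, x, y, c⟩, i, o, k⟩
    simp only at hx
    simp [Op.exec, hx]
  · simp [Op.exec]
  · simp [Op.exec]

noncomputable def clearAll {C : Type} : Cmd Γ (Tape I m) (Mem C) :=
  forAll clearStack

theorem run_clearAll {C : Type} {μ : Mem C} (hx : μ.x = none) {inp : List Γ} {out : List Bool}
    {k : Tape I m → List (Option Bool)} {N : ℕ} (hN : ∀ w, (k w).length ≤ N) :
    Run clearAll ⟨μ, inp, out, k⟩ ⟨μ, inp, out, fun _ => []⟩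
      (Fintype.card (Tape I m) * (N + 1)) :=
  run_forAll (fun k => ⟨μ, inp, out, k⟩) fun w k' hk' => by
    refine (run_clearStack w (s := ⟨μ, inp, out, k'⟩) hx).mono ?_
    simp only [hk']
    exact Nat.add_le_add_right (hN w) 1

noncomputable def parseAndEval (T : Transducer Γ Q I) (φ : Fm I m) (init : ParserMem Γ Q) :
    Cmd Γ (Tape I m) (ParserMem Γ Q) :=
  .seq (parse T) (.seq rewindAll
    (.seq (.ite (fun μ => (T.verdict μ.ctl.1).isNone) (φ.eval fun _ => none)
      (.op (.load fun μ => { μ with flag := (T.verdict μ.ctl.1).getD false })))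
    (.seq clearAll (.seq (.op (.pushOutput fun μ => μ.flag)) (.op (.load fun _ => init))))))

/-- Each input symbol adds at most one symbol to a column, so all columns are bounded by the length
of the input. The number of stacks is fixed and enters only as a constant factor of the cost of
rewinding and clearing. -/
theorem polyTimeDecidable_of_transducer [Fintype Γ] [Fintype Q] (T : Transducer Γ Q I)
    {φ : Fm I m} (hφ : φ.WellScoped (fun _ => none) = true) {α : Type} {enc : α → List Γ}
    {P : α → Prop}
    (h₁ : ∀ a b, T.verdict (T.run T.start (enc a)) = some b → (b = true ↔ P a))
    (h₂ : ∀ a, T.verdict (T.run T.start (enc a)) = none → ∃ D : I → List NamePair,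
      (∀ s c, T.output T.start (enc a) s c = columnSyms (D s) c) ∧
      (φ.Sat D (fun _ => ([], [])) ↔ P a)) :
    PolyTimeDecidable enc P := by
  let init : ParserMem Γ Q := ⟨false, none, none, T.start, none⟩
  refine polyTimeDecidable_of_run (W := Tape I m) (σ := ParserMem Γ Q) (init := init)
    (c := parseAndEval T φ init)
    (Polynomial.X + 1 + (Polynomial.C (Fintype.card ((I × Fin m) × Bool)) * (Polynomial.X + 1) +
      (φ.time + Polynomial.C (Fintype.card (Tape I m)) * (Polynomial.X + 1)))) ?_
  intro a
  set w := enc a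
  set q := T.run T.start w
  have hlen := T.length_output_le T.start w
  have h3 := run_parse (m := m) T [] w init
  have h4 := run_rewindAll (Γ := Γ) (m := m) (T.output T.start w) hlen
    (μ := (⟨false, none, none, q, none⟩ : ParserMem Γ Q)) rfl (inp := []) (out := [])
  have h5 : ∀ b, Run clearAll ⟨⟨b, none, none, q, none⟩, [], [],
      fun w' : Tape I m => if w'.2.2 then T.output T.start w w'.1.1 w'.2.1 else []⟩
      (⟨⟨b, none, none, q, none⟩, [], [], fun _ => []⟩ : Store Γ (Tape I m) (ParserMem Γ Q))
      (Fintype.card (Tape I m) * (w.length + 1)) := by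
    intro b
    refine run_clearAll rfl fun w' => ?_
    split_ifs
    · exact hlen _ _
    · simp
  suffices h6 : ∃ b : Bool, (b = true ↔ P a) ∧
      Run (.ite (fun μ => (T.verdict μ.ctl.1).isNone) (φ.eval fun _ => none)
        (.op (.load fun μ => { μ with flag := (T.verdict μ.ctl.1).getD false })))
        ⟨⟨false, none, none, q, none⟩, [], [],
          fun w' : Tape I m => if w'.2.2 then T.output T.start w w'.1.1 w'.2.1 else []⟩
        (⟨⟨b, none, none, q, none⟩, [], [],
          fun w' : Tape I m => if w'.2.2 then T.output T.start w w'.1.1 w'.2.1 else []⟩ :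
          Store Γ (Tape I m) (ParserMem Γ Q)) (φ.time.eval w.length) by
    obtain ⟨b, hb, h6⟩ := h6
    refine ⟨b, hb, .seq h3 (.seq h4 (.seq h6 (.seq (h5 b) (.seq (.op _ _ 0) (.op_of_eq 0 rfl)
      (le_refl _)) (le_refl _)) (le_refl _)) (le_refl _)) ?_⟩
    simp
  cases hv : T.verdict q with
  | some b =>
    exact ⟨b, h₁ a b hv, .ite_false (by simp [hv]) (.op_of_eq _ (by simp [Op.exec, hv]))⟩
  | none =>
    obtain ⟨D, hD, hP⟩ := h₂ a hv
    obtain ⟨b, hb, hrun⟩ := φ.run_eval D (N := w.length) (fun s c => hD s c ▸ hlen s c)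
      (inp := ([] : List Γ)) (out := []) (fun _ => none) (fun _ => ([], []))
      (fun v => ([], D v.1)) (⟨false, none, none, q, none⟩ : ParserMem Γ Q) rfl rfl hφ
      -- At the start no variable is bound and all lists are rewound.
      ⟨by simp, by simp, by simp⟩
    refine ⟨b, hb.trans hP, .ite_true (by simp [hv]) ?_⟩
    have hz : (fun w' : Tape I m => if w'.2.2 then T.output T.start w w'.1.1 w'.2.1 else []) =
        zipperStacks (fun v => ([], D v.1)) := by
      funext ⟨v, c, d⟩
      cases d with
      | false => rfl
      | true => exact hD v.1 c
    rw [hz]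
    exact hrun

end

end StackProgram

/-! ### Parsing instances and certificates -/

namespace StackProgram

/-- The lists that instances (`args` to `elemAtt`), certificates (`plusArgs` to `witness`) and
universally quantified certificates (`challenge`) consist of. -/
inductive Sec
  | args | uargs | att | uatt | target | addition | elemArg | elemAtt
  | plusArgs | plusAtt | minusArgs | minusAtt | order | witness
  | challenge
  deriving DecidableEq

instance : Fintype Sec where
  elems := {.args, .uargs, .att, .uatt, .target, .addition, .elemArg, .elemAtt, .plusArgs,
    .plusAtt, .minusArgs, .minusAtt, .order, .witness, .challenge}
  complete s := by cases s <;> decide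

inductive Part
  | word | cert | challenge
  deriving DecidableEq

def Sec.part : Sec → Part
  | .args | .uargs | .att | .uatt | .target | .addition | .elemArg | .elemAtt => .word
  | .plusArgs | .plusAtt | .minusArgs | .minusAtt | .order | .witness => .cert
  | .challenge => .challenge

/-- The lists that are given as lists of names `a`, which stand for the pairs `(a, a)`. -/
def Sec.unary : Sec → Bool
  | .args | .uargs | .target | .elemArg => true
  | _ => false

/-- The position in a pair of names: before it, in its first name, or in its second name. -/
inductive Col
  | fresh | fst | snd
  deriving DecidableEq

instance : Fintype Col where
  elems := {.fresh, .fst, .snd}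
  complete c := by cases c <;> decide

inductive Ctl
  | list (s : Sec) (col : Col)
  | action
  | tag
  | reject
  | accept
  deriving DecidableEq, Fintype

/-! ### The automaton that reads instances, certificates and challenges. -/

namespace Ctl

/-- A state of the wrong part leads to rejection, so the boundaries between word, certificate and
challenge are enforced. The state `reject` belongs to no part and is therefore absorbing; `accept`
belongs to the challenge, the only part whose defects lead to acceptance. -/
def part : Ctl → Option Part
  | .list s _ => some s.part
  | .action | .tag => some .word
  | .reject => none
  | .accept => some .challenge

/-- The uncertain element is a single item rather than a list. It ends the instance, so the next
state already expects the certificate. -/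
def afterPair : Sec → Ctl
  | .elemArg | .elemAtt => .list .plusArgs .fresh
  | s => .list s .fresh

def afterName (s : Sec) (col : Col) : Ctl :=
  if s.unary = true ∨ col = .snd then afterPair s else .list s .snd

def afterList : Sec → Ctl
  | .args => .list .uargs .fresh
  | .uargs => .list .att .fresh
  | .att => .list .uatt .fresh
  | .uatt => .list .target .fresh
  | .target => .action
  | .plusArgs => .list .plusAtt .fresh
  | .plusAtt => .list .minusArgs .fresh
  | .minusArgs => .list .minusAtt .fresh
  | .minusAtt => .list .order .fresh
  | .order => .list .witness .fresh
  | .witness => .list .challenge .fresh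
  | .challenge => .accept
  | .addition | .elemArg | .elemAtt => .reject

def rawStep : Ctl → InputSymbol → Ctl
  | .list s .snd, .bit _ => .list s .snd
  | .list s _, .bit _ => .list s .fst
  | .list s col, .endName => afterName s col
  | .list s .fresh, .endList => afterList s
  -- A challenge is closed by the end of the input. An end-of-list marker makes it malformed, and
  -- malformed challenges are accepted.
  | .list .challenge _, .endList => .accept
  | .action, .bit _ => .tag
  | .tag, .bit false => .list .elemArg .fresh
  | .tag, .bit true => .list .elemAtt .fresh
  | .accept, _ => .accept
  | _, _ => .reject

/-- Symbols of unary lists go to both columns, which turns a name `a` into the pair `(a, a)`. The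
action is recorded as a list as well: the pair of empty names for addition, nothing for removal. -/
def rawEmit : Ctl → InputSymbol → Sec → Bool → Option (Option Bool)
  | .list s col, .bit b, s', c =>
    if s' = s ∧ (s.unary = true ∨ c = decide (col = .snd)) then some (some b) else none
  | .list s col, .endName, s', c =>
    if s' = s ∧ (s.unary = true ∨ c = decide (col = .snd)) then some none else none
  | .action, .bit true, s', _ => if s' = .addition then some none else none
  | _, _, _, _ => none

/-- Steps while the part `p` is read. -/
def symStep (p : Part) (q : Ctl) (a : InputSymbol) : Ctl :=
  if q.part = some p then q.rawStep a else .reject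

def symEmit (p : Part) (q : Ctl) (a : InputSymbol) (s : Sec) (c : Bool) :
    Option (Option Bool) :=
  if q.part = some p then q.rawEmit a s c else none

def symRun (p : Part) : Ctl → List InputSymbol → Ctl
  | q, [] => q
  | q, a :: u => symRun p (symStep p q a) u

def symOutput (p : Part) : Ctl → List InputSymbol → Sec → Bool → List (Option Bool)
  | _, [], _, _ => []
  | q, a :: u, s, c => (symEmit p q a s c).toList ++ symOutput p (symStep p q a) u s c

theorem symRun_reject (p : Part) (u : List InputSymbol) : symRun p .reject u = .reject := by
  induction u with
  | nil => rfl
  | cons a u ih => exact ih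

theorem symRun_accept (u : List InputSymbol) : symRun .challenge .accept u = .accept := by
  induction u with
  | nil => rfl
  | cons a u ih => exact ih

theorem symRun_of_part_ne {p : Part} {q : Ctl} (h : q.part ≠ some p) (a : InputSymbol)
    (u : List InputSymbol) : symRun p q (a :: u) = .reject := by
  simp [symRun, symStep, h, symRun_reject]

theorem symRun_endList_of_ne_fresh {s : Sec} {col : Col} (hcol : col ≠ .fresh)
    (u : List InputSymbol) :
    symRun s.part (.list s col) (.endList :: u) = .reject ∨
      symRun s.part (.list s col) (.endList :: u) = .accept := by
  by_cases hs : s = .challenge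
  · subst hs
    right
    cases col <;> first | exact absurd rfl hcol | exact symRun_accept u
  · left
    have : rawStep (.list s col) .endList = .reject := by
      cases col <;> cases s <;> first | exact absurd rfl hcol | exact absurd rfl hs | rfl
    simp [symRun, symStep, part, this, symRun_reject]

/-- The states that can occur at the end of a well-formed part. -/
def Regular (t : Ctl) : Prop :=
  t ≠ .reject ∧ t ≠ .accept ∧ ∀ s col, t = .list s col → col = .fresh

/-! ### Words that lead to a regular state are encodings. -/

open RelevanceInput

/-- A regular final state excludes both `reject` and `accept`, as well as an input that breaks off
inside a pair. What remains is the end of the input, the end of the list, or a complete name. -/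
theorem name_of_symRun {s : Sec} {t : Ctl} (ht : t.Regular) {u : List InputSymbol} :
    ∀ {col : Col}, symRun s.part (.list s col) u = t →
    (col = .fresh ∧ u = [] ∧ t = .list s .fresh) ∨
    (col = .fresh ∧ ∃ v, u = .endList :: v ∧ symRun s.part (afterList s) v = t) ∨
    ∃ a v, u = encodeName a ++ v ∧ symRun s.part (afterName s col) v = t := by
  induction u with
  | nil =>
    intro col h
    have := ht.2.2 s col h.symm
    subst this
    exact .inl ⟨rfl, rfl, h.symm⟩
  | cons x u ih =>
    intro col h
    cases x with
    | bit b =>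
      right; right
      -- After a bit the position is inside a name, where only the third alternative is possible;
      -- the bit is then prefixed to the name found by induction.
      have key : ∀ col', col' ≠ .fresh → afterName s col' = afterName s col →
          symRun s.part (.list s col') u = t →
          ∃ a v, InputSymbol.bit b :: u = encodeName a ++ v ∧
            symRun s.part (afterName s col) v = t := by
        intro col' hne hcol' h'
        rcases ih h' with h1 | h1 | ⟨a, v, rfl, hv⟩
        · exact absurd h1.1 hne
        · exact absurd h1.1 hne
        · exact ⟨b :: a, v, by simp [encodeName], hcol' ▸ hv⟩
      cases col with
      | snd =>
        exact key .snd (by simp) rfl (by simpa [symRun, symStep, part, rawStep] using h)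
      | _ =>
        exact key .fst (by simp) (by simp [afterName])
          (by simpa [symRun, symStep, part, rawStep] using h)
    | endName =>
      right; right
      refine ⟨[], u, by simp [encodeName], ?_⟩
      cases col <;> simpa [symRun, symStep, part, rawStep] using h
    | endList =>
      by_cases hcol : col = .fresh
      · subst hcol
        exact .inr (.inl ⟨rfl, u, rfl, by simpa [symRun, symStep, part, rawStep] using h⟩)
      · rcases symRun_endList_of_ne_fresh hcol u with h1 | h1
        · exact absurd (h.symm.trans h1) ht.1
        · exact absurd (h.symm.trans h1) ht.2.1

/-- Each round consumes two names, so the induction is on a bound for the length. The first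
alternative, without a closing marker, is needed for challenges. -/
theorem atts_of_symRun {s : Sec} {t : Ctl} (ht : t.Regular) (hs : s.unary = false)
    (hs' : afterPair s = .list s .fresh) (n : ℕ) :
    ∀ u : List InputSymbol, u.length ≤ n → symRun s.part (.list s .fresh) u = t →
    ∃ l, (u = l.flatMap encodeAtt ∧ t = .list s .fresh) ∨
      ∃ v, u = encodeAtts l ++ v ∧ symRun s.part (afterList s) v = t := by
  induction n with
  | zero =>
    intro u hu h
    rw [Nat.le_zero, List.length_eq_zero_iff] at hu
    subst hu
    exact ⟨[], .inl ⟨rfl, h.symm⟩⟩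
  | succ n ih =>
    intro u hu h
    rcases name_of_symRun ht h with ⟨-, rfl, h1⟩ | ⟨-, v, rfl, h1⟩ | ⟨a, v, rfl, h1⟩
    · exact ⟨[], .inl ⟨rfl, h1⟩⟩
    · exact ⟨[], .inr ⟨v, by simp [encodeAtts], h1⟩⟩
    · have e1 : afterName s .fresh = .list s .snd := by simp [afterName, hs]
      rw [e1] at h1
      rcases name_of_symRun ht h1 with ⟨h2, -⟩ | ⟨h2, -⟩ | ⟨b, v, rfl, h2⟩
      · exact absurd h2 (by simp)
      · exact absurd h2 (by simp)
      · have e2 : afterName s .snd = .list s .fresh := by simp [afterName, hs']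
        rw [e2] at h2
        obtain ⟨l, h3⟩ := ih v (by simp [encodeName] at hu; omega) h2
        refine ⟨(a, b) :: l, ?_⟩
        rcases h3 with ⟨rfl, h3⟩ | ⟨v, rfl, h3⟩
        · exact .inl ⟨by simp [encodeAtt], h3⟩
        · exact .inr ⟨v, by simp [encodeAtts, encodeAtt], h3⟩

theorem atts_of_symRun_of_ne {s : Sec} {t : Ctl} (ht : t.Regular) (hs : s.unary = false)
    (hs' : afterPair s = .list s .fresh) (hne : t ≠ .list s .fresh) {u : List InputSymbol}
    (h : symRun s.part (.list s .fresh) u = t) :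
    ∃ l v, u = encodeAtts l ++ v ∧ symRun s.part (afterList s) v = t := by
  obtain ⟨l, h1 | ⟨v, h1⟩⟩ := atts_of_symRun ht hs hs' _ u le_rfl h
  · exact absurd h1.2 hne
  · exact ⟨l, v, h1⟩

theorem names_of_symRun {s : Sec} {t : Ctl} (ht : t.Regular) (hs : s.unary = true)
    (hs' : afterPair s = .list s .fresh) (hne : t ≠ .list s .fresh) {u : List InputSymbol}
    (h : symRun s.part (.list s .fresh) u = t) :
    ∃ l v, u = encodeNames l ++ v ∧ symRun s.part (afterList s) v = t := by
  have key : ∀ n, ∀ u : List InputSymbol, u.length ≤ n →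
      symRun s.part (.list s .fresh) u = t →
      ∃ l v, u = encodeNames l ++ v ∧ symRun s.part (afterList s) v = t := by
    intro n
    induction n with
    | zero =>
      intro u hu h
      rw [Nat.le_zero, List.length_eq_zero_iff] at hu
      subst hu
      exact absurd h.symm hne
    | succ n ih =>
      intro u hu h
      rcases name_of_symRun ht h with ⟨-, rfl, h1⟩ | ⟨-, v, rfl, h1⟩ | ⟨a, v, rfl, h1⟩
      · exact absurd h1 hne
      · exact ⟨[], v, by simp [encodeNames], h1⟩
      · have e1 : afterName s .fresh = .list s .fresh := by simp [afterName, hs, hs']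
        rw [e1] at h1
        obtain ⟨l, v, rfl, h3⟩ := ih v (by simp [encodeName] at hu; omega) h1
        exact ⟨a :: l, v, by simp [encodeNames], h3⟩
  exact key _ u le_rfl h

/-- The state `.list .plusArgs .fresh` is the first one of the certificate part. It is reached only
after a complete instance and is left again by any further symbol, so the word contains exactly the
instance. -/
theorem encode_of_symRun {w : List InputSymbol}
    (h : symRun .word (.list .args .fresh) w = .list .plusArgs .fresh) :
    ∃ X : RelevanceInput, w = X.encode := by
  have ht : Regular (.list .plusArgs .fresh) := ⟨by simp, by simp, by simp⟩
  have fin : ∀ v, symRun .word (.list .plusArgs .fresh) v = .list .plusArgs .fresh → v = [] := by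
    intro v hv
    cases v with
    | nil => rfl
    | cons a v =>
      rw [symRun_of_part_ne (by simp [part, Sec.part])] at hv
      simp at hv
  obtain ⟨A, w, rfl, h1⟩ := names_of_symRun (s := .args) ht rfl rfl (by simp) h
  obtain ⟨U, w, rfl, h2⟩ := names_of_symRun (s := .uargs) ht rfl rfl (by simp) h1
  obtain ⟨R, w, rfl, h3⟩ := atts_of_symRun_of_ne (s := .att) ht rfl rfl (by simp) h2
  obtain ⟨Q, w, rfl, h4⟩ := atts_of_symRun_of_ne (s := .uatt) ht rfl rfl (by simp) h3
  obtain ⟨T, w, rfl, h5⟩ := names_of_symRun (s := .target) ht rfl rfl (by simp) h4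
  obtain ⟨c, w, rfl, h6⟩ : ∃ c v, w = encodeAction c ++ v ∧ symRun .word .tag v =
      .list .plusArgs .fresh := by
    rcases w with _ | ⟨x | _ | _, w⟩
    · simp [symRun, afterList] at h5
    · refine ⟨if x then .addition else .removal, w, ?_, h5⟩
      cases x <;> rfl
    · exact absurd (h5.symm.trans (symRun_reject _ w)) (by simp)
    · exact absurd (h5.symm.trans (symRun_reject _ w)) (by simp)
  obtain ⟨e, rfl⟩ : ∃ e, w = encodeElem e := by
    rcases w with _ | ⟨x | _ | _, w⟩
    · simp [symRun] at h6
    · cases x with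
      | false =>
        rcases name_of_symRun (s := .elemArg) (col := .fresh) ht h6 with
          ⟨-, -, h7⟩ | ⟨-, v, -, h7⟩ | ⟨a, v, rfl, h7⟩
        · simp at h7
        · exact absurd (h7.symm.trans (symRun_reject _ v)) (by simp)
        · obtain rfl := fin v h7
          exact ⟨.inl a, by simp [encodeElem]⟩
      | true =>
        rcases name_of_symRun (s := .elemAtt) (col := .fresh) ht h6 with
          ⟨-, -, h7⟩ | ⟨-, v, -, h7⟩ | ⟨a, v, rfl, h7⟩
        · simp at h7
        · exact absurd (h7.symm.trans (symRun_reject _ v)) (by simp)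
        · rcases name_of_symRun (s := .elemAtt) (col := .snd) ht h7 with
            ⟨h8, -⟩ | ⟨h8, -⟩ | ⟨b, v, rfl, h8⟩
          · simp at h8
          · simp at h8
          · obtain rfl := fin v h8
            exact ⟨.inr (a, b), by simp [encodeElem, encodeAtt]⟩
    · exact absurd (h6.symm.trans (symRun_reject _ w)) (by simp)
    · exact absurd (h6.symm.trans (symRun_reject _ w)) (by simp)
  exact ⟨⟨A, U, R, Q, T, c, e⟩, rfl⟩

end Ctl

/-- The lists in a certificate. -/
structure Certificate where
  plusArgs : List NamePair
  plusAtt : List NamePair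
  minusArgs : List NamePair
  minusAtt : List NamePair
  order : List NamePair
  witness : List NamePair

open RelevanceInput in
def Certificate.encode (C : Certificate) : List InputSymbol :=
  encodeAtts C.plusArgs ++ (encodeAtts C.plusAtt ++ (encodeAtts C.minusArgs ++
    (encodeAtts C.minusAtt ++ (encodeAtts C.order ++ encodeAtts C.witness))))

namespace Ctl

open RelevanceInput

theorem certificate_of_symRun {u : List InputSymbol}
    (h : symRun .cert (.list .plusArgs .fresh) u = .list .challenge .fresh) :
    ∃ C : Certificate, u = C.encode := by
  have ht : Regular (.list .challenge .fresh) := ⟨by simp, by simp, by simp⟩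
  obtain ⟨l1, u, rfl, h1⟩ := atts_of_symRun_of_ne (s := .plusArgs) ht rfl rfl (by simp) h
  obtain ⟨l2, u, rfl, h2⟩ := atts_of_symRun_of_ne (s := .plusAtt) ht rfl rfl (by simp) h1
  obtain ⟨l3, u, rfl, h3⟩ := atts_of_symRun_of_ne (s := .minusArgs) ht rfl rfl (by simp) h2
  obtain ⟨l4, u, rfl, h4⟩ := atts_of_symRun_of_ne (s := .minusAtt) ht rfl rfl (by simp) h3
  obtain ⟨l5, u, rfl, h5⟩ := atts_of_symRun_of_ne (s := .order) ht rfl rfl (by simp) h4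
  obtain ⟨l6, u, rfl, h6⟩ := atts_of_symRun_of_ne (s := .witness) ht rfl rfl (by simp) h5
  refine ⟨⟨l1, l2, l3, l4, l5, l6⟩, ?_⟩
  cases u with
  | nil => simp [Certificate.encode]
  | cons a u => exact absurd (h6.symm.trans (symRun_of_part_ne (by decide) a u)) (by simp)

theorem challenge_of_symRun {u : List InputSymbol}
    (h : symRun .challenge (.list .challenge .fresh) u = .list .challenge .fresh) :
    ∃ l : List NamePair, u = l.flatMap encodeAtt := by
  obtain ⟨l, h1 | ⟨v, -, h1⟩⟩ := atts_of_symRun (s := .challenge)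
    ⟨by simp, by simp, by simp⟩ rfl rfl _ u le_rfl h
  · exact ⟨l, h1.1⟩
  · exact absurd (h1.symm.trans (symRun_accept v)) (by simp)

theorem symRun_name (s : Sec) (a : ArgName) (u : List InputSymbol) (col : Col) :
    symRun s.part (.list s col) (encodeName a ++ u) = symRun s.part (afterName s col) u := by
  induction a generalizing col with
  | nil => cases col <;> simp [encodeName, symRun, symStep, part, rawStep]
  | cons b a ih =>
    have h1 := ih .fst
    have h2 := ih .snd
    cases col <;> simp_all [encodeName, symRun, symStep, part, rawStep, afterName]

theorem symOutput_name (s : Sec) (a : ArgName) (u : List InputSymbol) (col : Col) (s' : Sec)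
    (c : Bool) :
    symOutput s.part (.list s col) (encodeName a ++ u) s' c =
      (if s' = s ∧ (s.unary = true ∨ c = decide (col = .snd)) then nameSyms a else []) ++
        symOutput s.part (afterName s col) u s' c := by
  induction a generalizing col with
  | nil =>
    simp only [encodeName, List.map_nil, List.nil_append, List.cons_append, symOutput, symEmit,
      part, if_true, rawEmit, symStep, nameSyms]
    cases col <;> split_ifs <;> rfl
  | cons b a ih =>
    have h1 := ih .fst
    have h2 := ih .snd
    cases col <;>
      simp_all only [encodeName, List.map_cons, List.cons_append, symOutput, symEmit, part,
        if_true, rawEmit, symStep, rawStep, nameSyms, afterName] <;>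
      split_ifs <;> simp_all

theorem symRun_atts {s : Sec} (hs : s.unary = false) (hs' : afterPair s = .list s .fresh)
    (l : List NamePair) (u : List InputSymbol) :
    symRun s.part (.list s .fresh) (l.flatMap encodeAtt ++ u) =
      symRun s.part (.list s .fresh) u := by
  induction l with
  | nil => rfl
  | cons p l ih =>
    simp only [List.flatMap_cons, encodeAtt, List.append_assoc, symRun_name]
    simp [afterName, hs, symRun_name, hs', ih]

theorem symOutput_atts {s : Sec} (hs : s.unary = false) (hs' : afterPair s = .list s .fresh)
    (l : List NamePair) (u : List InputSymbol) (s' : Sec) (c : Bool) :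
    symOutput s.part (.list s .fresh) (l.flatMap encodeAtt ++ u) s' c =
      (if s' = s then columnSyms l c else []) ++ symOutput s.part (.list s .fresh) u s' c := by
  induction l with
  | nil => simp [columnSyms]
  | cons p l ih =>
    simp only [List.flatMap_cons, encodeAtt, List.append_assoc, symOutput_name, columnSyms_cons]
    have e1 : afterName s .fresh = .list s .snd := by simp [afterName, hs]
    have e2 : afterName s .snd = .list s .fresh := by simp [afterName, hs']
    rw [e1, symOutput_name, e2, ih]
    by_cases h : s' = s <;> cases c <;> simp [h, hs, component]

theorem symRun_encodeAtts {s : Sec} (hs : s.unary = false) (hs' : afterPair s = .list s .fresh)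
    (l : List NamePair) (u : List InputSymbol) :
    symRun s.part (.list s .fresh) (encodeAtts l ++ u) = symRun s.part (afterList s) u := by
  rw [encodeAtts, List.append_assoc, symRun_atts hs hs']
  simp [symRun, symStep, part, rawStep]

theorem symOutput_encodeAtts {s : Sec} (hs : s.unary = false)
    (hs' : afterPair s = .list s .fresh) (l : List NamePair) (u : List InputSymbol) (s' : Sec)
    (c : Bool) :
    symOutput s.part (.list s .fresh) (encodeAtts l ++ u) s' c =
      (if s' = s then columnSyms l c else []) ++ symOutput s.part (afterList s) u s' c := by
  rw [encodeAtts, List.append_assoc, symOutput_atts hs hs']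
  simp [symOutput, symStep, symEmit, part, rawStep, rawEmit]

def diag (l : List ArgName) : List NamePair :=
  l.map fun a => (a, a)

theorem columnSyms_diag (l : List ArgName) (c : Bool) :
    columnSyms (diag l) c = l.flatMap nameSyms := by
  induction l with
  | nil => rfl
  | cons a l ih =>
    rw [diag, List.map_cons, columnSyms_cons, List.flatMap_cons]
    congr 1
    cases c <;> rfl

theorem symRun_encodeNames {s : Sec} (hs : s.unary = true) (hs' : afterPair s = .list s .fresh)
    (l : List ArgName) (u : List InputSymbol) :
    symRun s.part (.list s .fresh) (encodeNames l ++ u) = symRun s.part (afterList s) u := by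
  induction l with
  | nil => simp [encodeNames, symRun, symStep, part, rawStep]
  | cons a l ih =>
    simp only [encodeNames, List.flatMap_cons, List.append_assoc, symRun_name] at ih ⊢
    have e1 : afterName s .fresh = .list s .fresh := by simp [afterName, hs, hs']
    rw [e1, ih]

theorem symOutput_encodeNames {s : Sec} (hs : s.unary = true)
    (hs' : afterPair s = .list s .fresh) (l : List ArgName) (u : List InputSymbol) (s' : Sec)
    (c : Bool) :
    symOutput s.part (.list s .fresh) (encodeNames l ++ u) s' c =
      (if s' = s then columnSyms (diag l) c else []) ++ symOutput s.part (afterList s) u s' c := by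
  rw [columnSyms_diag]
  induction l with
  | nil => simp [encodeNames, symOutput, symStep, symEmit, part, rawStep, rawEmit]
  | cons a l ih =>
    simp only [encodeNames, List.flatMap_cons, List.append_assoc, symOutput_name] at ih ⊢
    have e1 : afterName s .fresh = .list s .fresh := by simp [afterName, hs, hs']
    rw [e1, ih]
    by_cases h : s' = s <;> simp [h, hs]

end Ctl

/-- The lists given by an instance, a certificate and a challenge. -/
def lists (X : RelevanceInput) (C : Certificate) (l : List NamePair) : Sec → List NamePair
  | .args => Ctl.diag X.args
  | .uargs => Ctl.diag X.uargs
  | .att => X.att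
  | .uatt => X.uatt
  | .target => Ctl.diag X.target
  | .addition => match X.action with
    | .addition => [([], [])]
    | .removal => []
  | .elemArg => match X.elem with
    | .inl a => [(a, a)]
    | .inr _ => []
  | .elemAtt => match X.elem with
    | .inl _ => []
    | .inr r => [r]
  | .plusArgs => C.plusArgs
  | .plusAtt => C.plusAtt
  | .minusArgs => C.minusArgs
  | .minusAtt => C.minusAtt
  | .order => C.order
  | .witness => C.witness
  | .challenge => l

namespace Ctl

open RelevanceInput

theorem symRun_encode (X : RelevanceInput) :
    symRun .word (.list .args .fresh) X.encode = .list .plusArgs .fresh := by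
  refine (symRun_encodeNames (s := .args) rfl rfl _ _).trans ?_
  refine (symRun_encodeNames (s := .uargs) rfl rfl _ _).trans ?_
  refine (symRun_encodeAtts (s := .att) rfl rfl _ _).trans ?_
  refine (symRun_encodeAtts (s := .uatt) rfl rfl _ _).trans ?_
  refine (symRun_encodeNames (s := .target) rfl rfl _ _).trans ?_
  have h : symRun .word .tag (encodeElem X.elem) = .list .plusArgs .fresh := by
    rcases X.elem with a | ⟨a, b⟩
    · have := symRun_name .elemArg a [] .fresh
      rw [List.append_nil] at this
      exact this
    · refine (symRun_name .elemAtt a (encodeName b) .fresh).trans ?_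
      have := symRun_name .elemAtt b [] .snd
      rw [List.append_nil] at this
      exact this
  cases X.action <;> exact h

theorem symRun_certificate (C : Certificate) :
    symRun .cert (.list .plusArgs .fresh) C.encode = .list .challenge .fresh := by
  refine (symRun_encodeAtts (s := .plusArgs) rfl rfl _ _).trans ?_
  refine (symRun_encodeAtts (s := .plusAtt) rfl rfl _ _).trans ?_
  refine (symRun_encodeAtts (s := .minusArgs) rfl rfl _ _).trans ?_
  refine (symRun_encodeAtts (s := .minusAtt) rfl rfl _ _).trans ?_
  refine (symRun_encodeAtts (s := .order) rfl rfl _ _).trans ?_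
  rw [← List.append_nil (encodeAtts C.witness)]
  exact symRun_encodeAtts (s := .witness) rfl rfl _ _

theorem symRun_challenge (l : List NamePair) :
    symRun .challenge (.list .challenge .fresh) (l.flatMap encodeAtt) =
      .list .challenge .fresh := by
  rw [← List.append_nil (l.flatMap encodeAtt)]
  exact symRun_atts (s := .challenge) rfl rfl _ _

/-- Each segment of the word contributes only to its own list. Therefore, of the concatenated
outputs, at most one is nonempty for a given `s`. -/
theorem symOutput_encode (X : RelevanceInput) (C : Certificate) (l : List NamePair) (s : Sec)
    (c : Bool) :
    symOutput .word (.list .args .fresh) X.encode s c =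
      if s.part = .word then columnSyms (lists X C l s) c else [] := by
  have h : symOutput .word .action (encodeAction X.action ++ encodeElem X.elem) s c =
      if s = .addition ∨ s = .elemArg ∨ s = .elemAtt then columnSyms (lists X C l s) c
      else [] := by
    have h1 : symOutput .word .tag (encodeElem X.elem) s c =
        if s = .elemArg ∨ s = .elemAtt then columnSyms (lists X C l s) c else [] := by
      rcases he : X.elem with a | ⟨a, b⟩
      · have := symOutput_name .elemArg a [] .fresh s c
        rw [List.append_nil] at this
        refine Eq.trans (this : symOutput .word .tag (encodeElem (.inl a)) s c = _) ?_
        cases s <;> simp [lists, he, columnSyms, symOutput, Sec.unary]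
        cases c <;> rfl
      · have h2 := symOutput_name .elemAtt b [] .snd s c
        have h3 := symOutput_name .elemAtt a (encodeName b) .fresh s c
        rw [List.append_nil] at h2
        refine Eq.trans (h3 : symOutput .word .tag (encodeElem (.inr (a, b))) s c = _) ?_
        refine (congrArg _ h2).trans ?_
        cases s <;> cases c <;> simp [lists, he, columnSyms, symOutput, Sec.unary, component]
    cases ha : X.action with
    | addition =>
      simp only [encodeAction, List.cons_append, List.nil_append, symOutput, symStep, symEmit,
        part, if_true, rawStep, rawEmit, h1]
      cases s <;> simp [lists, ha, columnSyms, nameSyms, component]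
      cases c <;> rfl
    | removal =>
      simp only [encodeAction, List.cons_append, List.nil_append, symOutput, symStep, symEmit,
        part, if_true, rawStep, rawEmit, h1]
      cases s <;> simp [lists, ha, columnSyms]
  refine (symOutput_encodeNames (s := .args) rfl rfl _ _ _ _).trans ?_
  refine (congrArg _ (symOutput_encodeNames (s := .uargs) rfl rfl _ _ _ _)).trans ?_
  refine (congrArg _ (congrArg _ (symOutput_encodeAtts (s := .att) rfl rfl _ _ _ _))).trans ?_
  refine (congrArg _ (congrArg _ (congrArg _
    (symOutput_encodeAtts (s := .uatt) rfl rfl _ _ _ _)))).trans ?_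
  refine (congrArg _ (congrArg _ (congrArg _ (congrArg _
    (symOutput_encodeNames (s := .target) rfl rfl _ _ _ _))))).trans ?_
  refine (congrArg _ (congrArg _ (congrArg _ (congrArg _ (congrArg _ h))))).trans ?_
  cases s <;> simp [Sec.part, lists]

theorem symOutput_certificate (X : RelevanceInput) (C : Certificate) (l : List NamePair)
    (s : Sec) (c : Bool) :
    symOutput .cert (.list .plusArgs .fresh) C.encode s c =
      if s.part = .cert then columnSyms (lists X C l s) c else [] := by
  refine (symOutput_encodeAtts (s := .plusArgs) rfl rfl _ _ _ _).trans ?_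
  refine (congrArg _ (symOutput_encodeAtts (s := .plusAtt) rfl rfl _ _ _ _)).trans ?_
  refine (congrArg _ (congrArg _
    (symOutput_encodeAtts (s := .minusArgs) rfl rfl _ _ _ _))).trans ?_
  refine (congrArg _ (congrArg _ (congrArg _
    (symOutput_encodeAtts (s := .minusAtt) rfl rfl _ _ _ _)))).trans ?_
  refine (congrArg _ (congrArg _ (congrArg _ (congrArg _
    (symOutput_encodeAtts (s := .order) rfl rfl _ _ _ _))))).trans ?_
  rw [← List.append_nil (encodeAtts C.witness)]
  refine (congrArg _ (congrArg _ (congrArg _ (congrArg _ (congrArg _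
    (symOutput_encodeAtts (s := .witness) rfl rfl _ _ _ _)))))).trans ?_
  cases s <;> simp [Sec.part, lists, symOutput]

theorem symOutput_challenge (X : RelevanceInput) (C : Certificate) (l : List NamePair)
    (s : Sec) (c : Bool) :
    symOutput .challenge (.list .challenge .fresh) (l.flatMap encodeAtt) s c =
      if s.part = .challenge then columnSyms (lists X C l s) c else [] := by
  rw [← List.append_nil (l.flatMap encodeAtt)]
  refine (symOutput_atts (s := .challenge) rfl rfl _ _ _ _).trans ?_
  cases s <;> simp [Sec.part, lists, symOutput]

end Ctl

end StackProgram

/-! ### Verifiers given by formulas -/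

namespace StackProgram

open Classical in
noncomputable instance : Fintype InputSymbol :=
  Fintype.ofSurjective (fun o : Option (Option Bool) => match o with
    | none => InputSymbol.endList
    | some none => InputSymbol.endName
    | some (some b) => InputSymbol.bit b) fun a => match a with
      | .endList => ⟨none, rfl⟩
      | .endName => ⟨some none, rfl⟩
      | .bit b => ⟨some (some b), rfl⟩

/-- Certificates and challenges are bit strings, in which two bits stand for a symbol. All four
pairs are used, so every bit string of even length can be decoded. -/
def decodeBits : Bool → Bool → InputSymbol
  | true, b => .bit b
  | false, true => .endName
  | false, false => .endList

def symBits : InputSymbol → List Bool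
  | .bit b => [true, b]
  | .endName => [false, true]
  | .endList => [false, false]

theorem exists_symBits (a : InputSymbol) :
    ∃ b b', symBits a = [b, b'] ∧ decodeBits b b' = a := by
  cases a with
  | bit b => exact ⟨true, b, rfl, rfl⟩
  | endName => exact ⟨false, true, rfl, rfl⟩
  | endList => exact ⟨false, false, rfl, rfl⟩

theorem symBits_decodeBits (b b' : Bool) : symBits (decodeBits b b') = [b, b'] := by
  cases b <;> cases b' <;> rfl

theorem exists_flatMap_symBits : ∀ y : List Bool,
    ∃ u : List InputSymbol, y = u.flatMap symBits ∨ ∃ b, y = u.flatMap symBits ++ [b]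
  | [] => ⟨[], .inl rfl⟩
  | [b] => ⟨[], .inr ⟨b, rfl⟩⟩
  | b :: b' :: y => by
    obtain ⟨u, rfl | ⟨c, rfl⟩⟩ := exists_flatMap_symBits y
    · exact ⟨decodeBits b b' :: u, .inl (by simp [symBits_decodeBits])⟩
    · exact ⟨decodeBits b b' :: u, .inr ⟨c, by simp [symBits_decodeBits]⟩⟩

theorem flatMap_symBits_injective :
    Function.Injective fun u : List InputSymbol => u.flatMap symBits := by
  intro u
  induction u with
  | nil =>
    intro v h
    cases v with
    | nil => rfl
    | cons a v => cases a <;> simp [symBits] at h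
  | cons a u ih =>
    intro v h
    cases v with
    | nil => cases a <;> simp [symBits] at h
    | cons a' v =>
      have key : a = a' ∧ u.flatMap symBits = v.flatMap symBits := by
        cases a <;> cases a' <;> simp_all [symBits]
      rw [key.1, ih key.2]

/-- Symbols of an instance, bits of a certificate, and bits of a challenge. -/
abbrev Event : Type := InputSymbol ⊕ (Bool ⊕ Bool)

/-- The optional bit in the state is the first half of a symbol that has been read only partially.
-/
def bitStep (p : Part) (q : Ctl × Option Bool) (b : Bool) : Ctl × Option Bool :=
  if q.1.part = some p then
    match q.2 with
    | none => (q.1, some b)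
    | some b' => (q.1.symStep p (decodeBits b' b), none)
  else (.reject, none)

def bitEmit (p : Part) (q : Ctl × Option Bool) (b : Bool) (s : Sec) (c : Bool) :
    Option (Option Bool) :=
  q.2.bind fun b' => q.1.symEmit p (decodeBits b' b) s c

/-- The verdict is left to the formula only when all three parts are complete. Ending before the
challenge part means a defective instance or certificate and gives rejection; any other ending
within the challenge part means a defective challenge and gives acceptance. -/
def reader : Transducer Event (Ctl × Option Bool) Sec where
  start := (.list .args .fresh, none)
  step q e := match e with
    | .inl a => (q.1.symStep .word a, none)
    | .inr (.inl b) => bitStep .cert q b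
    | .inr (.inr b) => bitStep .challenge q b
  emit q e s c := match e with
    | .inl a => q.1.symEmit .word a s c
    | .inr (.inl b) => bitEmit .cert q b s c
    | .inr (.inr b) => bitEmit .challenge q b s c
  verdict q :=
    if q.1.part = some .challenge then
      if q = (.list .challenge .fresh, none) then none else some true
    else some false

/-! ### Concatenated input, translated alphabets and invariants. -/

namespace Transducer

variable {Γ Δ Q I : Type} (T : Transducer Γ Q I)

theorem run_append (q : Q) (u v : List Γ) : T.run q (u ++ v) = T.run (T.run q u) v := by
  induction u generalizing q with
  | nil => rfl
  | cons a u ih => exact ih _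

theorem output_append (q : Q) (u v : List Γ) (s : I) (c : Bool) :
    T.output q (u ++ v) s c = T.output q u s c ++ T.output (T.run q u) v s c := by
  induction u generalizing q with
  | nil => rfl
  | cons a u ih => simp [output, run, ih]

def comap (g : Δ → Γ) : Transducer Δ Q I where
  start := T.start
  step q a := T.step q (g a)
  emit q a := T.emit q (g a)
  verdict := T.verdict

theorem run_comap (g : Δ → Γ) (q : Q) (u : List Δ) :
    (T.comap g).run q u = T.run q (u.map g) := by
  induction u generalizing q with
  | nil => rfl
  | cons a u ih => exact ih _

theorem output_comap (g : Δ → Γ) (q : Q) (u : List Δ) (s : I) (c : Bool) :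
    (T.comap g).output q u s c = T.output q (u.map g) s c := by
  induction u generalizing q with
  | nil => rfl
  | cons a u ih => exact congrArg _ (ih _)

theorem run_invariant {S : Q → Prop} {E : Γ → Prop}
    (h : ∀ q a, S q → E a → S (T.step q a)) {q : Q} (hq : S q) {u : List Γ}
    (hu : ∀ a ∈ u, E a) : S (T.run q u) := by
  induction u generalizing q with
  | nil => exact hq
  | cons a u ih => exact ih (h q a hq (hu a (by simp))) fun b hb => hu b (by simp [hb])

end Transducer

theorem reader_run_word (q : Ctl) (u : List InputSymbol) :
    reader.run (q, none) (u.map .inl) = (q.symRun .word u, none) := by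
  induction u generalizing q with
  | nil => rfl
  | cons a u ih => exact ih _

theorem reader_output_word (q : Ctl) (u : List InputSymbol) (s : Sec) (c : Bool) :
    reader.output (q, none) (u.map .inl) s c = q.symOutput .word u s c := by
  induction u generalizing q with
  | nil => rfl
  | cons a u ih => exact congrArg _ (ih _)

theorem Ctl.part_reject : Ctl.part .reject = none := rfl

/-! ### Symbols coded by two bits, for certificates and challenges alike. -/

section Bits

variable {p : Part} {ι : Bool → Event} (hstep : ∀ q b, reader.step q (ι b) = bitStep p q b)
  (hemit : ∀ q b s c, reader.emit q (ι b) s c = bitEmit p q b s c)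

include hstep in
theorem reader_run_bits (q : Ctl) (u : List InputSymbol) :
    reader.run (q, none) ((u.flatMap symBits).map ι) = (q.symRun p u, none) := by
  induction u generalizing q with
  | nil => rfl
  | cons a u ih =>
    obtain ⟨b, b', h, h'⟩ := exists_symBits a
    rw [List.flatMap_cons, h, List.map_append, Ctl.symRun, ← ih]
    simp only [List.map_cons, List.map_nil, List.cons_append, List.nil_append, Transducer.run,
      hstep]
    congr 1
    by_cases hq : q.part = some p
    · simp [bitStep, hq, h']
    · simp [bitStep, hq, Ctl.symStep, Ctl.part_reject]

include hstep hemit in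
theorem reader_output_bits (q : Ctl) (u : List InputSymbol) (s : Sec) (c : Bool) :
    reader.output (q, none) ((u.flatMap symBits).map ι) s c = q.symOutput p u s c := by
  induction u generalizing q with
  | nil => rfl
  | cons a u ih =>
    obtain ⟨b, b', h, h'⟩ := exists_symBits a
    rw [List.flatMap_cons, h, List.map_append, Ctl.symOutput, ← ih]
    simp only [List.map_cons, List.map_nil, List.cons_append, List.nil_append, Transducer.output,
      hstep, hemit]
    by_cases hq : q.part = some p
    · simp [bitStep, bitEmit, hq, h']
    · simp [bitStep, bitEmit, hq, Ctl.symStep, Ctl.symEmit, Ctl.part_reject]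

end Bits

namespace Ctl

theorem symRun_invariant {S : Ctl → Prop} {p : Part} (h : ∀ q a, S q → S (symStep p q a))
    {q : Ctl} (hq : S q) (u : List InputSymbol) : S (symRun p q u) := by
  induction u generalizing q with
  | nil => exact hq
  | cons a u ih => exact ih (h q a hq)

/-- Reading the word cannot lead beyond the first state of the certificate part. With its analogue
for certificates this locates the boundaries of the parts in `exists_encode_of_verdict`. -/
theorem symRun_word_cases (u : List InputSymbol) (q : Ctl)
    (hq : q.part = some .word ∨ q = .reject ∨ q = .list .plusArgs .fresh) :
    (symRun .word q u).part = some .word ∨ symRun .word q u = .reject ∨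
      symRun .word q u = .list .plusArgs .fresh := by
  refine symRun_invariant (S := fun q => q.part = some .word ∨ q = .reject ∨
    q = .list .plusArgs .fresh) ?_ hq u
  rintro q a (h | rfl | rfl)
  · simp only [symStep, h, if_true]
    rcases q with ⟨s, col⟩ | _ | _ | _ | _ <;> rcases a with (_ | _) | _ | _ <;>
      first
      | (cases s <;> cases col <;> first | exact absurd h (by decide) | decide)
      | exact absurd h (by decide)
      | decide
  · exact .inr (.inl rfl)
  · exact .inr (.inl rfl)

theorem symRun_cert_cases (u : List InputSymbol) (q : Ctl)
    (hq : q.part = some .cert ∨ q = .reject ∨ q = .list .challenge .fresh) :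
    (symRun .cert q u).part = some .cert ∨ symRun .cert q u = .reject ∨
      symRun .cert q u = .list .challenge .fresh := by
  refine symRun_invariant (S := fun q => q.part = some .cert ∨ q = .reject ∨
    q = .list .challenge .fresh) ?_ hq u
  rintro q a (h | rfl | rfl)
  · simp only [symStep, h, if_true]
    rcases q with ⟨s, col⟩ | _ | _ | _ | _ <;> rcases a with (_ | _) | _ | _ <;>
      first
      | (cases s <;> cases col <;> first | exact absurd h (by decide) | decide)
      | exact absurd h (by decide)
  · exact .inr (.inl rfl)
  · exact .inr (.inl rfl)

theorem symRun_challenge_part (u : List InputSymbol) (q : Ctl)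
    (hq : q.part = some .challenge) : (symRun .challenge q u).part = some .challenge := by
  refine symRun_invariant (S := fun q => q.part = some .challenge) ?_ hq u
  intro q a h
  simp only [symStep, h, if_true]
  rcases q with ⟨s, col⟩ | _ | _ | _ | _ <;> rcases a with (_ | _) | _ | _ <;>
    first
    | (cases s <;> cases col <;> first | exact absurd h (by decide) | decide)
    | exact absurd h (by decide)
    | rfl

end Ctl

/-- The input of the reader for an instance, a certificate and a challenge. -/
def events (w : List InputSymbol) (y z : List Bool) : List Event :=
  w.map .inl ++ ((y.map Sum.inl ++ z.map Sum.inr).map .inr)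

theorem events_eq (w : List InputSymbol) (y z : List Bool) :
    events w y z = w.map .inl ++ (y.map (fun b => .inr (.inl b)) ++
      z.map (fun b => .inr (.inr b))) := by
  simp [events, Function.comp_def]

open RelevanceInput

def challengeBits (l : List NamePair) : List Bool :=
  (l.flatMap encodeAtt).flatMap symBits

def Certificate.bits (C : Certificate) : List Bool :=
  C.encode.flatMap symBits

theorem reader_run_events (X : RelevanceInput) (C : Certificate) (z : List Bool) :
    reader.run reader.start (events X.encode C.bits z) =
      reader.run (.list .challenge .fresh, none) (z.map fun b => .inr (.inr b)) := by
  rw [events_eq, Transducer.run_append, Transducer.run_append]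
  have h1 := reader_run_word (.list .args .fresh) X.encode
  have h2 := reader_run_bits (p := .cert) (ι := fun b => .inr (.inl b)) (fun _ _ => rfl)
    (.list .plusArgs .fresh) C.encode
  rw [Ctl.symRun_encode] at h1
  rw [Ctl.symRun_certificate] at h2
  rw [show reader.start = (.list .args .fresh, none) from rfl, h1, Certificate.bits, h2]

theorem reader_output_events (X : RelevanceInput) (C : Certificate) (l : List NamePair)
    (s : Sec) (c : Bool) :
    reader.output reader.start (events X.encode C.bits (challengeBits l)) s c =
      columnSyms (lists X C l s) c := by
  rw [events_eq, Transducer.output_append, Transducer.output_append]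
  have h1 := reader_run_word (.list .args .fresh) X.encode
  have h2 := reader_run_bits (p := .cert) (ι := fun b => .inr (.inl b)) (fun _ _ => rfl)
    (.list .plusArgs .fresh) C.encode
  rw [Ctl.symRun_encode] at h1
  rw [Ctl.symRun_certificate] at h2
  rw [show reader.start = (.list .args .fresh, none) from rfl, h1, Certificate.bits, h2,
    challengeBits, reader_output_word,
    reader_output_bits (p := .cert) (fun _ _ => rfl) (fun _ _ _ _ => rfl),
    reader_output_bits (p := .challenge) (fun _ _ => rfl) (fun _ _ _ _ => rfl),
    Ctl.symOutput_encode X C l, Ctl.symOutput_certificate X C l, Ctl.symOutput_challenge X C l]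
  cases s <;> simp [Sec.part]

theorem verdict_challengeBits (X : RelevanceInput) (C : Certificate) (l : List NamePair) :
    reader.verdict (reader.run reader.start (events X.encode C.bits (challengeBits l))) =
      none := by
  rw [reader_run_events, challengeBits,
    reader_run_bits (p := .challenge) (fun _ _ => rfl), Ctl.symRun_challenge]
  rfl

theorem verdict_encode (X : RelevanceInput) (C : Certificate) (z : List Bool) :
    reader.verdict (reader.run reader.start (events X.encode C.bits z)) = some true ∨
      ∃ l, z = challengeBits l := by
  rw [reader_run_events]
  obtain ⟨u, rfl | ⟨b, rfl⟩⟩ := exists_flatMap_symBits z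
  · rw [reader_run_bits (p := .challenge) (fun _ _ => rfl)]
    have h1 := Ctl.symRun_challenge_part u (.list .challenge .fresh) rfl
    by_cases h2 : Ctl.symRun .challenge (.list .challenge .fresh) u = .list .challenge .fresh
    · obtain ⟨l, rfl⟩ := Ctl.challenge_of_symRun h2
      exact .inr ⟨l, rfl⟩
    · left
      simp [reader, h1, h2]
  · left
    rw [List.map_append, Transducer.run_append,
      reader_run_bits (p := .challenge) (fun _ _ => rfl)]
    have h1 := Ctl.symRun_challenge_part u (.list .challenge .fresh) rfl
    simp [reader, Transducer.run, bitStep, h1]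

/-- The argument runs backwards from the end. Only states of the challenge part avoid rejection, and
challenge bits never lead into that part from outside, so the certificate bits must already have
reached it; this in turn forces the word to end at the first state of the certificate part. -/
theorem exists_encode_of_verdict {w : List InputSymbol} {y z : List Bool}
    (h : reader.verdict (reader.run reader.start (events w y z)) ≠ some false) :
    ∃ X C, w = RelevanceInput.encode X ∧ y = Certificate.bits C := by
  rw [events_eq, Transducer.run_append, Transducer.run_append,
    show reader.start = (.list .args .fresh, none) from rfl, reader_run_word] at h
  set q₁ := Ctl.symRun .word (.list .args .fresh) w with hq₁
  have h2 : (reader.run (q₁, none) (y.map fun b => .inr (.inl b))).1.part = some .challenge := by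
    by_contra hne
    have := reader.run_invariant (S := fun q => q.1.part ≠ some .challenge)
      (E := fun e => ∃ b, e = .inr (.inr b)) (by
        rintro q _ hq ⟨b, rfl⟩
        simp [reader, bitStep, hq, Ctl.part_reject]) hne (u := z.map fun b => .inr (.inr b)) (by simp)
    exact h (if_neg this)
  have h3 : q₁ = .list .plusArgs .fresh := by
    have bad : ¬ (q₁.part ≠ some .cert ∧ q₁.part ≠ some .challenge) := by
      intro hbad
      refine (reader.run_invariant
        (S := fun q => q.1.part ≠ some .cert ∧ q.1.part ≠ some .challenge)
        (E := fun e => ∃ b, e = .inr (.inl b)) ?_ (q := (q₁, none)) hbad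
        (u := y.map fun b => .inr (.inl b)) (by simp)).2 h2
      rintro q _ hq ⟨b, rfl⟩
      simp [reader, bitStep, hq.1, Ctl.part_reject]
    rcases Ctl.symRun_word_cases w (.list .args .fresh) (.inl rfl) with h3 | h3 | h3
    · exact absurd (by rw [hq₁, h3]; simp) bad
    · exact absurd (by rw [hq₁, h3]; simp [Ctl.part_reject]) bad
    · exact h3
  obtain ⟨X, rfl⟩ := Ctl.encode_of_symRun h3
  rw [h3] at h2
  obtain ⟨u, rfl | ⟨b, rfl⟩⟩ := exists_flatMap_symBits y
  · rw [reader_run_bits (p := .cert) (fun _ _ => rfl)] at h2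
    rcases Ctl.symRun_cert_cases u (.list .plusArgs .fresh) (.inl rfl) with h4 | h4 | h4
    · rw [h4] at h2
      simp at h2
    · rw [h4] at h2
      simp [Ctl.part_reject] at h2
    · obtain ⟨C, rfl⟩ := Ctl.certificate_of_symRun h4
      exact ⟨X, C, rfl, rfl⟩
  -- A leftover odd bit keeps the state inside the certificate part or leads to rejection.
  · exfalso
    rw [List.map_append, Transducer.run_append,
      reader_run_bits (p := .cert) (fun _ _ => rfl)] at h2
    simp only [List.map_cons, List.map_nil, Transducer.run, reader, bitStep] at h2
    split_ifs at h2 with h4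
    · rw [h4] at h2
      simp at h2
    · simp [Ctl.part_reject] at h2

theorem nameSyms_append_inj {a b : ArgName} {u v : List (Option Bool)}
    (h : nameSyms a ++ u = nameSyms b ++ v) : a = b ∧ u = v := by
  induction a generalizing b with
  | nil => cases b <;> simp_all [nameSyms]
  | cons x a ih =>
    cases b with
    | nil => simp [nameSyms] at h
    | cons y b =>
      simp only [nameSyms, List.map_cons, List.cons_append, List.cons.injEq,
        Option.some.injEq] at h
      obtain ⟨h1, h2⟩ := ih h.2
      exact ⟨by rw [h.1, h1], h2⟩

/-- End markers make columns uniquely decodable, so the lists in `Accepts` are determined by the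
output of the reader. -/
theorem eq_of_columnSyms_eq {l l' : List NamePair}
    (h : ∀ c, columnSyms l c = columnSyms l' c) : l = l' := by
  induction l generalizing l' with
  | nil => exact (columnSyms_eq_nil.1 (h true).symm).symm
  | cons p l ih =>
    cases l' with
    | nil => exact columnSyms_eq_nil.1 (h true)
    | cons p' l' =>
      have key : ∀ c, component p c = component p' c ∧ columnSyms l c = columnSyms l' c := by
        intro c
        have hc := h c
        rw [columnSyms_cons, columnSyms_cons] at hc
        exact nameSyms_append_inj hc
      rw [ih fun c => (key c).2, Prod.ext (key false).1 (key true).1]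

/-! ### Acceptance by a formula, and the two complexity classes. -/

section

variable {m : ℕ}

/-- The formula `φ` accepts the instance `w` with certificate `y` and challenge `z`. -/
def Accepts (φ : Fm Sec m) (w : List InputSymbol) (y z : List Bool) : Prop :=
  reader.verdict (reader.run reader.start (events w y z)) = some true ∨
    reader.verdict (reader.run reader.start (events w y z)) = none ∧
    ∃ D : Sec → List NamePair,
      (∀ s c, reader.output reader.start (events w y z) s c = columnSyms (D s) c) ∧
      φ.Sat D fun _ => ([], [])

/-- If `z` codes no list of pairs, the condition on `l` is vacuous, in agreement with the acceptance
of malformed challenges. -/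
theorem accepts_iff {φ : Fm Sec m} {w : List InputSymbol} {y z : List Bool} :
    Accepts φ w y z ↔ ∃ X C, w = RelevanceInput.encode X ∧ y = Certificate.bits C ∧
      ∀ l, z = challengeBits l → φ.Sat (lists X C l) fun _ => ([], []) := by
  constructor
  · intro h
    obtain ⟨X, C, rfl, rfl⟩ : ∃ X C, w = RelevanceInput.encode X ∧ y = Certificate.bits C := by
      apply exists_encode_of_verdict (z := z)
      rcases h with h | h
      · rw [h]; simp
      · rw [h.1]; simp
    refine ⟨X, C, rfl, rfl, ?_⟩
    rintro l rfl
    rw [Accepts, verdict_challengeBits] at h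
    obtain h | ⟨-, D, hD, hsat⟩ := h
    · simp at h
    · have : D = lists X C l := by
        funext s
        refine eq_of_columnSyms_eq fun c => ?_
        rw [← hD, reader_output_events]
      rwa [← this]
  · rintro ⟨X, C, rfl, rfl, h⟩
    rcases verdict_encode X C z with h1 | ⟨l, rfl⟩
    · exact .inl h1
    · exact .inr ⟨verdict_challengeBits X C l, lists X C l, reader_output_events X C l,
        h l rfl⟩

/-- The map `g` renames the symbols of the encoding of pairs or triples to events. In this way the
same reader serves both classes, with empty challenge in the case of NP. -/
theorem polyTimeDecidable_accepts {φ : Fm Sec m} (hφ : φ.WellScoped (fun _ => none) = true)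
    {α Γ : Type} [Fintype Γ] {enc : α → List Γ} (g : Γ → Event) {w : α → List InputSymbol}
    {y z : α → List Bool} (henc : ∀ a, (enc a).map g = events (w a) (y a) (z a)) :
    PolyTimeDecidable enc fun a => Accepts φ (w a) (y a) (z a) := by
  refine polyTimeDecidable_of_transducer (reader.comap g) hφ ?_ ?_
  · intro a b h
    rw [Transducer.run_comap, henc] at h
    replace h : reader.verdict (reader.run reader.start (events (w a) (y a) (z a))) =
      some b := h
    simp [Accepts, h]
  · intro a h
    rw [Transducer.run_comap, henc] at h
    replace h : reader.verdict (reader.run reader.start (events (w a) (y a) (z a))) =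
      none := h
    obtain ⟨X, C, hw, hy⟩ := exists_encode_of_verdict (by rw [h]; simp)
    obtain ⟨l, hl⟩ : ∃ l, z a = challengeBits l := by
      rcases verdict_encode X C (z a) with h1 | h1
      · rw [← hw, ← hy, h] at h1
        simp at h1
      · exact h1
    have hout : ∀ s c, reader.output reader.start (events (w a) (y a) (z a)) s c =
        columnSyms (lists X C l s) c := by
      rw [hw, hy, hl]
      exact reader_output_events X C l
    refine ⟨lists X C l, fun s c => ?_, ?_⟩
    · rw [Transducer.output_comap, henc]
      exact hout s c
    · simp only [Accepts, h, reduceCtorEq, true_and, false_or]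
      constructor
      · exact fun hsat => ⟨_, hout, hsat⟩
      · rintro ⟨D, hD, hsat⟩
        have : D = lists X C l := by
          funext s
          refine eq_of_columnSyms_eq fun c => ?_
          rw [← hD, hout]
        rwa [← this]

theorem inNP_of_formula {φ : Fm Sec m} (hφ : φ.WellScoped (fun _ => none) = true)
    {L : Set (List InputSymbol)} (p : Polynomial ℕ)
    (h : ∀ w, w ∈ L ↔ ∃ X C, w = RelevanceInput.encode X ∧
      (Certificate.bits C).length ≤ p.eval w.length ∧
      φ.Sat (lists X C []) fun _ => ([], [])) : InNP L := by
  refine ⟨p,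
    fun a : List InputSymbol × List Bool => Accepts φ a.1 a.2 [],
    polyTimeDecidable_accepts hφ (α := List InputSymbol × List Bool) (Sum.map id Sum.inl)
      (w := fun a => a.1) (y := fun a => a.2) (z := fun _ => []) ?_, ?_⟩
  · rintro ⟨w, y⟩
    simp [Computability.encodingProd, Computability.encodingList, events, Function.comp_def]
  · intro w
    rw [h]
    -- Only the empty list has an empty code, since every pair contributes its end markers.
    have hnil : ∀ l, [] = challengeBits l → l = [] := by
      intro l hl
      cases l with
      | nil => rfl
      | cons p l =>
        have := congrArg List.length hl
        rcases p with ⟨_ | _, _⟩ <;> simp [challengeBits, encodeAtt, encodeName, symBits] at this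
    constructor
    · rintro ⟨X, C, rfl, hlen, hsat⟩
      refine ⟨C.bits, hlen, accepts_iff.2 ⟨X, C, rfl, rfl, fun l hl => ?_⟩⟩
      rwa [hnil l hl]
    · rintro ⟨y, hlen, hy⟩
      obtain ⟨X, C, rfl, rfl, hsat⟩ := accepts_iff.1 hy
      exact ⟨X, C, rfl, hlen, hsat [] rfl⟩

theorem inSigmaTwo_of_formula {φ : Fm Sec m} (hφ : φ.WellScoped (fun _ => none) = true)
    {L : Set (List InputSymbol)} (p : Polynomial ℕ)
    (h : ∀ w, w ∈ L ↔ ∃ X C, w = RelevanceInput.encode X ∧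
      (Certificate.bits C).length ≤ p.eval w.length ∧
      ∀ l, (challengeBits l).length ≤ p.eval w.length →
        φ.Sat (lists X C l) fun _ => ([], [])) : InSigmaTwo L := by
  refine ⟨p,
    fun a : List InputSymbol × List Bool × List Bool => Accepts φ a.1 a.2.1 a.2.2,
    polyTimeDecidable_accepts hφ (α := List InputSymbol × List Bool × List Bool) id
      (w := fun a => a.1) (y := fun a => a.2.1) (z := fun a => a.2.2) ?_, ?_⟩
  · rintro ⟨w, y, z⟩
    simp [Computability.encodingProd, Computability.encodingList, events]
  · intro w
    rw [h]
    constructor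
    · rintro ⟨X, C, rfl, hlen, hsat⟩
      refine ⟨C.bits, hlen, fun z hz => accepts_iff.2 ⟨X, C, rfl, rfl, ?_⟩⟩
      rintro l rfl
      exact hsat l hz
    · rintro ⟨y, hlen, hy⟩
      -- The empty challenge yields an instance and a certificate; injectivity of the encodings
      -- shows below that every other challenge yields the same ones.
      obtain ⟨X, C, rfl, rfl, -⟩ := accepts_iff.1 (hy [] (by simp))
      refine ⟨X, C, rfl, hlen, fun l hl => ?_⟩
      obtain ⟨X', C', hX, hC, hsat⟩ := accepts_iff.1 (hy (challengeBits l) hl)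
      have hC' : C = C' := by
        have h1 : C.encode = C'.encode := flatMap_symBits_injective hC
        simp only [Certificate.encode] at h1
        obtain ⟨e1, h1⟩ := encodeAtts_append_inj h1
        obtain ⟨e2, h1⟩ := encodeAtts_append_inj h1
        obtain ⟨e3, h1⟩ := encodeAtts_append_inj h1
        obtain ⟨e4, h1⟩ := encodeAtts_append_inj h1
        obtain ⟨e5, h1⟩ := encodeAtts_append_inj h1
        obtain ⟨e6, -⟩ := encodeAtts_append_inj (congrArg (· ++ []) h1)
        cases C; cases C'
        simp_all
      rw [encode_injective hX, hC']
      exact hsat l rfl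

end

end StackProgram

/-! ### Grounded extensions and completions -/

namespace AF

variable {α : Type} {F : AF α}

theorem ext {F G : AF α} (h₁ : F.args = G.args) (h₂ : F.att = G.att) : F = G := by
  cases F; cases G; simp_all

theorem defended_mono {S T : Set α} (h : S ⊆ T) : F.defended S ⊆ F.defended T := by
  rintro a ⟨ha, hd⟩
  refine ⟨ha, fun b hb => ?_⟩
  obtain ⟨c, hc, hcb⟩ := hd b hb
  exact ⟨c, h hc, hcb⟩

theorem conflictFree_mono {S T : Set α} (h : S ⊆ T) (hT : F.ConflictFree T) :
    F.ConflictFree S := by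
  rw [ConflictFree, Set.eq_empty_iff_forall_notMem] at hT ⊢
  rintro a ⟨ha, ha', b, hb, hba⟩
  exact hT a ⟨h ha, ha', b, h hb, hba⟩

/-- The strict order `r` shows that each element of `S` can be defended by earlier elements. -/
structure Ranked (F : AF α) (S : Set α) (r : Set (α × α)) : Prop where
  irrefl : ∀ p ∈ r, p.1 ≠ p.2
  trans : ∀ p ∈ r, ∀ q ∈ r, p.2 = q.1 → (p.1, q.2) ∈ r
  defends : ∀ p ∈ F.att, p.2 ∈ S → ∃ q ∈ F.att, q.2 = p.1 ∧ q.1 ∈ S ∧ (q.1, p.2) ∈ r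

/-- On a finite `S` the strict order is well-founded. If a complete `T` contains all earlier
elements, these answer every attack on `a`, so `T` defends `a` and hence contains it. -/
theorem Ranked.mem_grounded {S : Set α} {r : Set (α × α)} (h : F.Ranked S r) (hS : S.Finite)
    (hco : S ∈ F.complete) : S ∈ F.grounded := by
  refine ⟨hco, fun T hT hTS => ?_⟩
  have : IsStrictOrder α fun a b => (a, b) ∈ r :=
    { irrefl := fun a ha => h.irrefl _ ha rfl
      trans := fun a b c hab hbc => h.trans _ hab _ hbc rfl }
  have hwf := hS.wellFoundedOn (r := fun a b => (a, b) ∈ r)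
  intro a ha
  refine hwf.induction (P := fun a => a ∈ T) ha fun a ha ih => ?_
  refine hT.2 a ⟨hco.1.1 ha, fun b hb => ?_⟩
  obtain ⟨⟨c, d⟩, hq, rfl, hcS, hr⟩ := h.defends _ hb ha
  exact ⟨c, ih c hcS hr, hq⟩

/-- The stages of the least fixed point iteration of the characteristic function. -/
def stage (F : AF α) (n : ℕ) : Set α :=
  F.defended^[n] ∅

theorem stage_succ (n : ℕ) : F.stage (n + 1) = F.defended (F.stage n) :=
  Function.iterate_succ_apply' _ _ _

theorem stage_mono : Monotone F.stage := by
  refine monotone_nat_of_le_succ fun n => ?_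
  induction n with
  | zero => exact Set.empty_subset _
  | succ n ih =>
    rw [stage_succ, stage_succ]
    exact defended_mono ih

theorem stage_subset {S : Set α} (hS : S ∈ F.complete) (n : ℕ) : F.stage n ⊆ S := by
  induction n with
  | zero => exact Set.empty_subset _
  | succ n ih =>
    rw [stage_succ]
    exact fun a ha => hS.2 a (defended_mono ih ha)

/-- Conflict-freeness is inherited from `S`, and each stage is defended by its predecessor. For
closure, the finiteness of the attack relation gives one stage that contains all the
counterattackers needed. -/
theorem iUnion_stage_mem_complete {S : Set α} (hS : S ∈ F.complete) (hF : F.att.Finite) :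
    (⋃ n, F.stage n) ∈ F.complete := by
  have hsub : (⋃ n, F.stage n) ⊆ S := Set.iUnion_subset (stage_subset hS)
  refine ⟨⟨hsub.trans hS.1.1, conflictFree_mono hsub hS.1.2.1, ?_⟩, ?_⟩
  · refine Set.iUnion_subset fun n => ?_
    refine (stage_mono (Nat.le_succ n)).trans ?_
    rw [stage_succ]
    exact defended_mono (Set.subset_iUnion F.stage n)
  · rintro a ⟨ha, hd⟩
    -- The stage is chosen for all attacks, with the dummy value `0` for those on other arguments,
    -- so that `f` can be bounded on the finite set of attacks.
    have key : ∀ p ∈ F.att, ∃ n, p.2 = a → ∃ c ∈ F.stage n, (c, p.1) ∈ F.att := by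
      rintro ⟨b, a'⟩ hp
      by_cases haa : a' = a
      · subst haa
        obtain ⟨c, hc, hcb⟩ := hd b hp
        obtain ⟨n, hn⟩ := Set.mem_iUnion.1 hc
        exact ⟨n, fun _ => ⟨c, hn, hcb⟩⟩
      · exact ⟨0, fun h => absurd h haa⟩
    choose! f hf using key
    obtain ⟨N, hN⟩ := (hF.image f).bddAbove
    refine Set.mem_iUnion.2 ⟨N + 1, ?_⟩
    rw [stage_succ]
    refine ⟨ha, fun b hb => ?_⟩
    obtain ⟨c, hc, hcb⟩ := hf (b, a) hb rfl
    exact ⟨c, stage_mono (hN ⟨_, hb, rfl⟩) hc, hcb⟩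

/-- By minimality `S` is contained in the union of the stages. Ordering its elements by the first
stage in which they occur works, because membership in stage `n + 1` means being defended by stage
`n`. -/
theorem exists_ranked {S : Set α} (hS : S ∈ F.grounded) (hF : F.att.Finite) :
    ∃ r ⊆ S ×ˢ S, F.Ranked S r := by
  have hco : S ∈ F.complete := hS.1
  have hsub : S ⊆ ⋃ n, F.stage n :=
    hS.2 (iUnion_stage_mem_complete hco hF) (Set.iUnion_subset (stage_subset hco))
  let rank : α → ℕ := fun a => sInf {n | a ∈ F.stage n}
  refine ⟨{p | p.1 ∈ S ∧ p.2 ∈ S ∧ rank p.1 < rank p.2}, fun p hp => ⟨hp.1, hp.2.1⟩, ?_, ?_, ?_⟩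
  · rintro p ⟨-, -, hp⟩ h
    rw [h] at hp
    exact lt_irrefl _ hp
  · rintro p ⟨hp1, hp2, hp3⟩ q ⟨hq1, hq2, hq3⟩ h
    refine ⟨hp1, hq2, hp3.trans ?_⟩
    rw [h]
    exact hq3
  · rintro ⟨b, a⟩ hp ha
    have hmem : a ∈ F.stage (rank a) := Nat.sInf_mem (Set.mem_iUnion.1 (hsub ha))
    cases hn : rank a with
    | zero =>
      rw [hn] at hmem
      exact absurd hmem (Set.notMem_empty a)
    | succ n =>
      rw [hn, stage_succ] at hmem
      obtain ⟨c, hc, hcb⟩ := hmem.2 b hp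
      have hcS := stage_subset hco n hc
      refine ⟨(c, b), hcb, rfl, hcS, hcS, ha, ?_⟩
      change rank c < rank a
      rw [hn]
      exact Nat.lt_succ_of_le (Nat.sInf_le hc)

end AF

/-! ### The pairs of frameworks obtained by adding and removing the element. -/

namespace IAF

variable {α : Type}

theorem uargs_eq_of_uncertain {I : IAF α} {e : α ⊕ α × α} (h : I.uncertain = {e}) :
    I.uargs = {a | Sum.inl a = e} := by
  ext a
  have := Set.ext_iff.1 h (.inl a)
  simpa [uncertain] using this

theorem uatt_eq_of_uncertain {I : IAF α} {e : α ⊕ α × α} (h : I.uncertain = {e}) :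
    I.uatt = {r | Sum.inr r = e} := by
  ext r
  have := Set.ext_iff.1 h (.inr r)
  simpa [uncertain] using this

/-- `F` and `G` are the certain parts of `I' + {e}` and `I' - {e}`, for a partial completion `I'`
of `I` with the only uncertain element `e`. -/
def CompletesTo (I : IAF α) (e : α ⊕ α × α) (F G : AF α) : Prop :=
  ∃ I' ∈ I.part, ∃ he : e ∈ I'.uncertain, I'.uncertain = {e} ∧
    (I'.addElem e he).cert = F ∧ (I'.removeElem e).cert = G

/-- A description of `IAF.CompletesTo`, where `EA` and `ER` contain the uncertain argument or
attack. -/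
structure Completion (A U : Set α) (R Q : Set (α × α)) (EA : Set α) (ER : Set (α × α))
    (P : Set α) (Rp : Set (α × α)) (M : Set α) (Rm : Set (α × α)) : Prop where
  args_subset : A ⊆ M
  subset_args : M ⊆ A ∪ U
  disjoint : ∀ a ∈ M, a ∉ EA
  plus_args : ∀ a, a ∈ P ↔ a ∈ M ∨ a ∈ EA
  plus_att : ∀ r ∈ Rp, r.1 ∈ P ∧ r.2 ∈ P ∧ (r ∈ R ∨ r ∈ Q)
  att_subset : ∀ r ∈ R, r.1 ∈ P → r.2 ∈ P → r ∈ Rp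
  elem_subset : ER ⊆ Rp
  minus_att : ∀ r, r ∈ Rm ↔ r ∈ Rp ∧ r ∉ ER ∧ r.1 ∈ M ∧ r.2 ∈ M

/-- The intermediate completion can be eliminated because `F` and `G` determine it: its certain
arguments are those of `G`, and its certain attacks are those of `F` other than `e`. -/
theorem completesTo_iff {I : IAF α} {e : α ⊕ α × α} (he : e ∈ I.uncertain) {F G : AF α} :
    I.CompletesTo e F G ↔ Completion I.args I.uargs I.att I.uatt {a | Sum.inl a = e}
      {r | Sum.inr r = e} F.args F.att G.args G.att := by
  constructor
  · rintro ⟨I', ⟨⟨h1, h2⟩, ⟨h3, h4⟩, h5, h6⟩, he', hunc, rfl, rfl⟩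
    have hua := uargs_eq_of_uncertain hunc
    have hut := uatt_eq_of_uncertain hunc
    have hdis := Set.disjoint_left.1 I'.args_disjoint
    have hdis' := Set.disjoint_left.1 I'.att_disjoint
    have hatt := I'.att_subset
    have huatt := I'.uatt_subset
    rcases e with a | r
    · have hua' : I'.uargs = {a} := by simpa using hua
      have hut' : I'.uatt = ∅ := by simpa using hut
      rw [hua'] at hdis hatt h3
      constructor
      · exact h1
      · exact h2
      · intro b hb hba
        exact hdis hb (by simpa using hba)
      · intro b
        simp [addElem, removeElem, cert, addArgs, removeArgs, or_comm]
      · intro p hp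
        simp only [addElem, cert, addArgs, Set.mem_inter_iff, Set.mem_prod] at hp
        exact ⟨hp.2.1, hp.2.2, h4 hp.1⟩
      · intro p hp hp1 hp2
        exact ⟨h3 ⟨hp, hp1, hp2⟩, hp1, hp2⟩
      · simp
      · intro p
        simp only [removeElem, removeArgs, cert, related, addElem, addArgs, Set.mem_inter_iff,
          Set.mem_sdiff, Set.mem_ofPred_eq, Set.mem_prod, Set.mem_union, Set.mem_singleton_iff,
          reduceCtorEq, not_false_eq_true, true_and]
        constructor
        · rintro ⟨⟨hp, -⟩, hp1, hp2⟩
          exact ⟨⟨hp, .inl hp1, .inl hp2⟩, hp1, hp2⟩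
        · rintro ⟨⟨hp, -⟩, hp1, hp2⟩
          refine ⟨⟨hp, ?_⟩, hp1, hp2⟩
          rintro (h | h)
          · exact hdis hp1 h
          · exact hdis hp2 h
    · have hua' : I'.uargs = ∅ := by simpa using hua
      have hut' : I'.uatt = {r} := by simpa using hut
      -- When `e` is an attack, no argument is uncertain. Both endpoints of `e` are thus certain,
      -- and `e` survives in the certain part of `I' + {e}`.
      rw [hua', Set.union_empty] at hatt h3 huatt
      rw [hut'] at huatt hdis'
      have hr : r ∈ I.uatt := mem_uatt he
      have hr' := huatt rfl
      constructor
      · exact h1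
      · exact h2
      · simp
      · simp [addElem, removeElem, cert, addAtts, removeAtts]
      · intro p hp
        simp only [addElem, cert, addAtts, Set.mem_inter_iff, Set.mem_prod, Set.mem_union,
          Set.mem_singleton_iff] at hp
        refine ⟨hp.2.1, hp.2.2, ?_⟩
        rcases hp.1 with hp | rfl
        · exact h4 hp
        · exact .inr hr
      · intro p hp hp1 hp2
        exact ⟨.inl (h3 ⟨hp, hp1, hp2⟩), hp1, hp2⟩
      · rintro p hp
        obtain rfl : p = r := by simpa using hp
        exact ⟨.inr rfl, hr'⟩
      · intro p
        simp only [removeElem, removeAtts, cert, addElem, addAtts, Set.mem_inter_iff,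
          Set.mem_ofPred_eq, Set.mem_prod, Set.mem_union, Set.mem_singleton_iff, Sum.inr.injEq]
        constructor
        · rintro ⟨hp, hp1, hp2⟩
          refine ⟨⟨.inl hp, hp1, hp2⟩, ?_, hp1, hp2⟩
          rintro rfl
          exact hdis' hp rfl
        · rintro ⟨⟨hp, -⟩, hpr, hp1, hp2⟩
          exact ⟨hp.resolve_right hpr, hp1, hp2⟩
  · intro h
    have hFatt := F.att_subset
    have hP : F.args = G.args ∪ {a | Sum.inl a = e} := Set.ext h.plus_args
    let I' : IAF α :=
      { args := G.args
        uargs := {a | Sum.inl a = e}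
        att := F.att \ {r | Sum.inr r = e}
        uatt := {r | Sum.inr r = e}
        args_disjoint := Set.disjoint_left.2 h.disjoint
        att_disjoint := Set.disjoint_sdiff_left
        att_subset := by
          rw [← hP]
          exact Set.sdiff_subset.trans hFatt
        uatt_subset := by
          rw [← hP]
          exact h.elem_subset.trans hFatt }
    have hunc : I'.uncertain = {e} := by
      ext x
      rcases x with a | r <;> simp [uncertain, I']
    have he' : e ∈ I'.uncertain := by rw [hunc]; rfl
    refine ⟨I', ⟨⟨h.args_subset, h.subset_args⟩, ⟨?_, ?_⟩, ?_, ?_⟩, he', hunc, ?_, ?_⟩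
    · rintro p ⟨hp, hp'⟩
      change p ∈ (G.args ∪ {a | Sum.inl a = e}) ×ˢ (G.args ∪ {a | Sum.inl a = e}) at hp'
      rw [← hP] at hp'
      -- A certain attack of `I` differs from `e`, which is uncertain in `I`; removing `e` from
      -- `F.att` loses none of them.
      refine ⟨h.att_subset p hp hp'.1 hp'.2, ?_⟩
      rintro rfl
      exact Set.disjoint_left.1 I.att_disjoint hp (mem_uatt he)
    · rintro p ⟨hp, -⟩
      exact (h.plus_att p hp).2.2
    · intro a ha
      exact mem_uargs (by rwa [show Sum.inl a = e from ha])
    · intro r hr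
      exact mem_uatt (by rwa [show Sum.inr r = e from hr])
    · rcases e with a | r
      · refine AF.ext ?_ ?_
        · change G.args ∪ {a} = F.args
          rw [hP]
          simp
        · change (F.att \ {r | Sum.inr r = Sum.inl a}) ∩ ((G.args ∪ {a}) ×ˢ (G.args ∪ {a})) = F.att
          have : G.args ∪ {a} = F.args := by rw [hP]; simp
          rw [this]
          simpa using hFatt
      · have hP' : F.args = G.args := by rw [hP]; simp
        refine AF.ext hP'.symm ?_
        change ((F.att \ {p | Sum.inr p = Sum.inr r}) ∪ {r}) ∩ (G.args ×ˢ G.args) = F.att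
        rw [← hP']
        have hr : r ∈ F.att := h.elem_subset rfl
        have : (F.att \ {p | Sum.inr p = (Sum.inr r : α ⊕ α × α)}) ∪ {r} = F.att := by
          ext p
          by_cases hp : p = r <;> simp [hp, hr]
        rw [this]
        exact Set.inter_eq_left.2 hFatt
    · have hG : ∀ p, p ∈ G.att ↔ _ := h.minus_att
      rcases e with a | r
      · refine AF.ext rfl ?_
        ext p
        rw [hG]
        have hdis := h.disjoint
        simp only [Set.mem_ofPred_eq, Sum.inl.injEq] at hdis
        simp only [removeElem, removeArgs, cert, related, I', Set.mem_inter_iff,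
          Set.mem_sdiff, Set.mem_ofPred_eq, Set.mem_prod, Set.mem_singleton_iff,
          reduceCtorEq, not_false_eq_true, and_true, true_and]
        constructor
        · rintro ⟨⟨hp, -⟩, hp1, hp2⟩
          exact ⟨hp, hp1, hp2⟩
        · rintro ⟨hp, hp1, hp2⟩
          refine ⟨⟨hp, ?_⟩, hp1, hp2⟩
          rintro (h' | h')
          · exact hdis _ hp1 h'
          · exact hdis _ hp2 h'
      · refine AF.ext rfl ?_
        ext p
        rw [hG]
        simp only [removeElem, removeAtts, cert, I', Set.mem_inter_iff, Set.mem_sdiff,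
          Set.mem_prod, and_assoc]

/-- Addition for `true` and removal for `false` both require `S` to be an extension of `F` and not
of `G`; the other two combinations exchange the roles. The equivalence between action and truth
value separates these cases. -/
theorem relevant_iff {I : IAF α} {S : Set α} {σ : Semantics} {b : Bool} {action : RelAction}
    {e : α ⊕ α × α} :
    I.Relevant S (σ, b) action e ↔ ∃ F G, I.CompletesTo e F G ∧
      ((action = .addition ↔ b = true) → S ∈ σ.extensions F ∧ S ∉ σ.extensions G) ∧
      (¬ (action = .addition ↔ b = true) → S ∈ σ.extensions G ∧ S ∉ σ.extensions F) := by
  constructor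
  · rintro ⟨I', hI', he, hunc, h⟩
    refine ⟨_, _, ⟨I', hI', he, hunc, rfl, rfl⟩, ?_⟩
    cases action <;> cases b <;> simp_all [AF.HasStatus]
  · rintro ⟨F, G, ⟨I', hI', he, hunc, rfl, rfl⟩, h⟩
    refine ⟨I', hI', he, hunc, ?_⟩
    cases action <;> cases b <;> simp_all [AF.HasStatus]

end IAF

/-! ### Verification conditions and their formulas -/

namespace AF

variable {α : Type} {F : AF α} {S : Set α}

theorem conflictFree_iff : F.ConflictFree S ↔ ∀ p ∈ F.att, ¬ (p.1 ∈ S ∧ p.2 ∈ S) := by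
  simp only [ConflictFree, plus, Set.eq_empty_iff_forall_notMem, Set.mem_inter_iff,
    Set.mem_ofPred_eq]
  constructor
  · rintro h ⟨a, b⟩ hp ⟨ha, hb⟩
    exact h b ⟨hb, (F.att_subset hp).2, a, ha, hp⟩
  · rintro h a ⟨ha, -, b, hb, hba⟩
    exact h _ hba ⟨hb, ha⟩

/-- Attackers are replaced by attacks, so that all quantifiers range over the given lists. -/
theorem mem_defended_iff {a : α} : a ∈ F.defended S ↔ a ∈ F.args ∧
    ∀ p ∈ F.att, p.2 = a → ∃ q ∈ F.att, q.2 = p.1 ∧ q.1 ∈ S := by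
  constructor
  · rintro ⟨ha, h⟩
    refine ⟨ha, ?_⟩
    rintro ⟨b, _⟩ hb rfl
    obtain ⟨c, hc, hcb⟩ := h b hb
    exact ⟨_, hcb, rfl, hc⟩
  · rintro ⟨ha, h⟩
    refine ⟨ha, fun b hb => ?_⟩
    obtain ⟨⟨c, d⟩, hq, rfl, hc⟩ := h _ hb rfl
    exact ⟨c, hc, hq⟩

theorem mem_admissible_iff : S ∈ F.admissible ↔ S ⊆ F.args ∧
    (∀ p ∈ F.att, ¬ (p.1 ∈ S ∧ p.2 ∈ S)) ∧
    ∀ a ∈ S, ∀ p ∈ F.att, p.2 = a → ∃ q ∈ F.att, q.2 = p.1 ∧ q.1 ∈ S := by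
  simp only [admissible, Set.mem_ofPred_eq, conflictFree_iff, Set.subset_def (s := S),
    mem_defended_iff]
  grind

theorem mem_stable_iff : S ∈ F.stable ↔ S ⊆ F.args ∧
    (∀ p ∈ F.att, ¬ (p.1 ∈ S ∧ p.2 ∈ S)) ∧
    ∀ a ∈ F.args, a ∉ S → ∃ q ∈ F.att, q.2 = a ∧ q.1 ∈ S := by
  simp only [stable, Set.mem_ofPred_eq, conflictFree_iff]
  refine and_congr_right fun h1 => and_congr_right fun h2 => ?_
  constructor
  · intro h a ha haS
    have hmem : a ∈ F.args \ S := ⟨ha, haS⟩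
    rw [← h] at hmem
    obtain ⟨-, b, hb, hba⟩ := hmem
    exact ⟨_, hba, rfl, hb⟩
  · intro h
    ext a
    constructor
    · rintro ⟨ha, b, hb, hba⟩
      exact ⟨ha, fun haS => h2 _ hba ⟨hb, haS⟩⟩
    · rintro ⟨ha, haS⟩
      obtain ⟨⟨b, c⟩, hq, rfl, hb⟩ := h a ha haS
      exact ⟨ha, b, hb, hq⟩

theorem mem_complete_iff : S ∈ F.complete ↔ S ∈ F.admissible ∧
    ∀ a ∈ F.args, (∀ p ∈ F.att, p.2 = a → ∃ q ∈ F.att, q.2 = p.1 ∧ q.1 ∈ S) → a ∈ S := by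
  simp only [complete, Set.mem_ofPred_eq, mem_defended_iff]
  grind

/-- The condition on a ranking `r` and a competing set `C` that is used to verify that `S` is a
`σ`-extension. -/
def Confirms (F : AF α) (S : Set α) (r : Set (α × α)) (C : Set α) : Semantics → Prop
  | .ad => S ∈ F.admissible
  | .st => S ∈ F.stable
  | .co => S ∈ F.complete
  | .gr => S ∈ F.complete ∧ F.Ranked S r
  | .pr => S ∈ F.admissible ∧ ¬ (C ∈ F.admissible ∧ S ⊆ C ∧ ¬ C ⊆ S)

/-- The condition on a competing set `W` that is used to verify that `S` is not a
`σ`-extension. -/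
def Refutes (F : AF α) (S W : Set α) : Semantics → Prop
  | .ad => S ∉ F.admissible
  | .st => S ∉ F.stable
  | .co => S ∉ F.complete
  | .gr => S ∉ F.complete ∨ (W ∈ F.complete ∧ W ⊆ S ∧ ¬ S ⊆ W)
  | .pr => S ∉ F.admissible ∨ (W ∈ F.admissible ∧ S ⊆ W ∧ ¬ W ⊆ S)

theorem exists_confirms {σ : Semantics} (h : S ∈ σ.extensions F) (hF : F.att.Finite) :
    ∃ r ⊆ S ×ˢ S, ∀ C, F.Confirms S r C σ := by
  cases σ with
  | ad => exact ⟨∅, Set.empty_subset _, fun _ => h⟩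
  | st => exact ⟨∅, Set.empty_subset _, fun _ => h⟩
  | co => exact ⟨∅, Set.empty_subset _, fun _ => h⟩
  | gr =>
    obtain ⟨r, hr, hS⟩ := exists_ranked h hF
    exact ⟨r, hr, fun _ => ⟨Minimal.prop h, hS⟩⟩
  | pr =>
    refine ⟨∅, Set.empty_subset _, fun C => ⟨Maximal.prop h, ?_⟩⟩
    rintro ⟨hC, h1, h2⟩
    exact h2 (Maximal.le_of_ge h hC h1)

/-- Competitors inside `F.args` suffice, because admissible sets consist of arguments. This keeps
the challenges short. -/
theorem mem_extensions_of_confirms {σ : Semantics} {r : Set (α × α)} (hS : S.Finite)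
    (h : ∀ C ⊆ F.args, F.Confirms S r C σ) : S ∈ σ.extensions F := by
  have h0 := h ∅ (Set.empty_subset _)
  cases σ with
  | ad => exact h0
  | st => exact h0
  | co => exact h0
  | gr => exact h0.2.mem_grounded hS h0.1
  | pr =>
    refine ⟨h0.1, fun C hC h1 => ?_⟩
    by_contra h2
    exact (h C hC.1).2 ⟨hC, h1, h2⟩

/-- Only the preferred semantics looks at the competitor. For the others one value of it decides,
which removes the universal quantifier. -/
theorem Confirms.congr {σ : Semantics} (hσ : σ ≠ .pr) {r : Set (α × α)} {C : Set α}
    (h : F.Confirms S r C σ) (C' : Set α) : F.Confirms S r C' σ := by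
  cases σ <;> first | exact h | exact absurd rfl hσ

/-- If the basic property holds, then what fails is minimality or maximality, and this failure is a
competitor. -/
theorem exists_refutes {σ : Semantics} (h : S ∉ σ.extensions F) :
    ∃ W ⊆ F.args, F.Refutes S W σ := by
  cases σ with
  | ad => exact ⟨∅, Set.empty_subset _, h⟩
  | st => exact ⟨∅, Set.empty_subset _, h⟩
  | co => exact ⟨∅, Set.empty_subset _, h⟩
  | gr =>
    by_cases hS : S ∈ F.complete
    · have : ∃ W, W ∈ F.complete ∧ W ⊆ S ∧ ¬ S ⊆ W := by
        by_contra hW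
        push Not at hW
        exact h ⟨hS, fun W => hW W⟩
      obtain ⟨W, hW⟩ := this
      exact ⟨W, hW.1.1.1, .inr hW⟩
    · exact ⟨∅, Set.empty_subset _, .inl hS⟩
  | pr =>
    by_cases hS : S ∈ F.admissible
    · have : ∃ W, W ∈ F.admissible ∧ S ⊆ W ∧ ¬ W ⊆ S := by
        by_contra hW
        push Not at hW
        exact h ⟨hS, fun W => hW W⟩
      obtain ⟨W, hW⟩ := this
      exact ⟨W, hW.1.1, .inr hW⟩
    · exact ⟨∅, Set.empty_subset _, .inl hS⟩

theorem notMem_extensions_of_refutes {σ : Semantics} {W : Set α} (h : F.Refutes S W σ) :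
    S ∉ σ.extensions F := by
  intro hS
  cases σ with
  | ad => exact h hS
  | st => exact h hS
  | co => exact h hS
  | gr =>
    rcases h with h | ⟨h1, h2, h3⟩
    · exact h (Minimal.prop hS)
    · exact h3 (Minimal.le_of_le hS h1 h2)
  | pr =>
    rcases h with h | ⟨h1, h2, h3⟩
    · exact h (Maximal.prop hS)
    · exact h3 (Maximal.le_of_ge hS h1 h2)

end AF

namespace StackProgram

/-! ### Derived connectives and membership formulas. -/

section Connectives

variable {I : Type} {m : ℕ} {D : I → List NamePair} {ρ : Fin m → NamePair} {φ ψ : Fm I m}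

namespace Fm

def or (φ ψ : Fm I m) : Fm I m := .not (.and (.not φ) (.not ψ))

def imp (φ ψ : Fm I m) : Fm I m := .not (.and φ (.not ψ))

def all (s : I) (i : Fin m) (φ : Fm I m) : Fm I m := .not (.ex s i (.not φ))

@[simp]
theorem sat_eq {x y : Fin m × Bool} :
    (eq x y : Fm I m).Sat D ρ ↔ component (ρ x.1) x.2 = component (ρ y.1) y.2 := Iff.rfl

@[simp]
theorem sat_not : (not φ).Sat D ρ ↔ ¬ φ.Sat D ρ := Iff.rfl

@[simp]
theorem sat_and : (and φ ψ).Sat D ρ ↔ φ.Sat D ρ ∧ ψ.Sat D ρ := Iff.rfl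

@[simp]
theorem sat_ex {s : I} {i : Fin m} :
    (ex s i φ).Sat D ρ ↔ ∃ p ∈ D s, φ.Sat D (Function.update ρ i p) := Iff.rfl

@[simp]
theorem sat_or : (or φ ψ).Sat D ρ ↔ φ.Sat D ρ ∨ ψ.Sat D ρ := by
  simp only [or, sat_not, sat_and]
  tauto

@[simp]
theorem sat_imp : (imp φ ψ).Sat D ρ ↔ (φ.Sat D ρ → ψ.Sat D ρ) := by
  simp only [imp, sat_not, sat_and]
  tauto

@[simp]
theorem sat_all {s : I} {i : Fin m} :
    (all s i φ).Sat D ρ ↔ ∀ p ∈ D s, φ.Sat D (Function.update ρ i p) := by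
  simp [all]

/-- The first components of the pairs in a list. -/
def names (D : I → List NamePair) (s : I) : Set ArgName :=
  {a | ∃ p ∈ D s, p.1 = a}

theorem forall_mem_names {s : I} {Q : ArgName → Prop} :
    (∀ a ∈ names D s, Q a) ↔ ∀ p ∈ D s, Q p.1 := by
  simp [names]

@[simp]
theorem component_false (p : NamePair) : component p false = p.1 := rfl

@[simp]
theorem component_true (p : NamePair) : component p true = p.2 := rfl

/-- The name `x` occurs in the list `s`; the variable `i` is an auxiliary one. -/
def mem (x : Fin m × Bool) (s : I) (i : Fin m) : Fm I m :=
  .ex s i (.eq (i, false) x)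

theorem sat_mem {x : Fin m × Bool} {s : I} {i : Fin m} (h : x.1 ≠ i) :
    (mem x s i).Sat D ρ ↔ component (ρ x.1) x.2 ∈ names D s := by
  simp [mem, names, Function.update_of_ne h]

def memPair (x y : Fin m × Bool) (s : I) (i : Fin m) : Fm I m :=
  .ex s i (.and (.eq (i, false) x) (.eq (i, true) y))

theorem sat_memPair {x y : Fin m × Bool} {s : I} {i : Fin m} (hx : x.1 ≠ i) (hy : y.1 ≠ i) :
    (memPair x y s i).Sat D ρ ↔
      (component (ρ x.1) x.2, component (ρ y.1) y.2) ∈ D s := by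
  simp only [memPair, sat_ex, sat_and, sat_eq, Function.update_self, Function.update_of_ne hx,
    Function.update_of_ne hy, component_false, component_true]
  constructor
  · rintro ⟨p, hp, h1, h2⟩
    rwa [← h1, ← h2]
  · intro h
    exact ⟨_, h, rfl, rfl⟩

end Fm

end Connectives

/-! ### The argumentation semantics as formulas in four variables. -/

namespace Fm

variable {I : Type} {D : I → List NamePair} {ρ : Fin 4 → NamePair} {P R T T' O : I}

def subset (T T' : I) : Fm I 4 :=
  all T 0 (mem (0, false) T' 1)

theorem sat_subset : (subset T T').Sat D ρ ↔ names D T ⊆ names D T' := by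
  simp [subset, sat_mem, Set.subset_def, forall_mem_names]

def conflictFree (R T : I) : Fm I 4 :=
  all R 0 (not (and (mem (0, false) T 1) (mem (0, true) T 1)))

theorem sat_conflictFree : (conflictFree R T).Sat D ρ ↔
    ∀ p ∈ D R, ¬ (p.1 ∈ names D T ∧ p.2 ∈ names D T) := by
  simp [conflictFree, sat_mem]

/-- The set `T` attacks the name `x`. -/
def attacked (R T : I) (x : Fin 4 × Bool) (i : Fin 4) : Fm I 4 :=
  ex R i (and (eq (i, true) x) (mem (i, false) T 3))

theorem sat_attacked {x : Fin 4 × Bool} {i : Fin 4} (h : x.1 ≠ i) (hi : i ≠ 3) :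
    (attacked R T x i).Sat D ρ ↔
      ∃ q ∈ D R, q.2 = component (ρ x.1) x.2 ∧ q.1 ∈ names D T := by
  simp [attacked, sat_mem, hi, Function.update_of_ne h]

/-- The set `T` defends the first component of the variable `0`. -/
def defended (R T : I) : Fm I 4 :=
  all R 1 (imp (eq (1, true) (0, false)) (attacked R T (1, false) 2))

theorem sat_defended : (defended R T).Sat D ρ ↔
    ∀ p ∈ D R, p.2 = (ρ 0).1 → ∃ q ∈ D R, q.2 = p.1 ∧ q.1 ∈ names D T := by
  simp [defended, sat_attacked]

/-- In the defence clause, variable `0` is the defended name, `1` an attack on it, `2` the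
counterattack, and `3` serves the membership test. The other clauses reuse these variables, which
are free again there. -/
def admissible (P R T : I) : Fm I 4 :=
  and (subset T P) (and (conflictFree R T) (all T 0 (defended R T)))

def stable (P R T : I) : Fm I 4 :=
  and (subset T P) (and (conflictFree R T)
    (all P 0 (imp (not (mem (0, false) T 1)) (attacked R T (0, false) 1))))

def complete (P R T : I) : Fm I 4 :=
  and (admissible P R T) (all P 0 (imp (defended R T) (mem (0, false) T 1)))

def ranked (R T O : I) : Fm I 4 :=
  and (all O 0 (not (eq (0, false) (0, true)))) (and
    (all O 0 (all O 1 (imp (eq (0, true) (1, false)) (memPair (0, false) (1, true) O 2))))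
    (all R 0 (imp (mem (0, true) T 1) (ex R 1 (and (eq (1, true) (0, false))
      (and (mem (1, false) T 2) (memPair (1, false) (0, true) O 2)))))))

/-- The lists `P` and `R` give the arguments and the attacks of `F`. -/
structure Gives (D : I → List NamePair) (P R : I) (F : AF ArgName) : Prop where
  args : F.args = names D P
  att : F.att = {p | p ∈ D R}

variable {F : AF ArgName}

theorem Gives.sat_admissible (h : Gives D P R F) :
    (admissible P R T).Sat D ρ ↔ names D T ∈ F.admissible := by
  simp [admissible, AF.mem_admissible_iff, sat_subset, sat_conflictFree, sat_defended, h.args,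
    h.att, forall_mem_names]

theorem Gives.sat_stable (h : Gives D P R F) :
    (stable P R T).Sat D ρ ↔ names D T ∈ F.stable := by
  simp [stable, AF.mem_stable_iff, sat_subset, sat_conflictFree, sat_attacked, sat_mem, h.args,
    h.att, forall_mem_names]

theorem Gives.sat_complete (h : Gives D P R F) :
    (complete P R T).Sat D ρ ↔ names D T ∈ F.complete := by
  simp [complete, AF.mem_complete_iff, h.sat_admissible, sat_defended, sat_mem, h.args,
    h.att, forall_mem_names]

theorem Gives.sat_ranked (h : Gives D P R F) :
    (ranked R T O).Sat D ρ ↔ F.Ranked (names D T) {p | p ∈ D O} := by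
  simp only [ranked, sat_and, sat_all, sat_not, sat_eq, sat_imp, sat_ex]
  constructor
  · rintro ⟨h1, h2, h3⟩
    constructor
    · simpa using h1
    · simpa [sat_memPair] using h2
    · simpa [sat_memPair, sat_mem, h.att] using h3
  · rintro ⟨h1, h2, h3⟩
    refine ⟨?_, ?_, ?_⟩
    · simpa using h1
    · simpa [sat_memPair] using h2
    · simpa [sat_memPair, sat_mem, h.att] using h3

/-- The condition `AF.Confirms` for the lists `T`, `O` and `C`. -/
def confirms (P R T O C : I) : Semantics → Fm I 4
  | .ad => admissible P R T
  | .st => stable P R T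
  | .co => complete P R T
  | .gr => and (complete P R T) (ranked R T O)
  | .pr => and (admissible P R T)
      (not (and (admissible P R C) (and (subset T C) (not (subset C T)))))

/-- The condition `AF.Refutes` for the lists `T` and `W`. -/
def refutes (P R T W : I) : Semantics → Fm I 4
  | .ad => not (admissible P R T)
  | .st => not (stable P R T)
  | .co => not (complete P R T)
  | .gr => or (not (complete P R T))
      (and (complete P R W) (and (subset W T) (not (subset T W))))
  | .pr => or (not (admissible P R T))
      (and (admissible P R W) (and (subset T W) (not (subset W T))))

theorem Gives.sat_confirms (h : Gives D P R F) {C : I} {σ : Semantics} :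
    (confirms P R T O C σ).Sat D ρ ↔
      F.Confirms (names D T) {p | p ∈ D O} (names D C) σ := by
  cases σ <;> simp [confirms, AF.Confirms, h.sat_admissible, h.sat_stable, h.sat_complete,
    h.sat_ranked, sat_subset]

theorem Gives.sat_refutes (h : Gives D P R F) {W : I} {σ : Semantics} :
    (refutes P R T W σ).Sat D ρ ↔ F.Refutes (names D T) (names D W) σ := by
  cases σ <;> simp [refutes, AF.Refutes, h.sat_admissible, h.sat_stable, h.sat_complete,
    sat_subset]

end Fm

end StackProgram

/-! ### The relevance problem -/

namespace StackProgram

namespace Fm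

/-- The lists describe an instance. -/
def valid : Fm Sec 4 :=
  and (all .args 0 (not (mem (0, false) .uargs 1))) <|
  and (all .att 0 (not (memPair (0, false) (0, true) .uatt 1))) <|
  and (all .att 0 (and (or (mem (0, false) .args 1) (mem (0, false) .uargs 1))
    (or (mem (0, true) .args 1) (mem (0, true) .uargs 1)))) <|
  and (all .uatt 0 (and (or (mem (0, false) .args 1) (mem (0, false) .uargs 1))
    (or (mem (0, true) .args 1) (mem (0, true) .uargs 1)))) <|
  and (all .target 0 (or (mem (0, false) .args 1) (mem (0, false) .uargs 1))) <|
  and (subset .elemArg .uargs) (all .elemAtt 0 (memPair (0, false) (0, true) .uatt 1))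

variable {D : Sec → List NamePair} {ρ : Fin 4 → NamePair}

theorem sat_valid : valid.Sat D ρ ↔
    (∀ a ∈ names D .args, a ∉ names D .uargs) ∧ (∀ r ∈ D .att, r ∉ D .uatt) ∧
    (∀ r ∈ D .att, (r.1 ∈ names D .args ∨ r.1 ∈ names D .uargs) ∧
      (r.2 ∈ names D .args ∨ r.2 ∈ names D .uargs)) ∧
    (∀ r ∈ D .uatt, (r.1 ∈ names D .args ∨ r.1 ∈ names D .uargs) ∧
      (r.2 ∈ names D .args ∨ r.2 ∈ names D .uargs)) ∧
    (∀ a ∈ names D .target, a ∈ names D .args ∨ a ∈ names D .uargs) ∧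
    names D .elemArg ⊆ names D .uargs ∧ ∀ r ∈ D .elemAtt, r ∈ D .uatt := by
  simp [valid, sat_mem, sat_memPair, sat_subset, forall_mem_names]

/-- The condition `IAF.Completion`. -/
def completion : Fm Sec 4 :=
  and (subset .args .minusArgs) <|
  and (all .minusArgs 0 (or (mem (0, false) .args 1) (mem (0, false) .uargs 1))) <|
  and (all .minusArgs 0 (not (mem (0, false) .elemArg 1))) <|
  and (and (all .plusArgs 0 (or (mem (0, false) .minusArgs 1) (mem (0, false) .elemArg 1)))
    (and (subset .minusArgs .plusArgs) (subset .elemArg .plusArgs))) <|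
  and (all .plusAtt 0 (and (mem (0, false) .plusArgs 1) (and (mem (0, true) .plusArgs 1)
    (or (memPair (0, false) (0, true) .att 1) (memPair (0, false) (0, true) .uatt 1))))) <|
  and (all .att 0 (imp (mem (0, false) .plusArgs 1) (imp (mem (0, true) .plusArgs 1)
    (memPair (0, false) (0, true) .plusAtt 1)))) <|
  and (all .elemAtt 0 (memPair (0, false) (0, true) .plusAtt 1)) <|
  and (all .minusAtt 0 (and (memPair (0, false) (0, true) .plusAtt 1)
    (and (not (memPair (0, false) (0, true) .elemAtt 1))
      (and (mem (0, false) .minusArgs 1) (mem (0, true) .minusArgs 1)))))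
  (all .plusAtt 0 (imp (and (not (memPair (0, false) (0, true) .elemAtt 1))
      (and (mem (0, false) .minusArgs 1) (mem (0, true) .minusArgs 1)))
    (memPair (0, false) (0, true) .minusAtt 1)))

theorem sat_completion : completion.Sat D ρ ↔
    IAF.Completion (names D .args) (names D .uargs) {r | r ∈ D .att} {r | r ∈ D .uatt}
      (names D .elemArg) {r | r ∈ D .elemAtt} (names D .plusArgs) {r | r ∈ D .plusAtt}
      (names D .minusArgs) {r | r ∈ D .minusAtt} := by
  simp only [completion, sat_and, sat_all, sat_subset, sat_or, sat_not, sat_imp, sat_mem,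
    sat_memPair, Function.update_self, component_false, component_true, Prod.mk.eta, ne_eq,
    zero_ne_one, not_false_eq_true]
  constructor
  · rintro ⟨h1, h2, h3, ⟨h4, h5, h6⟩, h7, h8, h9, h10, h11⟩
    -- Each equivalence in `IAF.Completion` appears in the formula as bounded implications, one for
    -- each list that can contain the element.
    refine ⟨h1, fun a ha => ?_, ?_, fun a => ⟨?_, ?_⟩, h7, h8, h9, fun r => ⟨h10 r, ?_⟩⟩
    · exact forall_mem_names.2 h2 a ha
    · exact forall_mem_names.2 h3
    · exact forall_mem_names (Q := fun a => _ ∨ _).2 h4 a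
    · rintro (h | h)
      exacts [h5 h, h6 h]
    · rintro ⟨h, h'⟩
      exact h11 r h h'
  · intro h
    refine ⟨h.args_subset, ?_, ?_, ⟨?_, ?_, ?_⟩, h.plus_att, h.att_subset, h.elem_subset,
      fun r => (h.minus_att r).1, fun r h1 h2 => (h.minus_att r).2 ⟨h1, h2⟩⟩
    · exact forall_mem_names.1 h.subset_args
    · exact forall_mem_names.1 h.disjoint
    · exact forall_mem_names.1 fun a => (h.plus_args a).1
    · exact fun a ha => (h.plus_args a).2 (.inl ha)
    · exact fun a ha => (h.plus_args a).2 (.inr ha)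

/-- The element has to be made certain to attain the status with truth value `b`. -/
def positive : Bool → Fm Sec 4
  -- The only possible entry is the pair of empty names, for which the equation holds; so this says
  -- that the list is nonempty.
  | true => ex .addition 0 (eq (0, false) (0, true))
  | false => not (ex .addition 0 (eq (0, false) (0, true)))

theorem sat_positive {X : RelevanceInput} {C : Certificate} {l : List NamePair} {b : Bool} :
    (positive b).Sat (lists X C l) ρ ↔ (X.action = .addition ↔ b = true) := by
  cases b <;> cases h : X.action <;> simp [positive, lists, h]

/-- The order and the witness are taken from the certificate, the competitor from the challenge. The
challenge occurs only in the positive claim about `S`. -/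
def relevance (σ : Semantics) (b : Bool) : Fm Sec 4 :=
  and valid <| and completion <| and
    (imp (positive b) (and (confirms .plusArgs .plusAtt .target .order .challenge σ)
      (refutes .minusArgs .minusAtt .target .witness σ)))
    (imp (not (positive b)) (and (confirms .minusArgs .minusAtt .target .order .challenge σ)
      (refutes .plusArgs .plusAtt .target .witness σ)))

theorem relevance_wellScoped (σ : Semantics) (b : Bool) :
    (relevance σ b).WellScoped (fun _ => none) = true := by
  cases σ <;> cases b <;> decide

end Fm

open Fm

/-! ### Sets given as sublists of the lists of an instance. -/

section Selection

open Classical in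
/-- The names in `T` from a list, as pairs. -/
noncomputable def select (T : Set ArgName) (l : List ArgName) : List NamePair :=
  Ctl.diag (l.filter (· ∈ T))

open Classical in
noncomputable def selectPairs (T : Set NamePair) (l : List NamePair) : List NamePair :=
  l.filter (· ∈ T)

theorem exists_mem_diag {l : List ArgName} {a : ArgName} :
    (∃ p ∈ Ctl.diag l, p.1 = a) ↔ a ∈ l := by
  simp [Ctl.diag]

theorem exists_mem_select {T : Set ArgName} {l : List ArgName} (h : ∀ a ∈ T, a ∈ l)
    {a : ArgName} : (∃ p ∈ select T l, p.1 = a) ↔ a ∈ T := by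
  rw [select, exists_mem_diag]
  simpa using h a

theorem mem_selectPairs {T : Set NamePair} {l : List NamePair} (h : ∀ a ∈ T, a ∈ l)
    {a : NamePair} : a ∈ selectPairs T l ↔ a ∈ T := by
  simpa [selectPairs] using h a

variable (X : RelevanceInput) (C : Certificate) (l : List NamePair)

theorem names_lists_args : names (lists X C l) .args = {a | a ∈ X.args} :=
  Set.ext fun _ => exists_mem_diag

theorem names_lists_uargs : names (lists X C l) .uargs = {a | a ∈ X.uargs} :=
  Set.ext fun _ => exists_mem_diag

theorem names_lists_target : names (lists X C l) .target = X.targetSet :=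
  Set.ext fun _ => exists_mem_diag

theorem names_lists_elemArg : names (lists X C l) .elemArg = {a | Sum.inl a = X.elem} := by
  ext a
  cases h : X.elem <;> simp [names, lists, h, eq_comm]

theorem mem_lists_elemAtt : {r | r ∈ lists X C l .elemAtt} = {r | Sum.inr r = X.elem} := by
  ext r
  cases h : X.elem <;> simp [lists, h]

theorem sat_valid_lists {ρ : Fin 4 → NamePair} : valid.Sat (lists X C l) ρ ↔
    ∃ I : IAF ArgName, X.Describes I ∧ X.targetSet ⊆ I.args ∪ I.uargs ∧
      X.elem ∈ I.uncertain := by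
  rw [sat_valid, names_lists_args, names_lists_uargs, names_lists_target, names_lists_elemArg]
  have hR : ∀ r, r ∈ lists X C l .elemAtt ↔ Sum.inr r = X.elem := fun r =>
    Set.ext_iff.1 (mem_lists_elemAtt X C l) r
  simp only [hR]
  constructor
  · rintro ⟨h1, h2, h3, h4, h5, h6, h7⟩
    refine ⟨⟨{a | a ∈ X.args}, {a | a ∈ X.uargs}, {r | r ∈ X.att}, {r | r ∈ X.uatt},
      Set.disjoint_left.2 h1, Set.disjoint_left.2 h2, h3, h4⟩, ⟨rfl, rfl, rfl, rfl⟩, h5, ?_⟩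
    cases h : X.elem with
    | inl a => exact .inl ⟨a, h6 h.symm, rfl⟩
    | inr r => exact .inr ⟨r, h7 r h.symm, rfl⟩
  · rintro ⟨I, ⟨h1, h2, h3, h4⟩, hT, he⟩
    rw [← h1, ← h2]
    have e3 : ∀ r, r ∈ lists X C l .att ↔ r ∈ I.att := fun r => (Set.ext_iff.1 h3 r).symm
    have e4 : ∀ r, r ∈ lists X C l .uatt ↔ r ∈ I.uatt := fun r => (Set.ext_iff.1 h4 r).symm
    simp only [e3, e4]
    refine ⟨Set.disjoint_left.1 I.args_disjoint, Set.disjoint_left.1 I.att_disjoint,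
      I.att_subset, I.uatt_subset, hT, fun a ha => ?_, fun r hr => ?_⟩
    · exact IAF.mem_uargs (by rwa [show Sum.inl a = X.elem from ha])
    · exact IAF.mem_uatt (by rwa [hr])

variable {X C l}

theorem sat_completion_lists {I : IAF ArgName} (hI : X.Describes I) (he : X.elem ∈ I.uncertain)
    {F G : AF ArgName} (hF : Gives (lists X C l) .plusArgs .plusAtt F)
    (hG : Gives (lists X C l) .minusArgs .minusAtt G) {ρ : Fin 4 → NamePair} :
    completion.Sat (lists X C l) ρ ↔ I.CompletesTo X.elem F G := by
  rw [sat_completion, IAF.completesTo_iff he, hF.args, hF.att, hG.args, hG.att,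
    names_lists_args, names_lists_uargs, names_lists_elemArg, mem_lists_elemAtt, hI.1, hI.2.1,
    hI.2.2.1, hI.2.2.2]
  rfl

/-- Membership of an argument in a list of certain and uncertain arguments. -/
theorem mem_append_of_completesTo {I : IAF ArgName} (hI : X.Describes I)
    (he : X.elem ∈ I.uncertain) {F G : AF ArgName} (h : I.CompletesTo X.elem F G) :
    (∀ a ∈ F.args, a ∈ X.args ++ X.uargs) ∧ (∀ r ∈ F.att, r ∈ X.att ++ X.uatt) ∧
    (∀ a ∈ G.args, a ∈ X.args ++ X.uargs) ∧ (∀ r ∈ G.att, r ∈ X.att ++ X.uatt) := by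
  obtain ⟨h1, h2, h3, h4⟩ := hI
  have hc := (IAF.completesTo_iff he).1 h
  have hargs : ∀ a, a ∈ X.args ++ X.uargs ↔ a ∈ I.args ∨ a ∈ I.uargs := by
    simp [h1, h2]
  have hatt : ∀ a, a ∈ X.att ++ X.uatt ↔ a ∈ I.att ∨ a ∈ I.uatt := by
    simp [h3, h4]
  simp only [hargs, hatt]
  refine ⟨fun a ha => ?_, fun r hr => (hc.plus_att r hr).2.2, hc.subset_args,
    fun r hr => (hc.plus_att r ((hc.minus_att r).1 hr).1).2.2⟩
  rcases (hc.plus_args a).1 ha with ha | ha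
  · exact hc.subset_args ha
  · exact .inr (IAF.mem_uargs (by rwa [show Sum.inl a = X.elem from ha]))

end Selection

/-! ### The formula expresses relevance. -/

section Correctness

variable {X : RelevanceInput} {σ : Semantics} {b : Bool}

/-- It is enough to test challenges that select a set of arguments of the instance, and these have
bounded length. Apart from the preferred semantics, the empty challenge is enough. -/
theorem mem_relevanceProblem_of_sat {C : Certificate} {ρ : Fin 4 → NamePair}
    (h : ∀ T : Set ArgName, (σ ≠ .pr → T = ∅) →
      (relevance σ b).Sat (lists X C (select T (X.args ++ X.uargs))) ρ) :
    X.encode ∈ relevanceProblem (σ, b) := by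
  have h0 := h ∅ fun _ => rfl
  simp only [relevance, sat_and] at h0
  obtain ⟨hv, hc, -⟩ := h0
  obtain ⟨I, hI, hT, he⟩ := (sat_valid_lists X C _).1 hv
  have hc' := sat_completion.1 hc
  -- The certificate is an arbitrary tuple of lists; it is the completion clause that makes the
  -- attacks connect listed arguments.
  let F : AF ArgName :=
    { args := {a | ∃ p ∈ C.plusArgs, p.1 = a}
      att := {p | p ∈ C.plusAtt}
      att_subset := fun r hr => ⟨(hc'.plus_att r hr).1, (hc'.plus_att r hr).2.1⟩ }
  let G : AF ArgName :=
    { args := {a | ∃ p ∈ C.minusArgs, p.1 = a}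
      att := {p | p ∈ C.minusAtt}
      att_subset := fun r hr => ((hc'.minus_att r).1 hr).2.2 }
  have hF : ∀ l, Gives (lists X C l) .plusArgs .plusAtt F := fun l => ⟨rfl, rfl⟩
  have hG : ∀ l, Gives (lists X C l) .minusArgs .minusAtt G := fun l => ⟨rfl, rfl⟩
  have hcomp := (sat_completion_lists hI he (hF _) (hG _)).1 hc
  have hmem := mem_append_of_completesTo hI he hcomp
  have key : ∀ T : Set ArgName, (∀ a ∈ T, a ∈ X.args ++ X.uargs) → (σ ≠ .pr → T = ∅) →
      ((X.action = .addition ↔ b = true) →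
        F.Confirms X.targetSet {p | p ∈ C.order} T σ ∧
        G.Refutes X.targetSet {a | ∃ p ∈ C.witness, p.1 = a} σ) ∧
      (¬ (X.action = .addition ↔ b = true) →
        G.Confirms X.targetSet {p | p ∈ C.order} T σ ∧
        F.Refutes X.targetSet {a | ∃ p ∈ C.witness, p.1 = a} σ) := by
    intro T hTX hσ
    have h1 := h T hσ
    have hT' : names (lists X C (select T (X.args ++ X.uargs))) .challenge = T :=
      Set.ext fun _ => exists_mem_select hTX
    simp only [relevance, sat_and, sat_imp, sat_not, sat_positive, (hF _).sat_confirms,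
      (hF _).sat_refutes, (hG _).sat_confirms, (hG _).sat_refutes, names_lists_target, hT'] at h1
    exact h1.2.2
  -- The restriction to `T = ∅` is lifted by `Confirms.congr`.
  have key' : ∀ T : Set ArgName, (∀ a ∈ T, a ∈ X.args ++ X.uargs) →
      ((X.action = .addition ↔ b = true) →
        F.Confirms X.targetSet {p | p ∈ C.order} T σ ∧
        G.Refutes X.targetSet {a | ∃ p ∈ C.witness, p.1 = a} σ) ∧
      (¬ (X.action = .addition ↔ b = true) →
        G.Confirms X.targetSet {p | p ∈ C.order} T σ ∧
        F.Refutes X.targetSet {a | ∃ p ∈ C.witness, p.1 = a} σ) := by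
    intro T hTX
    by_cases hσ : σ = .pr
    · exact key T hTX fun h => absurd hσ h
    · have := key ∅ (by simp) fun _ => rfl
      exact ⟨fun hb => ⟨(this.1 hb).1.congr hσ T, (this.1 hb).2⟩,
        fun hb => ⟨(this.2 hb).1.congr hσ T, (this.2 hb).2⟩⟩
  have hfin : X.targetSet.Finite := X.target.finite_toSet
  refine ⟨X, I, rfl, hI, hT, he, IAF.relevant_iff.2 ⟨F, G, hcomp, fun hb => ⟨?_, ?_⟩,
    fun hb => ⟨?_, ?_⟩⟩⟩
  · exact AF.mem_extensions_of_confirms hfin fun T hTF =>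
      ((key' T fun a ha => hmem.1 a (hTF ha)).1 hb).1
  · exact AF.notMem_extensions_of_refutes ((key' ∅ (by simp)).1 hb).2
  · exact AF.mem_extensions_of_confirms hfin fun T hTF =>
      ((key' T fun a ha => hmem.2.2.1 a (hTF ha)).2 hb).1
  · exact AF.notMem_extensions_of_refutes ((key' ∅ (by simp)).2 hb).2

/-- The certificate that consists of the given sets. -/
noncomputable def certificateOf (X : RelevanceInput) (F G : AF ArgName) (r : Set NamePair)
    (W : Set ArgName) : Certificate where
  plusArgs := select F.args (X.args ++ X.uargs)
  plusAtt := selectPairs F.att (X.att ++ X.uatt)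
  minusArgs := select G.args (X.args ++ X.uargs)
  minusAtt := selectPairs G.att (X.att ++ X.uatt)
  order := selectPairs r (X.target ×ˢ X.target)
  witness := select W (X.args ++ X.uargs)

/-- The certificate is fixed before `l`: `AF.exists_confirms` provides one order that works against
every competitor, whatever set the challenge describes. -/
theorem exists_sat_of_relevant {I : IAF ArgName} (hI : X.Describes I)
    (hT : X.targetSet ⊆ I.args ∪ I.uargs) (he : X.elem ∈ I.uncertain)
    (h : I.Relevant X.targetSet (σ, b) X.action X.elem) :
    ∃ F G r W, ∀ l ρ, (relevance σ b).Sat (lists X (certificateOf X F G r W) l) ρ := by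
  obtain ⟨F, G, hcomp, h1, h2⟩ := IAF.relevant_iff.1 h
  have hmem := mem_append_of_completesTo hI he hcomp
  have hF : ∀ r W l, Gives (lists X (certificateOf X F G r W) l) .plusArgs .plusAtt F :=
    fun r W l => ⟨Set.ext fun a => (exists_mem_select hmem.1).symm,
      Set.ext fun p => (mem_selectPairs hmem.2.1).symm⟩
  have hG : ∀ r W l, Gives (lists X (certificateOf X F G r W) l) .minusArgs .minusAtt G :=
    fun r W l => ⟨Set.ext fun a => (exists_mem_select hmem.2.2.1).symm,
      Set.ext fun p => (mem_selectPairs hmem.2.2.2).symm⟩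
  have hFfin : F.att.Finite := (X.att ++ X.uatt).finite_toSet.subset hmem.2.1
  have hGfin : G.att.Finite := (X.att ++ X.uatt).finite_toSet.subset hmem.2.2.2
  obtain ⟨r, W, hr, hW, hb⟩ : ∃ r W, r ⊆ X.targetSet ×ˢ X.targetSet ∧
      (∀ a ∈ W, a ∈ X.args ++ X.uargs) ∧ ∀ C,
      ((X.action = .addition ↔ b = true) →
        F.Confirms X.targetSet r C σ ∧ G.Refutes X.targetSet W σ) ∧
      (¬ (X.action = .addition ↔ b = true) →
        G.Confirms X.targetSet r C σ ∧ F.Refutes X.targetSet W σ) := by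
    by_cases hb : X.action = .addition ↔ b = true
    · obtain ⟨r, hr, hC⟩ := AF.exists_confirms (h1 hb).1 hFfin
      obtain ⟨W, hW, hR⟩ := AF.exists_refutes (h1 hb).2
      exact ⟨r, W, hr, fun a ha => hmem.2.2.1 a (hW ha),
        fun C => ⟨fun _ => ⟨hC C, hR⟩, fun h => absurd hb h⟩⟩
    · obtain ⟨r, hr, hC⟩ := AF.exists_confirms (h2 hb).1 hGfin
      obtain ⟨W, hW, hR⟩ := AF.exists_refutes (h2 hb).2
      exact ⟨r, W, hr, fun a ha => hmem.1 a (hW ha),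
        fun C => ⟨fun h => absurd h hb, fun _ => ⟨hC C, hR⟩⟩⟩
  refine ⟨F, G, r, W, fun l ρ => ?_⟩
  have hW' : names (lists X (certificateOf X F G r W) l) .witness = W :=
    Set.ext fun a => exists_mem_select hW
  have hr' : {p | p ∈ lists X (certificateOf X F G r W) l .order} = r :=
    Set.ext fun p => mem_selectPairs fun p hp =>
      List.mem_product.2 ⟨(hr hp).1, (hr hp).2⟩
  simp only [relevance, sat_and, sat_imp, sat_not, sat_positive, (hF _ _ _).sat_confirms,
    (hF _ _ _).sat_refutes, (hG _ _ _).sat_confirms, (hG _ _ _).sat_refutes,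
    names_lists_target, hW', hr']
  exact ⟨(sat_valid_lists X _ _).2 ⟨I, hI, hT, he⟩,
    (sat_completion_lists hI he (hF _ _ _) (hG _ _ _)).2 hcomp, hb _⟩

end Correctness

/-! ### Polynomial bounds for certificates and challenges. -/

section Lengths

open RelevanceInput

theorem length_le_length_flatMap {α β : Type} {f : α → List β} {l : List α} {a : α}
    (h : a ∈ l) : (f a).length ≤ (l.flatMap f).length := by
  induction l with
  | nil => simp at h
  | cons b l ih =>
    simp only [List.flatMap_cons, List.length_append]
    rcases List.mem_cons.1 h with rfl | h
    · omega
    · have := ih h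
      omega

theorem length_le_length_flatMap_of_pos {α β : Type} {f : α → List β} (l : List α)
    (h : ∀ a, 1 ≤ (f a).length) : l.length ≤ (l.flatMap f).length := by
  induction l with
  | nil => simp
  | cons b l ih =>
    have := h b
    simp only [List.flatMap_cons, List.length_append, List.length_cons]
    omega

theorem length_flatMap_le {α β : Type} {f : α → List β} {l : List α} {n : ℕ}
    (h : ∀ a ∈ l, (f a).length ≤ n) : (l.flatMap f).length ≤ l.length * n := by
  induction l with
  | nil => simp
  | cons b l ih =>
    have h1 := h b List.mem_cons_self
    have h2 := ih fun a ha => h a (List.mem_cons_of_mem _ ha)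
    simp only [List.flatMap_cons, List.length_append, List.length_cons, Nat.succ_mul]
    omega

theorem length_flatMap_symBits (u : List InputSymbol) :
    (u.flatMap symBits).length = 2 * u.length := by
  induction u with
  | nil => rfl
  | cons a u ih => cases a <;> simp [symBits, ih] <;> omega

/-- The list has at most `2 * n + n * n` entries, with names of length at most `n`. -/
structure Fits (n : ℕ) (l : List NamePair) : Prop where
  length_le : l.length ≤ 2 * n + n * n
  name_le : ∀ p ∈ l, p.1.length ≤ n ∧ p.2.length ≤ n

theorem Fits.length_flatMap_encodeAtt_le {n : ℕ} {l : List NamePair} (h : Fits n l) :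
    (l.flatMap encodeAtt).length ≤ (2 * n + n * n) * (2 * (n + 1)) := by
  refine (length_flatMap_le (n := 2 * (n + 1)) fun p hp => ?_).trans
    (Nat.mul_le_mul_right _ h.length_le)
  have := h.name_le p hp
  simp only [encodeAtt, encodeName, List.length_append, List.length_map, List.length_singleton]
  omega

theorem Fits.selectPairs {n : ℕ} {l : List NamePair} (h : Fits n l) (T : Set NamePair) :
    Fits n (selectPairs T l) :=
  ⟨(List.length_filter_le _ _).trans h.length_le,
    fun p hp => h.name_le p (List.mem_of_mem_filter hp)⟩

theorem Fits.select {n : ℕ} {l : List ArgName} (h : Fits n (Ctl.diag l)) (T : Set ArgName) :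
    Fits n (select T l) := by
  refine ⟨le_trans ?_ h.length_le, fun p hp => h.name_le p ?_⟩
  · simpa [StackProgram.select, Ctl.diag] using List.length_filter_le _ _
  · simp only [StackProgram.select, Ctl.diag, List.mem_map] at hp ⊢
    obtain ⟨a, ha, rfl⟩ := hp
    exact ⟨a, List.mem_of_mem_filter ha, rfl⟩

variable (X : RelevanceInput)

theorem length_flatMap_le_encode :
    (X.args.flatMap encodeName).length ≤ X.encode.length ∧
    (X.uargs.flatMap encodeName).length ≤ X.encode.length ∧
    (X.att.flatMap encodeAtt).length ≤ X.encode.length ∧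
    (X.uatt.flatMap encodeAtt).length ≤ X.encode.length ∧
    (X.target.flatMap encodeName).length ≤ X.encode.length := by
  simp only [encode, encodeNames, encodeAtts, List.length_append]
  omega

theorem bounds_of_names {l : List ArgName} {n : ℕ} (h : (l.flatMap encodeName).length ≤ n) :
    l.length ≤ n ∧ ∀ a ∈ l, a.length ≤ n := by
  refine ⟨(length_le_length_flatMap_of_pos l fun a => ?_).trans h, fun a ha => ?_⟩
  · simp [encodeName]
  · refine le_trans ?_ ((length_le_length_flatMap (f := encodeName) ha).trans h)
    simp [encodeName]

theorem bounds_of_atts {l : List NamePair} {n : ℕ} (h : (l.flatMap encodeAtt).length ≤ n) :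
    l.length ≤ n ∧ ∀ p ∈ l, p.1.length ≤ n ∧ p.2.length ≤ n := by
  refine ⟨(length_le_length_flatMap_of_pos l fun a => ?_).trans h, fun a ha => ?_⟩
  · simp [encodeAtt, encodeName]
    omega
  · have := (length_le_length_flatMap (f := encodeAtt) ha).trans h
    simp only [encodeAtt, encodeName, List.length_append, List.length_map,
      List.length_singleton] at this
    omega

theorem fits_args : Fits X.encode.length (Ctl.diag (X.args ++ X.uargs)) := by
  obtain ⟨h1, h2, -⟩ := length_flatMap_le_encode X
  obtain ⟨a1, a2⟩ := bounds_of_names h1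
  obtain ⟨b1, b2⟩ := bounds_of_names h2
  constructor
  · simp only [Ctl.diag, List.length_map, List.length_append]
    omega
  · simp only [Ctl.diag, List.mem_map, List.mem_append]
    rintro p ⟨a, ha | ha, rfl⟩
    exacts [⟨a2 a ha, a2 a ha⟩, ⟨b2 a ha, b2 a ha⟩]

theorem fits_att : Fits X.encode.length (X.att ++ X.uatt) := by
  obtain ⟨-, -, h1, h2, -⟩ := length_flatMap_le_encode X
  obtain ⟨a1, a2⟩ := bounds_of_atts h1
  obtain ⟨b1, b2⟩ := bounds_of_atts h2
  constructor
  · simp only [List.length_append]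
    omega
  · simp only [List.mem_append]
    rintro p (hp | hp)
    exacts [a2 p hp, b2 p hp]

/-- The order is selected from all pairs of target names, which accounts for the term `n * n` in
`Fits`. -/
theorem fits_target : Fits X.encode.length (X.target ×ˢ X.target) := by
  obtain ⟨-, -, -, -, h⟩ := length_flatMap_le_encode X
  obtain ⟨a1, a2⟩ := bounds_of_names h
  constructor
  · rw [List.length_product]
    exact (Nat.mul_le_mul a1 a1).trans (Nat.le_add_left _ _)
  · rintro ⟨a, c⟩ hp
    obtain ⟨ha, hc⟩ := List.mem_product.1 hp
    exact ⟨a2 a ha, a2 c hc⟩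

/-- A bound on the lengths of certificates and challenges. -/
noncomputable def witnessBound : Polynomial ℕ :=
  -- The factor `12` stands for six lists with two bits per symbol, `2 * (X + 1)` for two names with
  -- end markers, and `+ 1` for the marker that closes a list.
  12 * ((2 * Polynomial.X + Polynomial.X * Polynomial.X) * (2 * (Polynomial.X + 1)) + 1)

theorem eval_witnessBound (n : ℕ) :
    witnessBound.eval n = 12 * ((2 * n + n * n) * (2 * (n + 1)) + 1) := by
  simp [witnessBound]

theorem length_bits_certificateOf_le (F G : AF ArgName) (r : Set NamePair) (W : Set ArgName) :
    (certificateOf X F G r W).bits.length ≤ witnessBound.eval X.encode.length := by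
  have h1 := ((fits_args X).select F.args).length_flatMap_encodeAtt_le
  have h2 := ((fits_att X).selectPairs F.att).length_flatMap_encodeAtt_le
  have h3 := ((fits_args X).select G.args).length_flatMap_encodeAtt_le
  have h4 := ((fits_att X).selectPairs G.att).length_flatMap_encodeAtt_le
  have h5 := ((fits_target X).selectPairs r).length_flatMap_encodeAtt_le
  have h6 := ((fits_args X).select W).length_flatMap_encodeAtt_le
  rw [Certificate.bits, length_flatMap_symBits, eval_witnessBound]
  simp only [Certificate.encode, certificateOf, encodeAtts, List.length_append,
    List.length_singleton]
  omega

theorem length_challengeBits_select_le (T : Set ArgName) :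
    (challengeBits (select T (X.args ++ X.uargs))).length ≤
      witnessBound.eval X.encode.length := by
  have h := ((fits_args X).select T).length_flatMap_encodeAtt_le
  rw [challengeBits, length_flatMap_symBits, eval_witnessBound]
  omega

end Lengths

theorem select_empty (l : List ArgName) : select ∅ l = [] := by
  simp [select, Ctl.diag]

theorem inNP_relevanceProblem {σ : Semantics} (hσ : σ ≠ .pr) (b : Bool) :
    InNP (relevanceProblem (σ, b)) := by
  refine inNP_of_formula (relevance_wellScoped σ b) witnessBound fun w => ⟨?_, ?_⟩
  · rintro ⟨X, I, rfl, hI, hT, he, h⟩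
    obtain ⟨F, G, r, W, hsat⟩ := exists_sat_of_relevant hI hT he h
    exact ⟨X, _, rfl, length_bits_certificateOf_le X F G r W, hsat _ _⟩
  · rintro ⟨X, C, rfl, -, hsat⟩
    refine mem_relevanceProblem_of_sat (C := C) (ρ := fun _ => ([], [])) fun T hT => ?_
    -- Without the preferred semantics, `T` is empty, and the challenge is the empty list used by
    -- the NP verifier.
    rw [hT hσ, select_empty]
    exact hsat

theorem inSigmaTwo_relevanceProblem (σ : Semantics) (b : Bool) :
    InSigmaTwo (relevanceProblem (σ, b)) := by
  refine inSigmaTwo_of_formula (relevance_wellScoped σ b) witnessBound fun w => ⟨?_, ?_⟩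
  · rintro ⟨X, I, rfl, hI, hT, he, h⟩
    obtain ⟨F, G, r, W, hsat⟩ := exists_sat_of_relevant hI hT he h
    exact ⟨X, _, rfl, length_bits_certificateOf_le X F G r W, fun l _ => hsat l _⟩
  · rintro ⟨X, C, rfl, -, hsat⟩
    exact mem_relevanceProblem_of_sat fun T _ => hsat _ (length_challengeBits_select_le X T)

end StackProgram

theorem corollary1 :
    (∀ σ ∈ ({Semantics.ad, Semantics.st, Semantics.co, Semantics.gr} : Set Semantics),
      ∀ b : Bool, InNP (relevanceProblem (σ, b))) ∧
    (∀ b : Bool, InSigmaTwo (relevanceProblem (Semantics.pr, b))) := by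
  refine ⟨fun σ hσ b => StackProgram.inNP_relevanceProblem ?_ b,
    fun b => StackProgram.inSigmaTwo_relevanceProblem .pr b⟩
  rintro rfl
  simp at hσ
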